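/- For positive integers $a,b,c$ with $\gcd(a,b,c)=1$ let $g(a,b,c)$ be the Frobenius number, that is, the largest integer that is not of the form $xa+yb+zc$ with integers $x,y,z\ge 0$ (so $g(a,b,c)=-1$ if one of $a,b,c$ equals $1$), and put $f(a,b,c)=g(a,b,c)+a+b+c$. For every real $\varepsilon>0$ there is a constant $K_\varepsilon>0$, depending only on $\varepsilon$, such that for all real $x_1,x_2,x_3>0$ and all real $N>0$ $$\left|\frac{1}{x_1x_2x_3N^{9/2}}\sum_{a\le x_1N}\ \sum_{b\le x_2N}\ \sum_{\substack{c\le x_3N\\ \gcd(a,b,c)=1}}\left(f(a,b,c)-\frac{8}{\pi}\sqrt{abc}\right)\right|\le K_\varepsilon\,N^{-1/2+\varepsilon}\left(x_1^{1+\varepsilon}\frac{x_3^{\varepsilon}}{x_2^{\varepsilon}}+x_2^{1+\varepsilon}\frac{x_3^{\varepsilon}}{x_1^{\varepsilon}}+x_3^{1+\varepsilon}\right),$$ where $a,b,c$ run over positive integers. -/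

import Mathlib

/-- The integers that are not representable as `x * a + y * b + z * c` with integers
`x, y, z ≥ 0`. All negative integers belong to this set. -/
def nonRepresentable (a b c : ℕ) : Set ℤ :=
  {k : ℤ | ¬ ∃ x y z : ℕ, (x : ℤ) * a + (y : ℤ) * b + (z : ℤ) * c = k}

/-- The Frobenius number `g(a,b,c)`: the largest integer that is not representable as a
non-negative integer combination of `a, b, c`. It is an integer, since it equals `-1` when
one of `a, b, c` is `1`. It is meant for positive `a, b, c` with `gcd(a,b,c) = 1`;
see `isGreatest_frobeniusInt`. -/
noncomputable def frobeniusInt (a b c : ℕ) : ℤ := sSup (nonRepresentable a b c)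

/-- The function `f(a,b,c) = g(a,b,c) + a + b + c`. -/
noncomputable def frobeniusShifted (a b c : ℕ) : ℤ := frobeniusInt a b c + a + b + c

/-- For positive integers with greatest common divisor one, `frobeniusInt a b c` really is the
largest non-representable integer. -/
theorem isGreatest_frobeniusInt (a b c : ℕ) (ha : 0 < a)
    (h : Nat.gcd (Nat.gcd a b) c = 1) :
    IsGreatest (nonRepresentable a b c) (frobeniusInt a b c) := by
  have hne : (nonRepresentable a b c).Nonempty := by
    refine ⟨-1, ?_⟩
    rintro ⟨x, y, z, hk⟩
    have h0 : (0 : ℤ) ≤ (x : ℤ) * a + (y : ℤ) * b + (z : ℤ) * c := by positivity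
    omega
  have hbdd : BddAbove (nonRepresentable a b c) := by
    refine ⟨(a : ℤ) * b + a * c, ?_⟩
    intro k hk
    by_contra! hlt
    apply hk
    obtain ⟨u, v, w, huvw⟩ : ∃ u v w : ℤ, u * a + v * b + w * c = 1 := by
      have h1 := Nat.gcd_eq_gcd_ab (Nat.gcd a b) c
      have h2 := Nat.gcd_eq_gcd_ab a b
      rw [h, h2] at h1
      push_cast at h1
      exact ⟨a.gcdA b * (a.gcd b).gcdA c, a.gcdB b * (a.gcd b).gcdA c, (a.gcd b).gcdB c, by
        linear_combination -h1⟩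
    have haz : (0 : ℤ) < a := by exact_mod_cast ha
    have hv0 := Int.emod_nonneg (k * v) haz.ne'
    have hw0 := Int.emod_nonneg (k * w) haz.ne'
    have hv1 := Int.emod_lt_of_pos (k * v) haz
    have hw1 := Int.emod_lt_of_pos (k * w) haz
    have hvd := Int.emod_add_mul_ediv (k * v) a
    have hwd := Int.emod_add_mul_ediv (k * w) a
    set v' := (k * v) % (a : ℤ)
    set w' := (k * w) % (a : ℤ)
    set t := k * u + (k * v) / (a : ℤ) * b + (k * w) / (a : ℤ) * c with ht
    have hk2 : t * a + v' * b + w' * c = k := by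
      rw [ht]
      linear_combination k * huvw + (b : ℤ) * hvd + (c : ℤ) * hwd
    have hb : (0 : ℤ) ≤ b := by positivity
    have hc : (0 : ℤ) ≤ c := by positivity
    have ht0 : 0 ≤ t := by
      by_contra! hneg
      nlinarith [mul_le_mul_of_nonneg_right hv1.le hb, mul_le_mul_of_nonneg_right hw1.le hc,
        mul_neg_of_neg_of_pos hneg haz]
    refine ⟨t.toNat, v'.toNat, w'.toNat, ?_⟩
    rw [Int.toNat_of_nonneg ht0, Int.toNat_of_nonneg hv0, Int.toNat_of_nonneg hw0]
    exact hk2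
  exact ⟨Int.csSup_mem hne hbdd, fun k hk => le_csSup hbdd hk⟩

/-!
The proof rests on a parametrization of the triples `(a, b, c)`. The lattice
`{(x, t) : a ∣ b x + c t}` has index `a`, and the linear form `b x + c t` singles out a basis
`(u + z, -y)`, `(z, -(w + y))` of it with `u, w > 0`, `y, z ≥ 0` (`exists_reduced_basis`,
`IsParam.unique`). Then `a = u w + u y + w z`, and the L-shaped fundamental domain attached to the
basis yields `f(a, b, c) = b u + c w + max (c y) (b z)` (`IsParam.frobeniusShifted_eq`), while
`√(a b c) = √(U W + U Y + W Z)` in terms of `U = b u`, `W = c w`, `Y = c y`, `Z = b z`. So both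
functions are values of a weight `Φ(U, W, Y, Z)`, homogeneous of degree one and monotone in the
sense of `IsWeight`, and summing over triples means summing over bases and linear forms.

Both sums are compared with integrals. Since superlevel sets of the weights are intervals in each
variable, the layer cake formula bounds the difference between a sum over an arithmetic progression
and the corresponding integral by the maximum of the summand (`IntervalClose.lintegral_le`), and
this gives the sum over lattice points in the plane (`lattice_sum_close`).

* For a fixed basis, the sum over the forms with `b ≤ Y`, `c ≤ Z` and coprimality is close to an
  integral over the forms `(β, γ)` (`param_sum_coprime`); this leads to `triple_sum_eq_integral`.
* For a fixed form `(β, γ)` one sums over the bases whose determinant is at most `n` and divisible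
  by `d`: over `(y, z)` in a lattice coset (`sum_quads_dvd_close`), and then over `u` and `w`, where
  the sum is compared with an integral in the coordinates of a strip (`sum_cellIntegral_close`). The
  main term is a multiple of `totalStrip Φ β γ n`, with a factor that depends only on `d`.

The constant `8 / π` enters through `totalStrip_frob`. In polar coordinates the two totals become
integrals over the triangle `τ + q > 1` in the unit square: `∫∫ 1 / (τ q) = π² / 6` for the square
root, and a beta integral with value a multiple of `π` for the Frobenius number. Hence the main
terms cancel in the sum of the `excess`. Möbius inversion for the common divisor of the basis, the divisor
sum for `φ(a) / a`, and summation by parts against `1 / a` carry this over to the sum that occurs in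
`triple_sum_eq_integral` (`abs_basisSum_sub_le`).

All errors are products of the sides of the box with divisor functions and harmonic sums, which are
smaller than any power. As `f` is symmetric, the shortest side of the box may be taken to be the one
of `a`, and the resulting bound `C m ^ ε X Y Z (X + Y + Z)`, with `m` the shortest side, is at most
the one claimed (`sum_mul_rpow_le`).
-/

/-! ### Reduced bases and the Frobenius number of three integers -/

/-- Minimal elements for the lexicographic order. -/
lemma exists_lex_min (P : ℕ → ℕ → Prop) (h : ∃ x y, P x y) :
    ∃ s p, P s p ∧ ∀ x y, P x y → s < x ∨ (s = x ∧ p ≤ y) := by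
  classical
  let s := Nat.find h
  have hs : ∃ y, P s y := Nat.find_spec h
  refine ⟨s, Nat.find hs, Nat.find_spec hs, fun x y hxy => ?_⟩
  have h1 : s ≤ x := Nat.find_min' h ⟨y, hxy⟩
  rcases h1.lt_or_eq with h2 | h2
  · exact Or.inl h2
  · right
    refine ⟨h2, Nat.find_min' hs ?_⟩
    rw [h2]; exact hxy

/-- A divisor of `a * n`, `b * n`, `c * n` divides `n` if `a, b, c` are coprime. -/
lemma dvd_of_dvd_mul_three {a b c : ℕ} (h : Nat.gcd (Nat.gcd a b) c = 1) {m n : ℤ}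
    (h1 : m ∣ a * n) (h2 : m ∣ b * n) (h3 : m ∣ c * n) : m ∣ n := by
  obtain ⟨x, y, z, e⟩ : ∃ x y z : ℤ, x * a + y * b + z * c = 1 := by
    have h1 := Nat.gcd_eq_gcd_ab (Nat.gcd a b) c
    have h2 := Nat.gcd_eq_gcd_ab a b
    rw [h, h2] at h1
    push_cast at h1
    exact ⟨a.gcdA b * (a.gcd b).gcdA c, a.gcdB b * (a.gcd b).gcdA c, (a.gcd b).gcdB c, by
      linear_combination -h1⟩
  have : n = x * (a * n) + y * (b * n) + z * (c * n) := by linear_combination (-n) * e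
  rw [this]
  exact dvd_add (dvd_add (h1.mul_left _) (h2.mul_left _)) (h3.mul_left _)

/-- Otherwise the difference of the two extremal lattice points would contradict the extremality of
one of them. -/
lemma extremal_points_lt (a b c : ℕ) (hb : 0 < b) (hc : 0 < c) {s p s' p' : ℤ} (hp0n : 0 ≤ p) (hs1n : 0 ≤ s')
    (hs0n : 0 < s) (hp1n : 0 < p') (hd : (a : ℤ) ∣ b * s - c * p) (hpos : c * p < b * s)
    (hd' : (a : ℤ) ∣ c * p' - b * s') (hneg : b * s' ≤ c * p')
    (hminz : ∀ x y : ℤ, 0 ≤ x → 0 ≤ y → (a : ℤ) ∣ b * x - c * y → c * y < b * x →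
      s < x ∨ (s = x ∧ p ≤ y))
    (hminz' : ∀ x y : ℤ, 0 ≤ x → 0 < y → (a : ℤ) ∣ c * y - b * x → b * x ≤ c * y →
      p' < y ∨ (p' = y ∧ s' ≤ x)) :
    s' < s ∧ p < p' := by
  have hbz : (0 : ℤ) < b := by exact_mod_cast hb
  have hcz : (0 : ℤ) < c := by exact_mod_cast hc
  have hdiff : (a : ℤ) ∣ b * (s - s') - c * (p - p') := by
    have := dvd_add hd hd'
    rwa [show (b : ℤ) * s - c * p + (c * p' - b * s') = b * (s - s') - c * (p - p') by ring] at this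
  have hss : s' < s := by
    by_contra! hcon
    rcases le_or_gt p p' with h1 | h1
    · have h2 : b * (s' - s) ≤ c * (p' - p) := by linarith
      have h3 : (a : ℤ) ∣ c * (p' - p) - b * (s' - s) := by
        exact hdiff.trans (dvd_of_eq (by ring))
      rcases h1.eq_or_lt with h4 | h4
      · subst h4
        nlinarith
      · rcases hminz' (s' - s) (p' - p) (by linarith) (by linarith) h3 h2 with h5 | ⟨h5, h6⟩
        · linarith
        · linarith
    · nlinarith
  have hpp : p < p' := by
    by_contra! hcon
    have h2 : c * (p - p') < b * (s - s') := by linarith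
    rcases hminz (s - s') (p - p') (by linarith) (by linarith) hdiff h2 with h5 | ⟨h5, h6⟩
    · linarith
    · linarith
  exact ⟨hss, hpp⟩

/-- The parallelogram spanned by the two extremal lattice points contains no further lattice
point, so they form a basis, and their determinant is the index of the lattice. -/
lemma extremal_points_det (a b c : ℕ) (ha : 0 < a) (hb : 0 < b) (hc : 0 < c)
    (h : Nat.gcd (Nat.gcd a b) c = 1) {s p s' p' : ℤ} (hp0n : 0 ≤ p) (hs1n : 0 ≤ s')
    (hs0n : 0 < s) (hp1n : 0 < p') (hd : (a : ℤ) ∣ b * s - c * p)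
    (hd' : (a : ℤ) ∣ c * p' - b * s')
    (hminz : ∀ x y : ℤ, 0 ≤ x → 0 ≤ y → (a : ℤ) ∣ b * x - c * y → c * y < b * x →
      s < x ∨ (s = x ∧ p ≤ y))
    (hminz' : ∀ x y : ℤ, 0 ≤ x → 0 < y → (a : ℤ) ∣ c * y - b * x → b * x ≤ c * y →
      p' < y ∨ (p' = y ∧ s' ≤ x))
    (hss : s' < s) (hpp : p < p') :
    s * p' - s' * p = a := by
  have haz : (0 : ℤ) < a := by exact_mod_cast ha
  have hbz : (0 : ℤ) < b := by exact_mod_cast hb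
  have hcz : (0 : ℤ) < c := by exact_mod_cast hc
  obtain ⟨j, hj⟩ := hd
  obtain ⟨k, hk⟩ := hd'
  set D := s * p' - s' * p with hD
  have hDpos : 0 < D := by nlinarith
  -- The triangle with vertices `0, (s, -p), (s', -p')` contains no other lattice points.
  have htri : ∀ α β x y : ℤ, 0 ≤ α → 0 ≤ β → α < D → β < D → α + β ≤ D → 0 < α + β →
      D * x = α * s + β * s' → D * y = α * p + β * p' → (a : ℤ) ∣ b * x - c * y → False := by
    intro α β x y h1 h2 h3 h4 h5 h6 hx hy hdv
    have hx0 : 0 ≤ x := by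
      have h8 : 0 ≤ D * x := by
        rw [hx]; exact add_nonneg (mul_nonneg h1 hs0n.le) (mul_nonneg h2 hs1n)
      exact nonneg_of_mul_nonneg_right h8 hDpos
    have hy0 : 0 ≤ y := by
      have h8 : 0 ≤ D * y := by
        rw [hy]; exact add_nonneg (mul_nonneg h1 hp0n) (mul_nonneg h2 hp1n.le)
      exact nonneg_of_mul_nonneg_right h8 hDpos
    rcases lt_or_ge ((c : ℤ) * y) (b * x) with h7 | h7
    · have h8 : s ≤ x := by
        rcases hminz x y hx0 hy0 hdv h7 with h8 | ⟨h8, -⟩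
        · exact h8.le
        · exact h8.le
      have : D * s ≤ α * s + β * s' := by rw [← hx]; exact mul_le_mul_of_nonneg_left h8 hDpos.le
      nlinarith [mul_nonneg (sub_nonneg.2 h5) hs1n, mul_pos (sub_pos.2 h3) (sub_pos.2 hss)]
    · have hy1 : 0 < y := by
        rcases hy0.lt_or_eq with h8 | h8
        · exact h8
        · exfalso
          have hx1 : x = 0 := by
            rw [← h8, mul_zero] at h7
            exact le_antisymm (nonpos_of_mul_nonpos_right h7 hbz) hx0
          rw [hx1, mul_zero] at hx
          rw [← h8, mul_zero] at hy
          have hα : α = 0 := (mul_eq_zero.1 (show α * s = 0 by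
            linarith [mul_nonneg h1 hs0n.le, mul_nonneg h2 hs1n])).resolve_right hs0n.ne'
          have hβ : β = 0 := (mul_eq_zero.1 (show β * p' = 0 by
            linarith [mul_nonneg h1 hp0n, mul_nonneg h2 hp1n.le])).resolve_right hp1n.ne'
          omega
      have hdv' : (a : ℤ) ∣ c * y - b * x := by
        exact (dvd_neg.2 hdv).trans (dvd_of_eq (by ring))
      have h8 : p' ≤ y := by
        rcases hminz' x y hx0 hy1 hdv' h7 with h8 | ⟨h8, -⟩
        · exact h8.le
        · exact h8.le
      have : D * p' ≤ α * p + β * p' := by rw [← hy]; exact mul_le_mul_of_nonneg_left h8 hDpos.le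
      nlinarith [mul_nonneg (sub_nonneg.2 h5) hp0n, mul_pos (sub_pos.2 h4) (sub_pos.2 hpp)]
  -- Hence the two vectors generate the lattice.
  have hgen : ∀ x t : ℤ, (a : ℤ) ∣ b * x + c * t → D ∣ x * p' + t * s' ∧ D ∣ x * p + t * s := by
    intro x t hxt
    obtain ⟨m, α, hα0, hα1, hα⟩ : ∃ m α : ℤ, 0 ≤ α ∧ α < D ∧ x * p' + t * s' = D * m + α :=
      ⟨(x * p' + t * s') / D, (x * p' + t * s') % D, Int.emod_nonneg _ hDpos.ne',
        Int.emod_lt_of_pos _ hDpos, (Int.mul_ediv_add_emod _ _).symm⟩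
    obtain ⟨n, β, hβ0, hβ1, hβ⟩ : ∃ m α : ℤ, 0 ≤ α ∧ α < D ∧ -(x * p + t * s) = D * m + α :=
      ⟨(-(x * p + t * s)) / D, (-(x * p + t * s)) % D, Int.emod_nonneg _ hDpos.ne',
        Int.emod_lt_of_pos _ hDpos, (Int.mul_ediv_add_emod _ _).symm⟩
    have e1 : D * (x - m * s - n * s') = α * s + β * s' := by
      linear_combination s * hα + s' * hβ + x * hD
    have e2 : D * (-(t + m * p + n * p')) = α * p + β * p' := by
      linear_combination p * hα + p' * hβ - t * hD
    have e3 : (a : ℤ) ∣ b * (x - m * s - n * s') - c * (-(t + m * p + n * p')) := by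
      have h1 := dvd_add (dvd_sub hxt (Dvd.intro (m * j) (by ring : (a : ℤ) * (m * j) = m * (a * j))))
        (Dvd.intro (n * k) (by ring : (a : ℤ) * (n * k) = n * (a * k)))
      rw [← hj, ← hk] at h1
      exact h1.trans (dvd_of_eq (by ring))
    have hz : α + β = 0 := by
      by_contra hne
      have hpos' : 0 < α + β := by omega
      rcases le_or_gt (α + β) D with h5 | h5
      · exact htri α β _ _ hα0 hβ0 hα1 hβ1 h5 hpos' e1 e2 e3
      -- the point reflection of the parallelogram moves the point into the triangle
      · refine htri (D - α) (D - β) (s + s' - (x - m * s - n * s'))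
          (p + p' - (-(t + m * p + n * p'))) (by omega) (by omega) (by omega) (by omega)
          (by omega) (by omega) (by linear_combination -e1) (by linear_combination -e2) ?_
        have h1 := dvd_sub (dvd_sub (Dvd.intro j rfl : (a : ℤ) ∣ a * j)
          (Dvd.intro k rfl : (a : ℤ) ∣ a * k)) e3
        rw [← hj, ← hk] at h1
        exact h1.trans (dvd_of_eq (by ring))
    have hα' : α = 0 := by omega
    have hβ' : β = 0 := by omega
    refine ⟨⟨m, by rw [hα, hα', add_zero]⟩, ⟨-n, ?_⟩⟩
    linear_combination -hβ - hβ'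
  -- The determinant is `a`, as both divide each other.
  have hbD : b * D = a * (j * p' + k * p) := by
    rw [hD]; linear_combination p' * hj + p * hk
  have hcD : c * D = a * (j * s' + k * s) := by
    rw [hD]; linear_combination s' * hj + s * hk
  obtain ⟨e, he⟩ : (a : ℤ) ∣ D :=
    dvd_of_dvd_mul_three h (Dvd.intro _ rfl) (Dvd.intro _ hbD.symm) (Dvd.intro _ hcD.symm)
  have hdiv : ∀ n : ℤ, D ∣ a * n → e ∣ n := by
    intro n hn
    rw [he] at hn
    exact (mul_dvd_mul_iff_left haz.ne').1 hn
  have ep' : e ∣ p' := hdiv _ (by simpa using (hgen a 0 (by simp)).1)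
  have ep : e ∣ p := hdiv _ (by simpa using (hgen a 0 (by simp)).2)
  have es' : e ∣ s' := hdiv _ (by simpa using (hgen 0 a (by simp)).1)
  have es : e ∣ s := hdiv _ (by simpa using (hgen 0 a (by simp)).2)
  have ek : e ∣ k := hdiv _ (by
    have := (hgen c (-b) (by ring_nf; simp)).1
    rw [← hk]; exact this.trans (dvd_of_eq (by ring)))
  have ej : e ∣ j := hdiv _ (by
    have := (hgen c (-b) (by ring_nf; simp)).2
    rw [← hj]; exact (dvd_neg.2 this).trans (dvd_of_eq (by ring)))
  have he0 : e ≠ 0 := by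
    rintro rfl
    simp at he
    omega
  have h2 : e * e ∣ e * (a : ℤ) := by
    have : e * e ∣ D := dvd_sub (mul_dvd_mul es ep') (mul_dvd_mul es' ep)
    rw [he] at this
    rwa [mul_comm e (a : ℤ)]
  have h2b : e * e ∣ e * (b : ℤ) := by
    have h3 : e * e ∣ j * p' + k * p := dvd_add (mul_dvd_mul ej ep') (mul_dvd_mul ek ep)
    have h4 : (a : ℤ) * (e * b) = a * (j * p' + k * p) := by rw [← hbD, he]; ring
    rwa [mul_left_cancel₀ haz.ne' h4]
  have h2c : e * e ∣ e * (c : ℤ) := by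
    have h3 : e * e ∣ j * s' + k * s := dvd_add (mul_dvd_mul ej es') (mul_dvd_mul ek es)
    have h4 : (a : ℤ) * (e * c) = a * (j * s' + k * s) := by rw [← hcD, he]; ring
    rwa [mul_left_cancel₀ haz.ne' h4]
  have he1 : e ∣ 1 := dvd_of_dvd_mul_three h
    (by simpa using (mul_dvd_mul_iff_left he0).1 h2)
    (by simpa using (mul_dvd_mul_iff_left he0).1 h2b)
    (by simpa using (mul_dvd_mul_iff_left he0).1 h2c)
  have he2 : e = 1 := by
    have hepos : 0 < e := by
      by_contra! hcon
      nlinarith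
    exact Int.eq_one_of_dvd_one hepos.le he1
  rw [he, he2, mul_one]

/-- The lattice `{(x, t) : a ∣ b x + c t}` has a basis `(s, -p)`, `(s', -p')` with
`0 ≤ s' < s`, `0 ≤ p < p'`, whose two vectors lie on different sides of the line
`b x + c t = 0`. Its members are the leftmost lattice point on the one side, and the
topmost lattice point on the other side. -/
lemma exists_reduced_basis (a b c : ℕ) (ha : 0 < a) (hb : 0 < b) (hc : 0 < c)
    (h : Nat.gcd (Nat.gcd a b) c = 1) :
    ∃ s p s' p' : ℤ, 0 ≤ p ∧ 0 ≤ s' ∧ s' < s ∧ p < p' ∧ c * p < b * s ∧ b * s' ≤ c * p' ∧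
      s * p' - s' * p = a ∧ (a : ℤ) ∣ b * s - c * p ∧ (a : ℤ) ∣ c * p' - b * s' := by
  have haz : (0 : ℤ) < a := by exact_mod_cast ha
  have hbz : (0 : ℤ) < b := by exact_mod_cast hb
  have hcz : (0 : ℤ) < c := by exact_mod_cast hc
  obtain ⟨s₀, p₀, ⟨hd, hpos⟩, hmin⟩ := exists_lex_min
    (fun x y => (a : ℤ) ∣ b * x - c * y ∧ (c : ℤ) * y < b * x)
    ⟨a, 0, by simp, by simpa using mul_pos hbz haz⟩
  obtain ⟨p₁, s₁, ⟨hd', hneg, hp1⟩, hmin'⟩ := exists_lex_min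
    (fun y x => (a : ℤ) ∣ c * y - b * x ∧ (b : ℤ) * x ≤ c * y ∧ 0 < y)
    ⟨a, 0, by simp, by simpa using (mul_pos hcz haz).le, ha⟩
  have hminz : ∀ x y : ℤ, 0 ≤ x → 0 ≤ y → (a : ℤ) ∣ b * x - c * y → c * y < b * x →
      (s₀ : ℤ) < x ∨ ((s₀ : ℤ) = x ∧ (p₀ : ℤ) ≤ y) := by
    intro x y hx hy h1 h2
    lift x to ℕ using hx
    lift y to ℕ using hy
    exact_mod_cast hmin x y ⟨h1, h2⟩
  have hminz' : ∀ x y : ℤ, 0 ≤ x → 0 < y → (a : ℤ) ∣ c * y - b * x → b * x ≤ c * y →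
      (p₁ : ℤ) < y ∨ ((p₁ : ℤ) = y ∧ (s₁ : ℤ) ≤ x) := by
    intro x y hx hy h1 h2
    lift x to ℕ using hx
    have hy' := hy.le
    lift y to ℕ using hy'
    exact_mod_cast hmin' y x ⟨h1, h2, by exact_mod_cast hy⟩
  have hp0n : (0 : ℤ) ≤ p₀ := by positivity
  have hs1n : (0 : ℤ) ≤ s₁ := by positivity
  have hp1n : (0 : ℤ) < p₁ := by exact_mod_cast hp1
  have hs0n : (0 : ℤ) < s₀ := by
    by_contra! hcon
    nlinarith [mul_nonneg hcz.le hp0n]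
  clear hmin hmin'
  generalize (s₀ : ℤ) = s at *
  generalize (p₀ : ℤ) = p at *
  generalize (s₁ : ℤ) = s' at *
  generalize (p₁ : ℤ) = p' at *
  obtain ⟨hss, hpp⟩ := extremal_points_lt a b c hb hc hp0n hs1n hs0n hp1n hd hpos hd' hneg hminz hminz'
  exact ⟨s, p, s', p', hp0n, hs1n, hss, hpp, hpos, hneg,
    extremal_points_det a b c ha hb hc h hp0n hs1n hs0n hp1n hd hd' hminz hminz' hss hpp,
    hd, hd'⟩

/-- The parametrization of a triple `(a, b, c)` by a reduced basis `(u + z, -y)`, `(z, -(w + y))`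
of the lattice `{(x, t) : a ∣ b x + c t}`. The numbers `a j` and `-a k` are the values of the
linear form `b x + c t` on the two basis vectors. -/
structure IsParam (a b c u w y z j k : ℕ) : Prop where
  u_pos : 0 < u
  w_pos : 0 < w
  j_pos : 0 < j
  a_eq : a = u * w + u * y + w * z
  b_eq : b = j * (w + y) + k * y
  c_eq : c = j * z + k * (u + z)

lemma exists_isParam (a b c : ℕ) (ha : 0 < a) (hb : 0 < b) (hc : 0 < c)
    (h : Nat.gcd (Nat.gcd a b) c = 1) : ∃ u w y z j k, IsParam a b c u w y z j k := by
  obtain ⟨s, p, s', p', hp, hs', hs, hpp, h1, h2, hdet, ⟨j, hj⟩, ⟨k, hk⟩⟩ :=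
    exists_reduced_basis a b c ha hb hc h
  have haz : (0 : ℤ) < a := by exact_mod_cast ha
  have hj0 : 0 < j := by
    have : 0 < (a : ℤ) * j := by rw [← hj]; linarith
    exact pos_of_mul_pos_right this haz.le
  have hk0 : 0 ≤ k := by
    have : 0 ≤ (a : ℤ) * k := by rw [← hk]; linarith
    exact nonneg_of_mul_nonneg_right this haz
  obtain ⟨u, rfl⟩ : ∃ u : ℤ, s = u + s' := ⟨s - s', by ring⟩
  obtain ⟨w, rfl⟩ : ∃ w : ℤ, p' = w + p := ⟨p' - p, by ring⟩
  have hb : (b : ℤ) = j * (w + p) + k * p := mul_left_cancel₀ haz.ne' (by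
    linear_combination (w + p) * hj + p * hk - b * hdet)
  have hc : (c : ℤ) = j * s' + k * (u + s') := mul_left_cancel₀ haz.ne' (by
    linear_combination s' * hj + (u + s') * hk - c * hdet)
  have hu : 0 < u := by linarith
  have hw : 0 < w := by linarith
  have hu' := hu.le
  have hw' := hw.le
  have hj' := hj0.le
  lift u to ℕ using hu'
  lift w to ℕ using hw'
  lift j to ℕ using hj'
  lift k to ℕ using hk0
  lift p to ℕ using hp
  lift s' to ℕ using hs'
  refine ⟨u, w, p, s', j, k, by exact_mod_cast hu, by exact_mod_cast hw, by exact_mod_cast hj0,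
    ?_, by exact_mod_cast hb, by exact_mod_cast hc⟩
  have : (a : ℤ) = u * w + u * p + w * s' := by linear_combination -hdet
  exact_mod_cast this

namespace IsParam

variable {a b c u w y z j k : ℕ}

lemma a_pos (P : IsParam a b c u w y z j k) : 0 < a := by
  have := Nat.mul_pos P.u_pos P.w_pos
  have := P.a_eq
  omega

/-- The two vectors attached to a parametrization generate the lattice. -/
lemma exists_coords (P : IsParam a b c u w y z j k) (h : Nat.gcd (Nat.gcd a b) c = 1)
    {x t : ℤ} (hxt : (a : ℤ) ∣ b * x + c * t) :
    ∃ m n : ℤ, x = m * (u + z) + n * z ∧ -t = m * y + n * (w + y) ∧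
      b * x + c * t = a * (m * j - n * k) := by
  have haz : (a : ℤ) ≠ 0 := by exact_mod_cast P.a_pos.ne'
  have ha : (a : ℤ) = u * w + u * y + w * z := by exact_mod_cast P.a_eq
  have hb : (b : ℤ) = j * (w + y) + k * y := by exact_mod_cast P.b_eq
  have hc : (c : ℤ) = j * z + k * (u + z) := by exact_mod_cast P.c_eq
  obtain ⟨r, hr⟩ := hxt
  obtain ⟨m, hm⟩ : (a : ℤ) ∣ x * (w + y) + t * z := by
    refine dvd_of_dvd_mul_three h ⟨_, rfl⟩ ⟨(w + y) * r - k * t, ?_⟩ ⟨z * r + k * x, ?_⟩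
    · linear_combination (w + y) * hr + t * z * hb - t * (w + y) * hc + k * t * ha
    · linear_combination z * hr - x * z * hb + x * (w + y) * hc - k * x * ha
  obtain ⟨n, hn⟩ : (a : ℤ) ∣ -(x * y + t * (u + z)) := by
    refine dvd_of_dvd_mul_three h ⟨_, rfl⟩ ⟨-y * r - j * t, ?_⟩ ⟨-(u + z) * r + j * x, ?_⟩
    · linear_combination -y * hr - t * (u + z) * hb + t * y * hc + j * t * ha
    · linear_combination -(u + z) * hr + x * (u + z) * hb - x * y * hc - j * x * ha
  refine ⟨m, n, mul_left_cancel₀ haz ?_, mul_left_cancel₀ haz ?_, ?_⟩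
  · linear_combination (u + z) * hm + z * hn + x * ha
  · linear_combination y * hm + (w + y) * hn - t * ha
  · linear_combination j * hm - k * hn + x * hb + t * hc

/-- The value of the linear form on the first basis vector. -/
lemma value_left (P : IsParam a b c u w y z j k) :
    (b : ℤ) * (u + z) - c * y = a * j := by
  have ha : (a : ℤ) = u * w + u * y + w * z := by exact_mod_cast P.a_eq
  have hb : (b : ℤ) = j * (w + y) + k * y := by exact_mod_cast P.b_eq
  have hc : (c : ℤ) = j * z + k * (u + z) := by exact_mod_cast P.c_eq
  rw [ha, hb, hc]; ring

/-- The value of the linear form on the second basis vector, up to the sign. -/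
lemma value_right (P : IsParam a b c u w y z j k) :
    (c : ℤ) * (w + y) - b * z = a * k := by
  have ha : (a : ℤ) = u * w + u * y + w * z := by exact_mod_cast P.a_eq
  have hb : (b : ℤ) = j * (w + y) + k * y := by exact_mod_cast P.b_eq
  have hc : (c : ℤ) = j * z + k * (u + z) := by exact_mod_cast P.c_eq
  rw [ha, hb, hc]; ring

/-- The first basis vector is the leftmost lattice point above the line `b x = c t`. -/
lemma left_min (P : IsParam a b c u w y z j k) (h : Nat.gcd (Nat.gcd a b) c = 1)
    {x t : ℤ} (hx : 0 ≤ x) (ht : 0 ≤ t) (hd : (a : ℤ) ∣ b * x - c * t) (hlt : c * t < b * x) :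
    (u + z : ℤ) < x ∨ ((u + z : ℤ) = x ∧ (y : ℤ) ≤ t) := by
  obtain ⟨m, n, h1, h2, h3⟩ := P.exists_coords h (x := x) (t := -t)
    (hd.trans (dvd_of_eq (by ring)))
  have haz : (0 : ℤ) < a := by exact_mod_cast P.a_pos
  have hu : (0 : ℤ) < u := by exact_mod_cast P.u_pos
  have hw : (0 : ℤ) < w := by exact_mod_cast P.w_pos
  have hj : (0 : ℤ) < j := by exact_mod_cast P.j_pos
  have hz : (0 : ℤ) ≤ z := by positivity
  have hy : (0 : ℤ) ≤ y := by positivity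
  have hk : (0 : ℤ) ≤ k := by positivity
  have hpos : 0 < m * j - n * k := by
    have : 0 < (a : ℤ) * (m * j - n * k) := by rw [← h3]; linarith
    exact pos_of_mul_pos_right this haz.le
  rw [neg_neg] at h2
  have hm : 1 ≤ m := by
    by_contra! hcon
    have hm0 : m ≤ 0 := by omega
    have hn : n < 0 := by
      by_contra! hn
      nlinarith [mul_nonneg hn hk, mul_nonneg (neg_nonneg.2 hm0) hj.le]
    have hx0 : x = 0 := le_antisymm (by
      rw [h1]; nlinarith [mul_nonneg (neg_nonneg.2 hm0) (add_nonneg hu.le hz),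
        mul_nonneg (neg_nonneg.2 hn.le) hz]) hx
    have : 0 ≤ (c : ℤ) * t := by positivity
    rw [hx0, mul_zero] at hlt
    omega
  rcases le_or_gt 0 n with hn | hn
  · have h4 : (u + z : ℤ) ≤ x := by
      rw [h1]; nlinarith [mul_nonneg (sub_nonneg.2 hm) (add_nonneg hu.le hz), mul_nonneg hn hz]
    rcases h4.lt_or_eq with h5 | h5
    · exact Or.inl h5
    · right
      refine ⟨h5, ?_⟩
      rw [h2]
      nlinarith [mul_nonneg (sub_nonneg.2 hm) hy, mul_nonneg hn (add_nonneg hw.le hy)]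
  · left
    -- `m y + n (w + y) ≥ 0` forces `m > -n`
    have hmn : 1 ≤ m + n := by
      by_contra! hcon
      have h6 : (m + n) * y ≤ 0 := mul_nonpos_of_nonpos_of_nonneg (by omega) hy
      have h7 : n * w < 0 := mul_neg_of_neg_of_pos hn hw
      nlinarith
    rw [h1]
    nlinarith [mul_nonneg (sub_nonneg.2 hmn) (add_nonneg hu.le hz),
      mul_pos (neg_pos.2 hn) hu]

/-- The second basis vector is the topmost lattice point below the line `b x = c t`. -/
lemma right_min (P : IsParam a b c u w y z j k) (h : Nat.gcd (Nat.gcd a b) c = 1)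
    {x t : ℤ} (hx : 0 ≤ x) (ht : 0 < t) (hd : (a : ℤ) ∣ c * t - b * x) (hle : b * x ≤ c * t) :
    (w + y : ℤ) < t ∨ ((w + y : ℤ) = t ∧ (z : ℤ) ≤ x) := by
  obtain ⟨m, n, h1, h2, h3⟩ := P.exists_coords h (x := x) (t := -t)
    ((dvd_neg.2 hd).trans (dvd_of_eq (by ring)))
  have haz : (0 : ℤ) < a := by exact_mod_cast P.a_pos
  have hu : (0 : ℤ) < u := by exact_mod_cast P.u_pos
  have hw : (0 : ℤ) < w := by exact_mod_cast P.w_pos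
  have hj : (0 : ℤ) < j := by exact_mod_cast P.j_pos
  have hz : (0 : ℤ) ≤ z := by positivity
  have hy : (0 : ℤ) ≤ y := by positivity
  have hk : (0 : ℤ) ≤ k := by positivity
  have hneg : m * j - n * k ≤ 0 := by
    have : (a : ℤ) * (m * j - n * k) ≤ 0 := by rw [← h3]; linarith
    exact nonpos_of_mul_nonpos_right this haz
  rw [neg_neg] at h2
  have hn : 1 ≤ n := by
    by_contra! hcon
    have hn0 : n ≤ 0 := by omega
    have hm : 0 < m := by
      by_contra! hm
      have h4 : m * y ≤ 0 := mul_nonpos_of_nonpos_of_nonneg hm hy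
      have h5 : n * (w + y) ≤ 0 := mul_nonpos_of_nonpos_of_nonneg hn0 (by positivity)
      omega
    nlinarith [mul_pos hm hj, mul_nonneg (neg_nonneg.2 hn0) hk]
  rcases le_or_gt 0 m with hm | hm
  · have h4 : (w + y : ℤ) ≤ t := by
      rw [h2]; nlinarith [mul_nonneg (sub_nonneg.2 hn) (add_nonneg hw.le hy), mul_nonneg hm hy]
    rcases h4.lt_or_eq with h5 | h5
    · exact Or.inl h5
    · right
      refine ⟨h5, ?_⟩
      rw [h1]
      nlinarith [mul_nonneg (sub_nonneg.2 hn) hz, mul_nonneg hm (add_nonneg hu.le hz)]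
  · left
    have hmn : 1 ≤ m + n := by
      by_contra! hcon
      have h6 : (m + n) * z ≤ 0 := mul_nonpos_of_nonpos_of_nonneg (by omega) hz
      have h7 : m * u < 0 := mul_neg_of_neg_of_pos hm hu
      nlinarith
    rw [h2]
    nlinarith [mul_nonneg (sub_nonneg.2 hmn) (add_nonneg hw.le hy),
      mul_pos (neg_pos.2 hm) hw]

/-- The parametrization of a triple of coprime numbers is unique. -/
lemma unique {u₁ w₁ y₁ z₁ j₁ k₁ : ℕ} (P : IsParam a b c u w y z j k)
    (P₁ : IsParam a b c u₁ w₁ y₁ z₁ j₁ k₁) (h : Nat.gcd (Nat.gcd a b) c = 1) :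
    u = u₁ ∧ w = w₁ ∧ y = y₁ ∧ z = z₁ ∧ j = j₁ ∧ k = k₁ := by
  have haz : (0 : ℤ) < a := by exact_mod_cast P.a_pos
  have hl := P.value_left
  have hr := P.value_right
  have hl₁ := P₁.value_left
  have hr₁ := P₁.value_right
  have hj : (0 : ℤ) < a * j := by have := P.j_pos; positivity
  have hj₁ : (0 : ℤ) < a * j₁ := by have := P₁.j_pos; positivity
  have hk : (0 : ℤ) ≤ a * k := by positivity
  have hk₁ : (0 : ℤ) ≤ a * k₁ := by positivity
  have hw := P.w_pos
  have hw₁ := P₁.w_pos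
  have A := P.left_min h (x := u₁ + z₁) (t := y₁) (by positivity) (by positivity)
    ⟨_, hl₁⟩ (by linarith)
  have A₁ := P₁.left_min h (x := u + z) (t := y) (by positivity) (by positivity)
    ⟨_, hl⟩ (by linarith)
  have B := P.right_min h (x := z₁) (t := w₁ + y₁) (by positivity) (by positivity)
    ⟨_, hr₁⟩ (by linarith)
  have B₁ := P₁.right_min h (x := z) (t := w + y) (by positivity) (by positivity)
    ⟨_, hr⟩ (by linarith)
  have e : u = u₁ ∧ w = w₁ ∧ y = y₁ ∧ z = z₁ := by omega
  obtain ⟨rfl, rfl, rfl, rfl⟩ := e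
  refine ⟨rfl, rfl, rfl, rfl, ?_, ?_⟩
  · have := mul_left_cancel₀ haz.ne' (hl.symm.trans hl₁)
    exact_mod_cast this
  · have := mul_left_cancel₀ haz.ne' (hr.symm.trans hr₁)
    exact_mod_cast this

/-- A corner of the L-shaped fundamental domain of the lattice gives a number without a
representation. -/
lemma corner_not_mem (P : IsParam a b c u w y z j k) (h : Nat.gcd (Nat.gcd a b) c = 1)
    {x t : ℤ} (hxt : (x = u ∧ t = w + y) ∨ (x = u + z ∧ t = w)) :
    b * x + c * t - a - b - c ∈ nonRepresentable a b c := by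
  rintro ⟨r, x', t', e⟩
  obtain ⟨m, n, h1, h2, h3⟩ := P.exists_coords h (x := x - 1 - x') (t := t - 1 - t')
    ⟨r + 1, by linear_combination -e⟩
  have haz : (0 : ℤ) < a := by exact_mod_cast P.a_pos
  have hu : (0 : ℤ) < u := by exact_mod_cast P.u_pos
  have hw : (0 : ℤ) < w := by exact_mod_cast P.w_pos
  have hj : (0 : ℤ) < j := by exact_mod_cast P.j_pos
  have hz : (0 : ℤ) ≤ z := by positivity
  have hy : (0 : ℤ) ≤ y := by positivity
  have hk : (0 : ℤ) ≤ k := by positivity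
  have hx' : (0 : ℤ) ≤ x' := by positivity
  have ht' : (0 : ℤ) ≤ t' := by positivity
  have hpos : 0 < m * j - n * k := by
    have h4 : (a : ℤ) * (m * j - n * k) = a * (r + 1) := by rw [← h3]; linear_combination -e
    rw [mul_left_cancel₀ haz.ne' h4]; positivity
  rcases le_or_gt m 0 with hm | hm
  · have hn : n ≤ -1 := by
      by_contra! hn
      nlinarith [mul_nonneg (show 0 ≤ n by omega) hk, mul_nonneg (neg_nonneg.2 hm) hj.le]
    have h5 : m * y ≤ 0 := mul_nonpos_of_nonpos_of_nonneg hm hy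
    have h6 : (n + 1) * (w + y : ℤ) ≤ 0 := mul_nonpos_of_nonpos_of_nonneg (by omega) (by positivity)
    rcases hxt with ⟨rfl, rfl⟩ | ⟨rfl, rfl⟩ <;> nlinarith
  · rcases hxt with ⟨rfl, rfl⟩ | ⟨rfl, rfl⟩
    · -- the first coordinate gives `m + n < 0`, the second one `m + n ≥ 0`
      have hn : m + n ≤ -1 := by
        by_contra! hn
        nlinarith [mul_nonneg (show 0 ≤ m + n by omega) hz,
          mul_nonneg (show 0 ≤ m - 1 by omega) hu.le]
      nlinarith [mul_nonneg (show 0 ≤ -1 - (m + n) by omega) (add_nonneg hw.le hy),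
        mul_pos hm hw]
    · have hn : m + n ≤ 0 := by
        by_contra! hn
        nlinarith [mul_nonneg (show 0 ≤ m + n - 1 by omega) hz,
          mul_nonneg (show 0 ≤ m - 1 by omega) hu.le]
      nlinarith [mul_nonneg (show 0 ≤ - (m + n) by omega) (add_nonneg hw.le hy),
        mul_nonneg (show 0 ≤ m - 1 by omega) hw.le]

/-- Numbers above the larger corner are representable: in its residue class modulo `a`, the
least number `b x + c t` has `(x, t)` inside the L-shaped fundamental domain. -/
lemma exists_rep (P : IsParam a b c u w y z j k) (h : Nat.gcd (Nat.gcd a b) c = 1)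
    {n : ℤ} (hn : b * u + c * w + max (c * y : ℤ) (b * z) - a - b - c < n) :
    n ∉ nonRepresentable a b c := by
  have haz : (0 : ℤ) < a := by exact_mod_cast P.a_pos
  have hu : 0 < u := P.u_pos
  have hw : 0 < w := P.w_pos
  have hj : 0 < j := P.j_pos
  have hl := P.value_left
  have hr := P.value_right
  have hb0 : (0 : ℤ) ≤ b := by positivity
  have hc0 : (0 : ℤ) ≤ c := by positivity
  -- the least value `v = b x + c t` in the residue class of `n`, with the least `t` among the ties
  obtain ⟨v, t, ⟨x, hv, hd⟩, hmin⟩ := exists_lex_min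
    (fun v t => ∃ x : ℕ, b * x + c * t = v ∧ (a : ℤ) ∣ n - v) (by
      obtain ⟨e₁, e₂, e₃, he⟩ : ∃ x y z : ℤ, x * a + y * b + z * c = 1 := by
        have h1 := Nat.gcd_eq_gcd_ab (Nat.gcd a b) c
        have h2 := Nat.gcd_eq_gcd_ab a b
        rw [h, h2] at h1
        push_cast at h1
        exact ⟨a.gcdA b * (a.gcd b).gcdA c, a.gcdB b * (a.gcd b).gcdA c, (a.gcd b).gcdB c, by
          linear_combination -h1⟩
      have hx0 := Int.emod_nonneg (n * e₂) haz.ne'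
      have ht0 := Int.emod_nonneg (n * e₃) haz.ne'
      have hxd := Int.emod_add_mul_ediv (n * e₂) a
      have htd := Int.emod_add_mul_ediv (n * e₃) a
      refine ⟨_, ((n * e₃) % a).toNat, ((n * e₂) % a).toNat, rfl, ?_⟩
      push_cast
      rw [Int.toNat_of_nonneg hx0, Int.toNat_of_nonneg ht0]
      exact ⟨n * e₁ + b * (n * e₂ / a) + c * (n * e₃ / a), by
        linear_combination -n * he - b * hxd - c * htd⟩)
  have hvz : (b : ℤ) * x + c * t = v := by exact_mod_cast hv
  have hmin' : ∀ x' t' : ℕ, (a : ℤ) ∣ n - (b * x' + c * t') →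
      (v : ℤ) < b * x' + c * t' ∨ ((v : ℤ) = b * x' + c * t' ∧ t ≤ t') := by
    intro x' t' hd'
    exact_mod_cast hmin (b * x' + c * t') t' ⟨x', rfl, by exact_mod_cast hd'⟩
  have hjk : (0 : ℤ) < a * j := by positivity
  have hak : (0 : ℤ) ≤ a * k := by positivity
  -- A point outside the domain can be moved by `-(u + z, -y)`, by `(z, -(w + y))`, or by both,
  -- within the quadrant and without increasing the value.
  have h1 : x < u + z := by
    by_contra! hcon
    obtain ⟨x', rfl⟩ := Nat.exists_eq_add_of_le hcon
    push_cast at hvz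
    rcases hmin' x' (t + y) ((dvd_add hd ⟨j, hl⟩).trans (dvd_of_eq (by
      push_cast; linear_combination hvz))) with h2 | ⟨h2, -⟩ <;>
    · push_cast at h2
      linarith
  have h2 : t < w + y := by
    by_contra! hcon
    obtain ⟨t', rfl⟩ := Nat.exists_eq_add_of_le hcon
    push_cast at hvz
    rcases hmin' (x + z) t' ((dvd_add hd ⟨k, hr⟩).trans (dvd_of_eq (by
      push_cast; linear_combination hvz))) with h2 | ⟨h2, h3⟩
    · push_cast at h2
      linarith
    · omega
  have h3 : x < u ∨ t < w := by
    by_contra! hcon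
    obtain ⟨x', rfl⟩ := Nat.exists_eq_add_of_le hcon.1
    obtain ⟨t', rfl⟩ := Nat.exists_eq_add_of_le hcon.2
    push_cast at hvz
    rcases hmin' x' t' ((dvd_add hd (dvd_add ⟨j, hl⟩ ⟨k, hr⟩)).trans (dvd_of_eq (by
      linear_combination hvz))) with h2 | ⟨h2, -⟩ <;>
    linarith
  have hvle : (v : ℤ) ≤ b * u + c * w + max (c * y : ℤ) (b * z) - b - c := by
    rw [← hvz]
    rcases h3 with h3 | h3
    · have e1 : (x : ℤ) ≤ u - 1 := by omega
      have e2 : (t : ℤ) ≤ w + y - 1 := by omega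
      have := le_max_left (c * y : ℤ) (b * z)
      nlinarith [mul_le_mul_of_nonneg_left e1 hb0, mul_le_mul_of_nonneg_left e2 hc0]
    · have e1 : (x : ℤ) ≤ u + z - 1 := by omega
      have e2 : (t : ℤ) ≤ w - 1 := by omega
      have := le_max_right (c * y : ℤ) (b * z)
      nlinarith [mul_le_mul_of_nonneg_left e1 hb0, mul_le_mul_of_nonneg_left e2 hc0]
  obtain ⟨r, hr'⟩ := hd
  have hr0 : 0 ≤ r := by
    by_contra! hcon
    nlinarith
  lift r to ℕ using hr0
  exact fun hmem => hmem ⟨r, x, t, by linear_combination -hr' + hvz⟩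

/-- The formula for the Frobenius number in terms of the reduced basis. -/
lemma frobeniusShifted_eq (P : IsParam a b c u w y z j k) (h : Nat.gcd (Nat.gcd a b) c = 1) :
    frobeniusShifted a b c = b * u + c * w + max (c * y : ℤ) (b * z) := by
  have hg := isGreatest_frobeniusInt a b c P.a_pos h
  have hmem : (b * u + c * w + max (c * y : ℤ) (b * z)) - a - b - c ∈ nonRepresentable a b c := by
    rcases le_total (c * y : ℤ) (b * z) with h1 | h1
    · rw [max_eq_right h1]
      have := P.corner_not_mem h (x := u + z) (t := w) (Or.inr ⟨rfl, rfl⟩)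
      convert this using 1; ring
    · rw [max_eq_left h1]
      have := P.corner_not_mem h (x := u) (t := w + y) (Or.inl ⟨rfl, rfl⟩)
      convert this using 1; ring
  have h1 := hg.2 hmem
  have h2 : ¬ (b * u + c * w + max (c * y : ℤ) (b * z)) - a - b - c < frobeniusInt a b c :=
    fun hlt => P.exists_rep h hlt hg.1
  unfold frobeniusShifted
  omega

end IsParam

open MeasureTheory Set
open scoped ENNReal

/-! ### Sums over arithmetic progressions and lattices against integrals -/

/-- Two measures on the line which give every interval the same mass up to an error `1`. -/
def IntervalClose (μ ν : Measure ℝ) : Prop :=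
  ∀ I : Set ℝ, I.OrdConnected → μ I ≤ ν I + 1 ∧ ν I ≤ μ I + 1

lemma IntervalClose.symm {μ ν : Measure ℝ} (h : IntervalClose μ ν) : IntervalClose ν μ :=
  fun I hI => (h I hI).symm

/-- A function whose superlevel sets are intervals. -/
def Unimodal (φ : ℝ → ℝ) : Prop := ∀ t : ℝ, 0 ≤ t → {x | t < φ x}.OrdConnected

/-- By the layer cake formula, interval-close measures give nearly the same integral to a
bounded unimodal function. -/
lemma IntervalClose.lintegral_le {μ ν : Measure ℝ} (h : IntervalClose μ ν) {φ : ℝ → ℝ} {B : ℝ}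
    (h0 : ∀ x, 0 ≤ φ x) (hm : Measurable φ) (hB : ∀ x, φ x ≤ B) (hφ : Unimodal φ) :
    ∫⁻ x, ENNReal.ofReal (φ x) ∂μ ≤ ∫⁻ x, ENNReal.ofReal (φ x) ∂ν + ENNReal.ofReal B := by
  rw [lintegral_eq_lintegral_meas_lt μ (Filter.Eventually.of_forall h0) hm.aemeasurable,
    lintegral_eq_lintegral_meas_lt ν (Filter.Eventually.of_forall h0) hm.aemeasurable]
  have h1 : ∫⁻ t in Ioi (0 : ℝ), (Iio B).indicator (fun _ => (1 : ℝ≥0∞)) t = ENNReal.ofReal B := by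
    rw [lintegral_indicator measurableSet_Iio, Measure.restrict_restrict measurableSet_Iio,
      lintegral_const, one_mul, Measure.restrict_apply_univ, Iio_inter_Ioi, Real.volume_Ioo,
      sub_zero]
  rw [← h1, ← lintegral_add_right _ (measurable_const.indicator measurableSet_Iio)]
  refine setLIntegral_mono' measurableSet_Ioi fun t ht => ?_
  by_cases htB : t < B
  · rw [indicator_of_mem (show t ∈ Iio B from htB)]
    exact (h _ (hφ t (le_of_lt ht))).1
  · have : {a | t < φ a} = ∅ := by
      ext a
      simp only [mem_ofPred_eq, mem_empty_iff_false, iff_false, not_lt]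
      exact (hB a).trans (not_lt.1 htB)
    simp [this]

/-- The counting measure of the arithmetic progression `r, r + q, r + 2 q, …`. -/
noncomputable def apMeasure (q r : ℝ) : Measure ℝ :=
  Measure.sum fun n : ℕ => Measure.dirac (r + q * n)

instance (q r : ℝ) : SFinite (apMeasure q r) := by unfold apMeasure; infer_instance

lemma lintegral_apMeasure (q r : ℝ) (f : ℝ → ℝ≥0∞) :
    ∫⁻ x, f x ∂(apMeasure q r) = ∑' n : ℕ, f (r + q * n) := by
  unfold apMeasure
  rw [lintegral_sum_measure]
  simp only [lintegral_dirac]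

lemma apMeasure_apply (q r : ℝ) {I : Set ℝ} (hI : MeasurableSet I) :
    apMeasure q r I = ∑' n : ℕ, I.indicator (fun _ => (1 : ℝ≥0∞)) (r + q * n) := by
  rw [← lintegral_apMeasure, lintegral_indicator_const hI, one_mul]

/-- The density measure which an arithmetic progression with difference `q` approximates. -/
noncomputable def densityMeasure (q lo : ℝ) : Measure ℝ :=
  ENNReal.ofReal q⁻¹ • volume.restrict (Ioi lo)

instance (q lo : ℝ) : SFinite (densityMeasure q lo) := by unfold densityMeasure; infer_instance

lemma lintegral_densityMeasure (q lo : ℝ) (f : ℝ → ℝ≥0∞) :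
    ∫⁻ x, f x ∂(densityMeasure q lo) = ENNReal.ofReal q⁻¹ * ∫⁻ x in Ioi lo, f x := by
  unfold densityMeasure
  rw [lintegral_smul_measure, smul_eq_mul]

/-- Each term of the progression in `I` but the last one is charged to the gap that follows it. -/
lemma ap_le_density {q r lo : ℝ} (hq : 0 < q) (h1 : lo ≤ r) {I : Set ℝ} (hI : I.OrdConnected) :
    apMeasure q r I ≤ densityMeasure q lo I + 1 := by
  classical
  have hIm := hI.measurableSet
  rw [apMeasure_apply q r hIm]
  set S : ℕ → ℝ≥0∞ := fun n => I.indicator (fun _ => (1 : ℝ≥0∞)) (r + q * n) with hS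
  -- `A` collects the points whose successor is in `I`, and `B` the last point
  set A : ℕ → ℝ≥0∞ := fun n => if r + q * n ∈ I ∧ r + q * (n + 1 : ℕ) ∈ I then 1 else 0 with hA
  set B : ℕ → ℝ≥0∞ := fun n => if r + q * n ∈ I ∧ r + q * (n + 1 : ℕ) ∉ I then 1 else 0 with hB
  have hSAB : ∀ n, S n = A n + B n := by
    intro n
    simp only [hS, hA, hB, indicator]
    by_cases h1 : r + q * n ∈ I <;> by_cases h2 : r + q * (n + 1 : ℕ) ∈ I <;>
      simp only [h1, h2, if_true, if_false, and_true, and_false, not_true, not_false_iff, add_zero,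
        zero_add]
  have hB1 : ∑' n, B n ≤ 1 := by
    by_cases hex : ∃ n : ℕ, r + q * n ∈ I ∧ r + q * (n + 1 : ℕ) ∉ I
    · obtain ⟨n, hn1, hn2⟩ := hex
      rw [tsum_eq_single n]
      · simp only [hB]; split_ifs <;> simp
      · intro m hm
        simp only [hB]
        rw [if_neg]
        rintro ⟨hm1, hm2⟩
        rcases lt_or_gt_of_ne hm with hlt | hlt
        · refine hm2 (hI.out hm1 hn1 ⟨?_, ?_⟩)
          · push_cast; nlinarith
          · have : ((m + 1 : ℕ) : ℝ) ≤ n := by exact_mod_cast hlt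
            nlinarith
        · refine hn2 (hI.out hn1 hm1 ⟨?_, ?_⟩)
          · push_cast; nlinarith
          · have : ((n + 1 : ℕ) : ℝ) ≤ m := by exact_mod_cast hlt
            nlinarith
    · have : ∀ n, B n = 0 := fun n => by
        simp only [hB]; rw [if_neg (fun h => hex ⟨n, h⟩)]
      simp [this]
  have hA1 : ∑' n, A n ≤ densityMeasure q lo I := by
    unfold densityMeasure
    rw [Measure.smul_apply, smul_eq_mul, Measure.restrict_apply hIm]
    have hdisj : Pairwise (Function.onFun Disjoint
        (fun n : ℕ => (I ∩ Ioi lo) ∩ Ioc (r + q * n) (r + q * (n + 1 : ℕ)))) := by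
      have hd : Pairwise (Function.onFun Disjoint
          (fun n : ℕ => Ioc (r + q * n) (r + q * (n + 1 : ℕ)))) := by
        refine Monotone.pairwise_disjoint_on_Ioc_succ (f := fun n : ℕ => r + q * n) ?_
        intro m n hmn
        have : (m : ℝ) ≤ n := by exact_mod_cast hmn
        simp only
        nlinarith
      intro m n hmn
      exact (hd hmn).mono inter_subset_right inter_subset_right
    have h2 : ∑' n : ℕ, volume ((I ∩ Ioi lo) ∩ Ioc (r + q * n) (r + q * (n + 1 : ℕ)))
        ≤ volume (I ∩ Ioi lo) := by
      rw [← measure_iUnion hdisj fun n => (hIm.inter measurableSet_Ioi).inter measurableSet_Ioc]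
      exact measure_mono (iUnion_subset fun n => inter_subset_left)
    refine le_trans ?_ (mul_le_mul_right h2 _)
    rw [← ENNReal.tsum_mul_left]
    refine ENNReal.tsum_le_tsum fun n => ?_
    simp only [hA]
    split_ifs with hn
    · have hsub : Ioc (r + q * n) (r + q * (n + 1 : ℕ)) ⊆
          (I ∩ Ioi lo) ∩ Ioc (r + q * n) (r + q * (n + 1 : ℕ)) := by
        intro x hx
        refine ⟨⟨hI.out hn.1 hn.2 ⟨hx.1.le, hx.2⟩, ?_⟩, hx⟩
        have : 0 ≤ q * (n : ℝ) := by positivity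
        exact lt_of_le_of_lt (by linarith) hx.1
      calc (1 : ℝ≥0∞) = ENNReal.ofReal q⁻¹ * volume (Ioc (r + q * n) (r + q * (n + 1 : ℕ))) := by
            rw [Real.volume_Ioc, ← ENNReal.ofReal_mul (by positivity)]
            push_cast
            rw [show q⁻¹ * (r + q * (n + 1) - (r + q * n)) = 1 by field_simp; ring]
            simp
        _ ≤ _ := mul_le_mul_right (measure_mono hsub) _
    · exact zero_le
  calc ∑' n, S n = ∑' n, A n + ∑' n, B n := by
        rw [← ENNReal.tsum_add]; exact tsum_congr hSAB
    _ ≤ _ := add_le_add hA1 hB1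

lemma density_le_ap {q r lo : ℝ} (hq : 0 < q) (h2 : r ≤ lo + q) {I : Set ℝ} (hI : I.OrdConnected) :
    densityMeasure q lo I ≤ apMeasure q r I + 1 := by
  classical
  have hIm := hI.measurableSet
  rcases eq_or_ne (apMeasure q r I) ⊤ with htop | htop
  · simp [htop]
  set C := apMeasure q r I with hC
  have key : volume (I ∩ Ioi lo) ≤ ENNReal.ofReal q * (C + 1) := by
    refine (Real.volume_le_diam _).trans (Metric.ediam_le ?_)
    have main : ∀ x ∈ I ∩ Ioi lo, ∀ y ∈ I ∩ Ioi lo, x ≤ y →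
        ENNReal.ofReal (y - x) ≤ ENNReal.ofReal q * (C + 1) := by
      rintro x ⟨hx, hx'⟩ y ⟨hy, hy'⟩ hxy
      simp only [mem_Ioi] at hx' hy'
      set m := ⌈(x - r) / q⌉₊ with hm
      set n := ⌊(y - r) / q + 1⌋₊ with hn
      have hsub : ((Finset.Ico m n).card : ℝ≥0∞) ≤ C := by
        rw [hC, apMeasure_apply q r hIm]
        refine le_trans ?_ (ENNReal.sum_le_tsum (Finset.Ico m n))
        rw [Finset.card_eq_sum_ones, Nat.cast_sum]
        refine Finset.sum_le_sum fun i hi => ?_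
        rw [Finset.mem_Ico] at hi
        rw [indicator_of_mem]
        · simp
        · refine hI.out hx hy ⟨?_, ?_⟩
          · have := (Nat.ceil_le.1 hi.1)
            rw [div_le_iff₀ hq] at this
            linarith
          · have h3 : ((i + 1 : ℕ) : ℝ) ≤ (y - r) / q + 1 := by
              have h4 : i + 1 ≤ n := hi.2
              exact (Nat.le_floor_iff' (by omega)).1 h4
            push_cast at h3
            have h5 : (i : ℝ) ≤ (y - r) / q := by linarith
            rw [le_div_iff₀ hq] at h5
            linarith
      have h5 : (y - x) ≤ q * (((Finset.Ico m n).card : ℝ) + 1) := by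
        rw [Nat.card_Ico]
        have hxr : -1 < (x - r) / q := by rw [lt_div_iff₀ hq]; linarith
        have hmle : (m : ℝ) < (x - r) / q + 1 := by
          rcases le_or_gt ((x - r) / q) 0 with h6 | h6
          · rw [hm, Nat.ceil_eq_zero.2 h6]; push_cast; linarith
          · exact Nat.ceil_lt_add_one h6.le
        have hnge : (y - r) / q < n := by
          have := Nat.lt_floor_add_one ((y - r) / q + 1)
          linarith
        have hsubc : (n : ℝ) - m ≤ ((n - m : ℕ) : ℝ) := by
          have : (n : ℝ) ≤ ((n - m : ℕ) : ℝ) + m := by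
            exact_mod_cast (by omega : n ≤ n - m + m)
          linarith
        have : (y - x) / q ≤ ((n - m : ℕ) : ℝ) + 1 := by
          have : (y - x) / q = (y - r) / q - (x - r) / q := by ring
          linarith
        rw [div_le_iff₀ hq] at this
        linarith
      calc ENNReal.ofReal (y - x) ≤ ENNReal.ofReal (q * (((Finset.Ico m n).card : ℝ) + 1)) :=
            ENNReal.ofReal_le_ofReal h5
        _ = ENNReal.ofReal q * (((Finset.Ico m n).card : ℝ≥0∞) + 1) := by
            rw [ENNReal.ofReal_mul hq.le, ENNReal.ofReal_add (by positivity) (by positivity)]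
            simp
        _ ≤ _ := mul_le_mul_right (add_le_add_left hsub _) _
    intro x hx y hy
    rcases le_total x y with hxy | hxy
    · rw [edist_comm, edist_dist, Real.dist_eq, abs_of_nonneg (by linarith)]
      exact main x hx y hy hxy
    · rw [edist_dist, Real.dist_eq, abs_of_nonneg (by linarith)]
      exact main y hy x hx hxy
  unfold densityMeasure
  rw [Measure.smul_apply, smul_eq_mul, Measure.restrict_apply hIm]
  refine (mul_le_mul_right key _).trans ?_
  rw [← mul_assoc, ← ENNReal.ofReal_mul (by positivity), inv_mul_cancel₀ hq.ne']
  simp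

lemma intervalClose_ap {q r lo : ℝ} (hq : 0 < q) (h1 : lo ≤ r) (h2 : r ≤ lo + q) :
    IntervalClose (apMeasure q r) (densityMeasure q lo) :=
  fun _ hI => ⟨ap_le_density hq h1 hI, density_le_ap hq h2 hI⟩

lemma unimodal_ite {φ : ℝ → ℝ} {C : Set ℝ} [DecidablePred (· ∈ C)] (hC : C.OrdConnected)
    (hφ : MonotoneOn φ C) : Unimodal fun x => if x ∈ C then φ x else 0 := by
  intro t ht
  refine ⟨fun x hx y hy v hv => ?_⟩
  simp only [mem_ofPred_eq] at hx hy ⊢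
  have hxC : x ∈ C := by
    by_contra hcon
    rw [if_neg hcon] at hx
    linarith
  have hyC : y ∈ C := by
    by_contra hcon
    rw [if_neg hcon] at hy
    linarith
  have hvC : v ∈ C := hC.out hxC hyC hv
  rw [if_pos hxC] at hx
  rw [if_pos hvC]
  exact hx.trans_le (hφ hxC hvC hv.1)

/-- Sum over the residue class `r` modulo `q`. -/
lemma tsum_mod_eq (q r : ℕ) (hr : r < q) (f : ℕ → ℝ≥0∞) :
    ∑' n : ℕ, (if n % q = r then f n else 0) = ∑' n : ℕ, f (r + q * n) := by
  have hinj : Function.Injective fun n : ℕ => r + q * n := by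
    intro m n hmn
    simp only at hmn
    exact Nat.eq_of_mul_eq_mul_left (by omega : 0 < q) (by omega)
  have h1 := hinj.tsum_eq (f := fun n : ℕ => if n % q = r then f n else 0) (by
    intro n hn
    simp only [Function.mem_support, ne_eq, ite_eq_right_iff, Classical.not_imp] at hn
    exact ⟨n / q, by have := Nat.mod_add_div n q; simp only; omega⟩)
  rw [← h1]
  refine tsum_congr fun n => ?_
  rw [if_pos]
  rw [Nat.add_mul_mod_self_left, Nat.mod_eq_of_lt hr]

/-- Sums over a lattice coset in the plane, presented by its rows, against the integral over the
positive quadrant. The rows have distance `q₁`, and each row has mesh `q₂`. -/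
lemma lattice_sum_close {G : ℝ → ℝ → ℝ} {B H₂ : ℝ} {M : ℝ≥0∞} {S : Set ℝ} {q₁ q₂ : ℝ} {r : ℕ → ℝ}
    (hq₁ : 0 < q₁) (hq₂ : 1 ≤ q₂) (hr : ∀ m, 0 ≤ r m ∧ r m ≤ q₂) (hG0 : ∀ x y, 0 ≤ G x y)
    (hGm : Measurable (Function.uncurry G)) (hGB : ∀ x y, G x y ≤ B)
    (hS : MeasurableSet S) (hSG : ∀ x y, G x y ≠ 0 → x ∈ S) (hSM : apMeasure q₁ 0 S ≤ M)
    (hH₂ : ∀ x y, 0 < y → G x y ≠ 0 → y ≤ H₂)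
    (h1 : ∀ x, Unimodal fun y => G x y) (h2 : ∀ y, Unimodal fun x => G x y) :
    (∑' m : ℕ, ∑' n : ℕ, ENNReal.ofReal (G (q₁ * m) (r m + q₂ * n)) ≤
      ENNReal.ofReal (q₁ * q₂)⁻¹ * (∫⁻ y in Ioi (0 : ℝ), ∫⁻ x in Ioi (0 : ℝ), ENNReal.ofReal (G x y))
        + (M + ENNReal.ofReal H₂) * ENNReal.ofReal B) ∧
    (ENNReal.ofReal (q₁ * q₂)⁻¹ * (∫⁻ y in Ioi (0 : ℝ), ∫⁻ x in Ioi (0 : ℝ), ENNReal.ofReal (G x y)) ≤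
      ∑' m : ℕ, ∑' n : ℕ, ENNReal.ofReal (G (q₁ * m) (r m + q₂ * n))
        + (M + ENNReal.ofReal H₂) * ENNReal.ofReal B) := by
  have hq₂' : 0 < q₂ := by linarith
  have hGx : ∀ x, Measurable fun y => G x y := fun x => hGm.comp (measurable_const.prodMk measurable_id)
  have hGy : ∀ y, Measurable fun x => G x y := fun y => hGm.comp (measurable_id.prodMk measurable_const)
  have hGE : Measurable (Function.uncurry fun x y => ENNReal.ofReal (G x y)) :=
    ENNReal.measurable_ofReal.comp hGm
  set P := ∑' m : ℕ, ∑' n : ℕ, ENNReal.ofReal (G (q₁ * m) (r m + q₂ * n)) with hP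
  set T := ∫⁻ x, ∫⁻ y, ENNReal.ofReal (G x y) ∂(densityMeasure q₂ 0) ∂(apMeasure q₁ 0) with hT
  have hTsum : T = ∑' m : ℕ, ∫⁻ y, ENNReal.ofReal (G (q₁ * m) y) ∂(densityMeasure q₂ 0) := by
    rw [hT, lintegral_apMeasure]; simp only [zero_add]
  have hSsum : ∑' m : ℕ, (S.indicator (fun _ => ENNReal.ofReal B) (q₁ * m)) ≤
      M * ENNReal.ofReal B := by
    have := lintegral_apMeasure q₁ 0 (S.indicator fun _ => ENNReal.ofReal B)
    simp only [zero_add] at this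
    rw [← this, lintegral_indicator_const hS, mul_comm]
    exact mul_le_mul_left hSM _
  -- In each row that meets the support, the sum is replaced by the integral.
  have hrow : ∀ m : ℕ,
      (∑' n : ℕ, ENNReal.ofReal (G (q₁ * m) (r m + q₂ * n)) ≤
        ∫⁻ y, ENNReal.ofReal (G (q₁ * m) y) ∂(densityMeasure q₂ 0)
          + S.indicator (fun _ => ENNReal.ofReal B) (q₁ * m)) ∧
      (∫⁻ y, ENNReal.ofReal (G (q₁ * m) y) ∂(densityMeasure q₂ 0) ≤
        ∑' n : ℕ, ENNReal.ofReal (G (q₁ * m) (r m + q₂ * n))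
          + S.indicator (fun _ => ENNReal.ofReal B) (q₁ * m)) := by
    intro m
    rw [← lintegral_apMeasure q₂ (r m) fun y => ENNReal.ofReal (G (q₁ * m) y)]
    by_cases hmS : q₁ * m ∈ S
    · rw [indicator_of_mem hmS]
      have hc : IntervalClose (apMeasure q₂ (r m)) (densityMeasure q₂ 0) :=
        intervalClose_ap hq₂' (hr m).1 (by simpa using (hr m).2)
      exact ⟨hc.lintegral_le (hG0 _) (hGx _) (hGB _) (h1 _),
        hc.symm.lintegral_le (hG0 _) (hGx _) (hGB _) (h1 _)⟩
    · have hz : ∀ y, G (q₁ * m) y = 0 := fun y => by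
        by_contra hne
        exact hmS (hSG _ _ hne)
      simp [hz]
  have hPT : P ≤ T + M * ENNReal.ofReal B := by
    rw [hP, hTsum]
    refine (ENNReal.tsum_le_tsum fun m => (hrow m).1).trans ?_
    rw [ENNReal.tsum_add]
    exact add_le_add_right hSsum _
  have hTP : T ≤ P + M * ENNReal.ofReal B := by
    rw [hP, hTsum]
    refine (ENNReal.tsum_le_tsum fun m => (hrow m).2).trans ?_
    rw [ENNReal.tsum_add]
    exact add_le_add_right hSsum _
  -- For each `y`, the sum over the rows is replaced by the integral over `x`.
  have hTswap : T = ENNReal.ofReal q₂⁻¹ * ∫⁻ y in Ioi (0 : ℝ),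
      ∫⁻ x, ENNReal.ofReal (G x y) ∂(apMeasure q₁ 0) := by
    rw [hT, lintegral_lintegral_swap hGE.aemeasurable, lintegral_densityMeasure]
  have hmain : ENNReal.ofReal (q₁ * q₂)⁻¹ * (∫⁻ y in Ioi (0 : ℝ), ∫⁻ x in Ioi (0 : ℝ),
      ENNReal.ofReal (G x y)) = ENNReal.ofReal q₂⁻¹ * ∫⁻ y in Ioi (0 : ℝ),
      ∫⁻ x, ENNReal.ofReal (G x y) ∂(densityMeasure q₁ 0) := by
    simp only [lintegral_densityMeasure]
    rw [lintegral_const_mul' _ _ ENNReal.ofReal_ne_top, ← mul_assoc,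
      ← ENNReal.ofReal_mul (by positivity)]
    congr 3
    field_simp
  have hcol : ∀ y ∈ Ioi (0 : ℝ),
      (∫⁻ x, ENNReal.ofReal (G x y) ∂(apMeasure q₁ 0) ≤
        ∫⁻ x, ENNReal.ofReal (G x y) ∂(densityMeasure q₁ 0)
          + (Ioc 0 H₂).indicator (fun _ => ENNReal.ofReal B) y) ∧
      (∫⁻ x, ENNReal.ofReal (G x y) ∂(densityMeasure q₁ 0) ≤
        ∫⁻ x, ENNReal.ofReal (G x y) ∂(apMeasure q₁ 0)
          + (Ioc 0 H₂).indicator (fun _ => ENNReal.ofReal B) y) := by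
    intro y hy
    by_cases hyH : y ∈ Ioc 0 H₂
    · rw [indicator_of_mem hyH]
      have hc : IntervalClose (apMeasure q₁ 0) (densityMeasure q₁ 0) :=
        intervalClose_ap hq₁ le_rfl (by linarith)
      exact ⟨hc.lintegral_le (fun x => hG0 x y) (hGy _) (fun x => hGB x y) (h2 _),
        hc.symm.lintegral_le (fun x => hG0 x y) (hGy _) (fun x => hGB x y) (h2 _)⟩
    · have hz : ∀ x, G x y = 0 := fun x => by
        by_contra hne
        exact hyH ⟨hy, hH₂ x y hy hne⟩
      simp [hz]
  have herr : ENNReal.ofReal q₂⁻¹ * ∫⁻ y in Ioi (0 : ℝ),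
      (Ioc 0 H₂).indicator (fun _ => ENNReal.ofReal B) y ≤ ENNReal.ofReal H₂ * ENNReal.ofReal B := by
    have h3 : ∫⁻ y in Ioi (0 : ℝ), (Ioc 0 H₂).indicator (fun _ => ENNReal.ofReal B) y ≤
        ENNReal.ofReal H₂ * ENNReal.ofReal B := by
      refine (setLIntegral_le_lintegral _ _).trans ?_
      rw [lintegral_indicator_const measurableSet_Ioc, Real.volume_Ioc, sub_zero, mul_comm]
    refine (mul_le_mul_right h3 _).trans ?_
    have h4 : ENNReal.ofReal q₂⁻¹ ≤ 1 := by
      rw [← ENNReal.ofReal_one]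
      exact ENNReal.ofReal_le_ofReal (inv_le_one_of_one_le₀ hq₂)
    exact (mul_le_mul_left h4 _).trans (by rw [one_mul])
  have hind : Measurable ((Ioc 0 H₂).indicator fun _ : ℝ => ENNReal.ofReal B) :=
    measurable_const.indicator measurableSet_Ioc
  have hTQ : T ≤ ENNReal.ofReal (q₁ * q₂)⁻¹ * (∫⁻ y in Ioi (0 : ℝ), ∫⁻ x in Ioi (0 : ℝ),
      ENNReal.ofReal (G x y)) + ENNReal.ofReal H₂ * ENNReal.ofReal B := by
    rw [hTswap, hmain]
    refine (mul_le_mul_right (setLIntegral_mono' measurableSet_Ioi fun y hy => (hcol y hy).1) _).trans ?_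
    rw [lintegral_add_right _ hind, mul_add]
    exact add_le_add_right herr _
  have hQT : ENNReal.ofReal (q₁ * q₂)⁻¹ * (∫⁻ y in Ioi (0 : ℝ), ∫⁻ x in Ioi (0 : ℝ),
      ENNReal.ofReal (G x y)) ≤ T + ENNReal.ofReal H₂ * ENNReal.ofReal B := by
    rw [hTswap, hmain]
    refine (mul_le_mul_right (setLIntegral_mono' measurableSet_Ioi fun y hy => (hcol y hy).2) _).trans ?_
    rw [lintegral_add_right _ hind, mul_add]
    exact add_le_add_right herr _
  rw [add_mul]
  constructor
  · calc P ≤ T + M * ENNReal.ofReal B := hPT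
      _ ≤ _ := by
        refine (add_le_add_left hTQ _).trans (le_of_eq ?_)
        ring
  · refine hQT.trans ((add_le_add_left hTP _).trans (le_of_eq ?_))
    ring

/-! ### Weights and the sum over the linear forms with a given basis -/

/-- The properties shared by `U + W + max Y Z`, which gives the Frobenius number, and by
`√(U W + U Y + W Z)`, which gives its mean value. -/
structure IsWeight (Φ : ℝ → ℝ → ℝ → ℝ → ℝ) : Prop where
  nonneg : ∀ {U W Y Z : ℝ}, 0 ≤ U → 0 ≤ W → 0 ≤ Y → 0 ≤ Z → 0 ≤ Φ U W Y Z
  le_frob : ∀ {U W Y Z : ℝ}, 0 ≤ U → 0 ≤ W → 0 ≤ Y → 0 ≤ Z → Φ U W Y Z ≤ U + W + max Y Z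
  mono : ∀ {U W Y Z U' W' Y' Z' : ℝ}, 0 ≤ U → 0 ≤ W → 0 ≤ Y → 0 ≤ Z →
    U ≤ U' → W ≤ W' → Y ≤ Y' → Z ≤ Z' → Φ U W Y Z ≤ Φ U' W' Y' Z'
  hom : ∀ {t U W Y Z : ℝ}, 0 ≤ t → Φ (t * U) (t * W) (t * Y) (t * Z) = t * Φ U W Y Z
  symm : ∀ U W Y Z : ℝ, Φ W U Z Y = Φ U W Y Z
  cont : Continuous fun p : ℝ × ℝ × ℝ × ℝ => Φ p.1 p.2.1 p.2.2.1 p.2.2.2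
  /-- Monotonicity in the coordinates `(η, τ)` of the strip belonging to `U` and `W`. -/
  strip : ∀ {U W W' η τ : ℝ}, 0 ≤ U → 0 ≤ W → W ≤ W' → 0 ≤ τ → τ ≤ 1 → 0 ≤ η →
    τ * W' ≤ η → (1 - τ) * U ≤ η →
    (U + W) * Φ U W (η - τ * W) (η - (1 - τ) * U) ≤
      (U + W') * Φ U W' (η - τ * W') (η - (1 - τ) * U)

/-- The weight of the Frobenius number. -/
lemma isWeight_frob : IsWeight fun U W Y Z => U + W + max Y Z where
  nonneg hU hW hY _ := add_nonneg (add_nonneg hU hW) (hY.trans (le_max_left _ _))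
  le_frob _ _ _ _ := le_rfl
  mono _ _ _ _ h1 h2 h3 h4 := add_le_add (add_le_add h1 h2) (max_le_max h3 h4)
  hom ht := by rw [← mul_max_of_nonneg _ _ ht]; ring
  symm U W Y Z := by rw [max_comm, add_comm W U]
  cont := by fun_prop
  strip := by
    intro U W W' η τ hU hW hWW hτ hτ1 hη h1 h2
    rw [← max_add_add_left, ← max_add_add_left,
      mul_max_of_nonneg _ _ (by positivity), mul_max_of_nonneg _ _ (by linarith)]
    refine max_le_max ?_ ?_
    · have h3 : 0 ≤ (W' - W) * (η + U * (1 - τ)) := mul_nonneg (by linarith)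
        (add_nonneg hη (mul_nonneg hU (by linarith)))
      have h4 : 0 ≤ (1 - τ) * ((W' - W) * (W + W' + U)) :=
        mul_nonneg (by linarith) (mul_nonneg (by linarith) (by linarith))
      nlinarith
    · have h3 : 0 ≤ (W' - W) * (η - (1 - τ) * U) := mul_nonneg (by linarith) (by linarith)
      have h4 : 0 ≤ (W' - W) * (W + W' + 2 * U) := mul_nonneg (by linarith) (by linarith)
      nlinarith

/-- The weight of `√(a b c)`. -/
lemma isWeight_sqrt : IsWeight fun U W Y Z => √(U * W + U * Y + W * Z) where
  nonneg _ _ _ _ := Real.sqrt_nonneg _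
  le_frob {U W Y Z} hU hW hY hZ := by
    have h1 := le_max_left Y Z
    have h2 := le_max_right Y Z
    refine Real.sqrt_le_iff.2 ⟨by linarith, ?_⟩
    nlinarith [mul_nonneg hU hW, mul_le_mul_of_nonneg_left h1 hU, mul_le_mul_of_nonneg_left h2 hW,
      mul_nonneg hU (hY.trans h1), mul_nonneg hW (hY.trans h1), sq_nonneg (max Y Z),
      sq_nonneg U, sq_nonneg W]
  mono {U W Y Z U' W' Y' Z'} hU hW hY hZ h1 h2 h3 h4 := by
    apply Real.sqrt_le_sqrt
    have := mul_le_mul h1 h2 hW (hU.trans h1)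
    have := mul_le_mul h1 h3 hY (hU.trans h1)
    have := mul_le_mul h2 h4 hZ (hW.trans h2)
    linarith
  hom {t U W Y Z} ht := by
    rw [show t * U * (t * W) + t * U * (t * Y) + t * W * (t * Z) =
      t ^ 2 * (U * W + U * Y + W * Z) by ring, Real.sqrt_mul (by positivity), Real.sqrt_sq ht]
  symm U W Y Z := by congr 1; ring
  cont := by fun_prop
  strip := by
    intro U W W' η τ hU hW hWW hτ hτ1 hη h1 h2
    rw [show U * W + U * (η - τ * W) + W * (η - (1 - τ) * U) = (U + W) * η by ring,
      show U * W' + U * (η - τ * W') + W' * (η - (1 - τ) * U) = (U + W') * η by ring]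
    exact mul_le_mul (by linarith) (Real.sqrt_le_sqrt (by nlinarith)) (Real.sqrt_nonneg _)
      (by linarith)

/-- The congruence condition `d ∣ b`, `d ∣ c` on `(j, k)`, for a squarefree divisor `d` of
`a`, describes a sublattice of index `d`: only the rows `j` divisible by some `d₂` occur,
and then `k` runs over one residue class modulo `d₁ = d / d₂`. -/
lemma exists_row_structure {u w y z d : ℕ} (hd : Squarefree d) (hda : d ∣ u * w + u * y + w * z)
    (hprim : Nat.gcd (Nat.gcd u w) (Nat.gcd y z) = 1) :
    ∃ d₁ d₂ : ℕ, 0 < d₁ ∧ 0 < d₂ ∧ d₂ * d₁ = d ∧ ∃ r : ℕ → ℕ, (∀ j, r j < d₁) ∧ ∀ j k : ℕ,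
      (d ∣ j * (w + y) + k * y ∧ d ∣ j * z + k * (u + z)) ↔ (d₂ ∣ j ∧ k % d₁ = r j) := by
  have hd0 : 0 < d := Nat.pos_of_ne_zero hd.ne_zero
  set d₂ := Nat.gcd d (Nat.gcd y (u + z)) with hd₂
  obtain ⟨d₁, hd₁⟩ : d₂ ∣ d := Nat.gcd_dvd_left _ _
  have hd₂0 : 0 < d₂ := Nat.gcd_pos_of_pos_left _ hd0
  have hd₁0 : 0 < d₁ := by
    rcases Nat.eq_zero_or_pos d₁ with h | h
    · rw [h] at hd₁; omega
    · exact h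
  have hd₂y : d₂ ∣ y := (Nat.gcd_dvd_right _ _).trans (Nat.gcd_dvd_left _ _)
  have hd₂s : d₂ ∣ u + z := (Nat.gcd_dvd_right _ _).trans (Nat.gcd_dvd_right _ _)
  have hco : Nat.Coprime d₂ d₁ := Nat.coprime_of_squarefree_mul (hd₁ ▸ hd)
  have hco1 : Nat.gcd d₁ (Nat.gcd y (u + z)) = 1 := by
    have h1 : Nat.gcd d₁ (Nat.gcd y (u + z)) ∣ d₁ := Nat.gcd_dvd_left _ _
    have h2 : Nat.gcd d₁ (Nat.gcd y (u + z)) ∣ d₂ :=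
      Nat.dvd_gcd (h1.trans ⟨d₂, by rw [mul_comm]; exact hd₁⟩) (Nat.gcd_dvd_right _ _)
    exact Nat.dvd_one.1 (hco ▸ Nat.dvd_gcd h2 h1)
  have hco2 : Nat.gcd d₂ (Nat.gcd (w + y) z) = 1 := by
    have h1 := Nat.gcd_dvd_left d₂ (Nat.gcd (w + y) z)
    have h2 := Nat.gcd_dvd_right d₂ (Nat.gcd (w + y) z)
    have hy := h1.trans hd₂y
    have hz := h2.trans (Nat.gcd_dvd_right _ _)
    have hw := (Nat.dvd_add_left hy).1 (h2.trans (Nat.gcd_dvd_left _ _))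
    have hu := (Nat.dvd_add_left hz).1 (h1.trans hd₂s)
    exact Nat.dvd_one.1 (hprim ▸ Nat.dvd_gcd (Nat.dvd_gcd hu hw) (Nat.dvd_gcd hy hz))
  -- Modulo `d₁`, the congruences determine `k`, as `y` and `u + z` generate the unit ideal.
  obtain ⟨α, β, γ, hbez⟩ : ∃ α β γ : ℤ, α * y + β * (u + z) + γ * d₁ = 1 := by
    have h1 := Nat.gcd_eq_gcd_ab d₁ (Nat.gcd y (u + z))
    have h2 := Nat.gcd_eq_gcd_ab y (u + z)
    rw [hco1, h2] at h1
    push_cast at h1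
    exact ⟨y.gcdA (u + z) * d₁.gcdB (y.gcd (u + z)), y.gcdB (u + z) * d₁.gcdB (y.gcd (u + z)),
      d₁.gcdA (y.gcd (u + z)), by linear_combination -h1⟩
  have hd₁z : (0 : ℤ) < d₁ := by exact_mod_cast hd₁0
  obtain ⟨e, he⟩ : (d₁ : ℤ) ∣ u * w + u * y + w * z := by
    have h1 : d₁ ∣ u * w + u * y + w * z := (Dvd.intro_left d₂ hd₁.symm).trans hda
    exact_mod_cast h1
  set m : ℤ := α * (w + y) + β * z with hm
  refine ⟨d₁, d₂, hd₁0, hd₂0, hd₁.symm, fun j => ((-(j * m)) % (d₁ : ℤ)).toNat, ?_, ?_⟩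
  · intro j
    have h1 := Int.emod_nonneg (-(j * m)) hd₁z.ne'
    have h2 := Int.emod_lt_of_pos (-(j * m)) hd₁z
    simp only
    omega
  intro j k
  have hres : k % d₁ = ((-(j * m)) % (d₁ : ℤ)).toNat ↔ (d₁ : ℤ) ∣ k + j * m := by
    have h1 := Int.emod_nonneg (-(j * m)) hd₁z.ne'
    have h2 : (d₁ : ℤ) ∣ k + j * m ↔ (k : ℤ) % d₁ = (-(j * m)) % d₁ := by
      rw [Int.emod_eq_emod_iff_emod_sub_eq_zero, ← Int.dvd_iff_emod_eq_zero, sub_neg_eq_add]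
    rw [h2, ← Int.natCast_mod]
    omega
  simp only [hres]
  constructor
  · rintro ⟨h1, h2⟩
    constructor
    · have h3 : d₂ ∣ j * (w + y) := (Nat.dvd_add_left (hd₂y.mul_left k)).1
        ((Dvd.intro _ hd₁.symm).trans h1)
      have h4 : d₂ ∣ j * z := (Nat.dvd_add_left (hd₂s.mul_left k)).1
        ((Dvd.intro _ hd₁.symm).trans h2)
      have h5 := Nat.dvd_gcd h3 h4
      rw [Nat.gcd_mul_left] at h5
      exact Nat.Coprime.dvd_of_dvd_mul_right hco2 h5
    · obtain ⟨x₁, hx₁⟩ : (d₁ : ℤ) ∣ j * (w + y) + k * y := by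
        exact_mod_cast (Dvd.intro_left _ hd₁.symm).trans h1
      obtain ⟨x₂, hx₂⟩ : (d₁ : ℤ) ∣ j * z + k * (u + z) := by
        exact_mod_cast (Dvd.intro_left _ hd₁.symm).trans h2
      exact ⟨α * x₁ + β * x₂ + γ * k, by
        rw [hm]; linear_combination α * hx₁ + β * hx₂ - (k : ℤ) * hbez⟩
  · rintro ⟨h1, x, hx⟩
    have h3 : d₁ ∣ j * (w + y) + k * y := by
      have : (d₁ : ℤ) ∣ j * (w + y) + k * y := ⟨y * x + j * (w + y) * γ + j * β * e, by
        rw [hm] at hx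
        linear_combination y * hx - j * (w + y) * hbez + j * β * he⟩
      exact_mod_cast this
    have h4 : d₁ ∣ j * z + k * (u + z) := by
      have : (d₁ : ℤ) ∣ j * z + k * (u + z) := ⟨(u + z) * x + j * z * γ - j * α * e, by
        rw [hm] at hx
        linear_combination (u + z) * hx - j * z * hbez - j * α * he⟩
      exact_mod_cast this
    rw [hd₁]
    exact ⟨hco.mul_dvd_of_dvd_of_dvd (dvd_add (h1.mul_right _) (hd₂y.mul_left _)) h3,
      hco.mul_dvd_of_dvd_of_dvd (dvd_add (h1.mul_right _) (hd₂s.mul_left _)) h4⟩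

/-- The summand belonging to the parameters `(u, w, y, z, j, k)`, restricted to `b ≤ Yb`,
`0 < c ≤ Zb`. -/
noncomputable def paramTerm (Φ : ℝ → ℝ → ℝ → ℝ → ℝ) (Yb Zb u w y z j k : ℝ) : ℝ :=
  if 0 < j ∧ 0 ≤ k ∧ 0 < j * z + k * (u + z) ∧ j * (w + y) + k * y ≤ Yb ∧
      j * z + k * (u + z) ≤ Zb then
    Φ ((j * (w + y) + k * y) * u) ((j * z + k * (u + z)) * w) ((j * z + k * (u + z)) * y)
      ((j * (w + y) + k * y) * z)
  else 0

section ParamTerm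

variable {Φ : ℝ → ℝ → ℝ → ℝ → ℝ} {Yb Zb u w y z : ℝ}

lemma paramTerm_nonneg (hΦ : IsWeight Φ) (hu : 0 ≤ u) (hw : 0 ≤ w) (hy : 0 ≤ y) (hz : 0 ≤ z)
    (j k : ℝ) : 0 ≤ paramTerm Φ Yb Zb u w y z j k := by
  unfold paramTerm
  split_ifs with h
  · have := h.1
    have := h.2.1
    exact hΦ.nonneg (by positivity) (by positivity) (by positivity) (by positivity)
  · exact le_rfl

lemma measurable_paramTerm (hΦ : IsWeight Φ) :
    Measurable (Function.uncurry (paramTerm Φ Yb Zb u w y z)) := by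
  unfold paramTerm Function.uncurry
  refine Measurable.ite ?_ ?_ measurable_const
  · refine ((measurableSet_lt measurable_const measurable_fst).inter
      ((measurableSet_le measurable_const measurable_snd).inter
      ((measurableSet_lt (g := fun p : ℝ × ℝ => p.1 * z + p.2 * (u + z)) measurable_const
        (by fun_prop)).inter
      ((measurableSet_le (f := fun p : ℝ × ℝ => p.1 * (w + y) + p.2 * y) (by fun_prop)
        measurable_const).inter
        (measurableSet_le (f := fun p : ℝ × ℝ => p.1 * z + p.2 * (u + z)) (by fun_prop)
        measurable_const)))))
  · exact (hΦ.cont.comp (by fun_prop : Continuous fun p : ℝ × ℝ =>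
      ((p.1 * (w + y) + p.2 * y) * u, (p.1 * z + p.2 * (u + z)) * w,
        (p.1 * z + p.2 * (u + z)) * y, (p.1 * (w + y) + p.2 * y) * z))).measurable

lemma unimodal_paramTerm_right (hΦ : IsWeight Φ) (hu : 0 ≤ u) (hw : 0 ≤ w) (hy : 0 ≤ y)
    (hz : 0 ≤ z) (j : ℝ) : Unimodal fun k => paramTerm Φ Yb Zb u w y z j k := by
  classical
  unfold paramTerm
  refine unimodal_ite (C := {k | 0 < j ∧ 0 ≤ k ∧ 0 < j * z + k * (u + z) ∧
    j * (w + y) + k * y ≤ Yb ∧ j * z + k * (u + z) ≤ Zb}) ⟨?_⟩ ?_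
  · rintro k₁ ⟨h1, h2, h5, -, -⟩ k₂ ⟨-, -, -, h3, h4⟩ k ⟨hk1, hk2⟩
    refine ⟨h1, h2.trans hk1, h5.trans_le (by gcongr), ?_, ?_⟩
    · nlinarith [mul_le_mul_of_nonneg_right hk2 hy]
    · nlinarith [mul_le_mul_of_nonneg_right hk2 (add_nonneg hu hz)]
  · rintro k₁ ⟨h1, h2, -, -, -⟩ k₂ - hk
    have hb : j * (w + y) + k₁ * y ≤ j * (w + y) + k₂ * y := by gcongr
    have hc : j * z + k₁ * (u + z) ≤ j * z + k₂ * (u + z) := by gcongr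
    exact hΦ.mono (by positivity) (by positivity) (by positivity) (by positivity)
      (by gcongr) (by gcongr) (by gcongr) (by gcongr)

lemma unimodal_paramTerm_left (hΦ : IsWeight Φ) (hu : 0 ≤ u) (hw : 0 ≤ w) (hy : 0 ≤ y)
    (hz : 0 ≤ z) (k : ℝ) : Unimodal fun j => paramTerm Φ Yb Zb u w y z j k := by
  classical
  unfold paramTerm
  refine unimodal_ite (C := {j | 0 < j ∧ 0 ≤ k ∧ 0 < j * z + k * (u + z) ∧
    j * (w + y) + k * y ≤ Yb ∧ j * z + k * (u + z) ≤ Zb}) ⟨?_⟩ ?_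
  · rintro k₁ ⟨h1, h2, h5, -, -⟩ k₂ ⟨-, -, -, h3, h4⟩ j ⟨hk1, hk2⟩
    refine ⟨h1.trans_le hk1, h2, h5.trans_le (by gcongr), ?_, ?_⟩
    · nlinarith [mul_le_mul_of_nonneg_right hk2 (add_nonneg hw hy)]
    · nlinarith [mul_le_mul_of_nonneg_right hk2 hz]
  · rintro k₁ ⟨h1, h2, -, -, -⟩ k₂ - hk
    have hb : k₁ * (w + y) + k * y ≤ k₂ * (w + y) + k * y := by gcongr
    have hc : k₁ * z + k * (u + z) ≤ k₂ * z + k * (u + z) := by gcongr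
    exact hΦ.mono (by positivity) (by positivity) (by positivity) (by positivity)
      (by gcongr) (by gcongr) (by gcongr) (by gcongr)

end ParamTerm

/-- Two inequalities in `ℝ≥0∞` as an estimate of a difference of real numbers. The first bound of
the conclusion ensures that `toReal` is not a junk value. -/
lemma abs_sub_le_of_ennreal {S e c : ℝ} {H : ℝ≥0∞} (hS : 0 ≤ S) (he : 0 ≤ e) (hc : 0 < c)
    (h1 : ENNReal.ofReal S ≤ ENNReal.ofReal c * H + ENNReal.ofReal e)
    (h2 : ENNReal.ofReal c * H ≤ ENNReal.ofReal S + ENNReal.ofReal e) :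
    H ≠ ⊤ ∧ |S - c * H.toReal| ≤ e := by
  have hH : H ≠ ⊤ := by
    rintro rfl
    rw [ENNReal.mul_top (by simpa using hc)] at h2
    exact absurd h2 (by simp)
  refine ⟨hH, ?_⟩
  rw [← ENNReal.ofReal_toReal hH, ← ENNReal.ofReal_mul hc.le] at h1 h2
  rw [← ENNReal.ofReal_add (by positivity) he, ENNReal.ofReal_le_ofReal_iff (by positivity)] at h1
  rw [← ENNReal.ofReal_add hS he, ENNReal.ofReal_le_ofReal_iff (by positivity)] at h2
  rw [abs_le]
  constructor <;> linarith

/-- The integral which approximates the sum over `(j, k)` for a fixed basis. -/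
noncomputable def paramIntegral (Φ : ℝ → ℝ → ℝ → ℝ → ℝ) (Yb Zb u w y z : ℝ) : ℝ≥0∞ :=
  ∫⁻ k in Ioi (0 : ℝ), ∫⁻ j in Ioi (0 : ℝ), ENNReal.ofReal (paramTerm Φ Yb Zb u w y z j k)

lemma apMeasure_Ioc_le {q H : ℝ} (hq : 1 ≤ q) : apMeasure q 0 (Ioc 0 H) ≤ ENNReal.ofReal H := by
  classical
  rw [apMeasure_apply q 0 measurableSet_Ioc]
  have h : ∀ n : ℕ, (Ioc 0 H).indicator (fun _ => (1 : ℝ≥0∞)) (0 + q * n) ≤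
      if n ∈ Finset.Icc 1 ⌊H⌋₊ then 1 else 0 := by
    intro n
    by_cases hn : 0 + q * n ∈ Ioc 0 H
    · rw [indicator_of_mem hn, if_pos]
      rw [Finset.mem_Icc]
      rw [zero_add] at hn
      have h0 : n ≠ 0 := by
        rintro rfl
        simp at hn
      refine ⟨by omega, Nat.le_floor (le_trans ?_ hn.2)⟩
      nlinarith [Nat.cast_nonneg (α := ℝ) n]
    · rw [indicator_of_notMem hn]; exact zero_le
  refine (ENNReal.tsum_le_tsum h).trans ?_
  rw [tsum_eq_sum (s := Finset.Icc 1 ⌊H⌋₊) (fun n hn => if_neg hn), Finset.sum_ite_mem,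
    Finset.inter_self, Finset.sum_const, Nat.card_Icc, nsmul_one]
  rcases le_total 0 H with hH | hH
  · rw [← ENNReal.ofReal_natCast]
    exact ENNReal.ofReal_le_ofReal (by simpa using Nat.floor_le hH)
  · simp [Nat.floor_of_nonpos hH]

/-- `lattice_sum_close` for a summand with finite support and a lattice coset given by a
predicate `P` on pairs of natural numbers. -/
lemma row_sum_close {G : ℝ → ℝ → ℝ} {B H₂ M : ℝ} {S : Set ℝ} {q₁ q₂ : ℕ} {r : ℕ → ℕ}
    {P : ℕ → ℕ → Prop} [∀ j k, Decidable (P j k)] (hq₁ : 0 < q₁) (hq₂ : 0 < q₂)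
    (hr : ∀ j, r j < q₂) (hP : ∀ j k, P j k ↔ q₁ ∣ j ∧ k % q₂ = r j) (s t : Finset ℕ)
    (hst : ∀ j k : ℕ, G j k ≠ 0 → j ∈ s ∧ k ∈ t) (hM : 0 ≤ M) (hH0 : 0 ≤ H₂) (hB0 : 0 ≤ B)
    (hG0 : ∀ x y, 0 ≤ G x y) (hGm : Measurable (Function.uncurry G)) (hGB : ∀ x y, G x y ≤ B)
    (hS : MeasurableSet S) (hSG : ∀ x y, G x y ≠ 0 → x ∈ S)
    (hSM : apMeasure q₁ 0 S ≤ ENNReal.ofReal M) (hH₂ : ∀ x y, G x y ≠ 0 → y ≤ H₂)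
    (h1 : ∀ x, Unimodal fun y => G x y) (h2 : ∀ y, Unimodal fun x => G x y) :
    (∫⁻ y in Ioi (0 : ℝ), ∫⁻ x in Ioi (0 : ℝ), ENNReal.ofReal (G x y)) ≠ ⊤ ∧
    |∑ j ∈ s, ∑ k ∈ t, (if P j k then G j k else 0) - ((q₁ * q₂ : ℕ) : ℝ)⁻¹ *
      (∫⁻ y in Ioi (0 : ℝ), ∫⁻ x in Ioi (0 : ℝ), ENNReal.ofReal (G x y)).toReal| ≤
      (M + H₂) * B := by
  have hq₁' : (0 : ℝ) < q₁ := by exact_mod_cast hq₁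
  have hq₂' : (1 : ℝ) ≤ q₂ := by exact_mod_cast hq₂
  have hmain := lattice_sum_close (G := G) (B := B) (H₂ := H₂) (M := ENNReal.ofReal M)
    (S := S) (q₁ := q₁) (q₂ := q₂) (r := fun m => r (q₁ * m)) hq₁' hq₂'
    (fun m => ⟨by positivity, by exact_mod_cast (hr _).le⟩) hG0 hGm hGB hS hSG hSM
    (fun x y _ h => hH₂ x y h) h1 h2
  have hsum : ∑' m : ℕ, ∑' n : ℕ, ENNReal.ofReal (G (q₁ * m) ((r (q₁ * m) : ℕ) + q₂ * n)) =
      ENNReal.ofReal (∑ j ∈ s, ∑ k ∈ t, if P j k then G j k else 0) := by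
    have e1 : ∀ m : ℕ, ∑' n : ℕ, ENNReal.ofReal (G (q₁ * m) ((r (q₁ * m) : ℕ) + q₂ * n)) =
        ∑' k : ℕ, if k % q₂ = r (q₁ * m) then ENNReal.ofReal (G (q₁ * m) k) else 0 := by
      intro m
      rw [tsum_mod_eq q₂ (r (q₁ * m)) (hr _) fun k => ENNReal.ofReal (G (q₁ * m) k)]
      push_cast
      rfl
    have e2 := tsum_mod_eq q₁ 0 hq₁ fun j =>
      ∑' k : ℕ, if k % q₂ = r j then ENNReal.ofReal (G j k) else 0
    simp only [zero_add] at e2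
    push_cast at e2
    rw [tsum_congr e1, ← e2]
    have e3 : ∀ j : ℕ, (if j % q₁ = 0 then ∑' k : ℕ, (if k % q₂ = r j then ENNReal.ofReal (G j k)
        else 0) else 0) = ∑' k : ℕ, ENNReal.ofReal (if P j k then G j k else 0) := by
      intro j
      split_ifs with hj
      · refine tsum_congr fun k => ?_
        have h1 := hP j k
        by_cases hk : k % q₂ = r j
        · rw [if_pos hk, if_pos (h1.2 ⟨Nat.dvd_of_mod_eq_zero hj, hk⟩)]
        · rw [if_neg hk, if_neg (fun h => hk (h1.1 h).2), ENNReal.ofReal_zero]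
      · symm
        rw [ENNReal.tsum_eq_zero]
        intro k
        rw [if_neg, ENNReal.ofReal_zero]
        intro h
        exact hj (Nat.mod_eq_zero_of_dvd ((hP j k).1 h).1)
    rw [tsum_congr e3]
    rw [tsum_eq_sum (s := s)]
    · rw [ENNReal.ofReal_sum_of_nonneg fun j _ => Finset.sum_nonneg fun k _ => by
        split_ifs; exacts [hG0 _ _, le_rfl]]
      refine Finset.sum_congr rfl fun j _ => ?_
      rw [ENNReal.ofReal_sum_of_nonneg fun k _ => by split_ifs; exacts [hG0 _ _, le_rfl]]
      refine tsum_eq_sum fun k hk => ?_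
      by_cases hne : G j k = 0
      · simp [hne]
      · exact absurd (hst j k hne).2 hk
    · intro j hj
      rw [ENNReal.tsum_eq_zero]
      intro k
      by_cases hne : G j k = 0
      · simp [hne]
      · exact absurd (hst j k hne).1 hj
  rw [hsum, ← ENNReal.ofReal_add hM hH0, ← ENNReal.ofReal_mul (by positivity)] at hmain
  rw [Nat.cast_mul]
  exact abs_sub_le_of_ennreal (Finset.sum_nonneg fun j _ => Finset.sum_nonneg fun k _ => by
    split_ifs; exacts [hG0 _ _, le_rfl]) (by positivity) (by positivity) hmain.1 hmain.2

/-- The sum over `(j, k)` with `d ∣ b` and `d ∣ c`, for a squarefree divisor `d` of `a`. -/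
lemma param_sum_dvd {Φ : ℝ → ℝ → ℝ → ℝ → ℝ} (hΦ : IsWeight Φ) {Yb Zb J K B : ℝ} {u w y z d : ℕ}
    (hu : 0 < u) (hw : 0 < w) (hd : Squarefree d) (hda : d ∣ u * w + u * y + w * z)
    (hprim : Nat.gcd (Nat.gcd u w) (Nat.gcd y z) = 1) (hJ0 : 0 ≤ J) (hK0 : 0 ≤ K) (hB0 : 0 ≤ B)
    (hJ : ∀ j k : ℝ, paramTerm Φ Yb Zb u w y z j k ≠ 0 → j ≤ J)
    (hK : ∀ j k : ℝ, paramTerm Φ Yb Zb u w y z j k ≠ 0 → k ≤ K)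
    (hB : ∀ j k : ℝ, paramTerm Φ Yb Zb u w y z j k ≤ B) :
    paramIntegral Φ Yb Zb u w y z ≠ ⊤ ∧
    |(∑ j ∈ Finset.Icc 1 ⌊Yb⌋₊, ∑ k ∈ Finset.range (⌊Zb⌋₊ + 1),
        if d ∣ j * (w + y) + k * y ∧ d ∣ j * z + k * (u + z) then
          paramTerm Φ Yb Zb u w y z j k else 0)
      - (d : ℝ)⁻¹ * (paramIntegral Φ Yb Zb u w y z).toReal| ≤ (J + K) * B := by
  obtain ⟨d₁, d₂, hd₁, hd₂, hdd, r, hr, hiff⟩ := exists_row_structure hd hda hprim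
  have hu' : (0 : ℝ) ≤ u := by positivity
  have hw' : (0 : ℝ) ≤ w := by positivity
  have hy' : (0 : ℝ) ≤ y := by positivity
  have hz' : (0 : ℝ) ≤ z := by positivity
  have hd₂' : (1 : ℝ) ≤ d₂ := by exact_mod_cast hd₂
  have hne : ∀ j k, paramTerm Φ Yb Zb u w y z j k ≠ 0 → 0 < j ∧ 0 ≤ k ∧ 0 < j * z + k * (u + z) ∧
      j * (w + y) + k * y ≤ Yb ∧ j * z + k * (u + z) ≤ Zb := by
    intro j k h
    by_contra hcon
    exact h (by rw [paramTerm, if_neg hcon])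
  have hout : ∀ j k : ℕ, paramTerm Φ Yb Zb u w y z j k ≠ 0 →
      j ∈ Finset.Icc 1 ⌊Yb⌋₊ ∧ k ∈ Finset.range (⌊Zb⌋₊ + 1) := by
    intro j k h
    obtain ⟨h1, h2, -, h3, h4⟩ := hne _ _ h
    have hu1 : (1 : ℝ) ≤ u := by exact_mod_cast hu
    have hw1 : (1 : ℝ) ≤ w := by exact_mod_cast hw
    constructor
    · rw [Finset.mem_Icc]
      refine ⟨by exact_mod_cast h1, Nat.le_floor ?_⟩
      nlinarith [mul_nonneg h1.le hy', mul_nonneg h2 hy']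
    · rw [Finset.mem_range, Nat.lt_succ_iff]
      refine Nat.le_floor ?_
      nlinarith [mul_nonneg h1.le hz', mul_nonneg h2 hz']
  rw [← hdd]
  rw [← hdd] at hiff
  exact row_sum_close hd₂ hd₁ hr hiff _ _ hout hJ0 hK0 hB0
    (paramTerm_nonneg hΦ hu' hw' hy' hz') (measurable_paramTerm hΦ) hB measurableSet_Ioc
    (fun j k h => ⟨(hne j k h).1, hJ j k h⟩) (apMeasure_Ioc_le hd₂') hK
    (unimodal_paramTerm_right hΦ hu' hw' hy' hz') (unimodal_paramTerm_left hΦ hu' hw' hy' hz')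

/-! ### The linear form as variable, and the coprimality condition -/

lemma lintegral_affine (f : ℝ → ℝ≥0∞) {m : ℝ} (hm : 0 < m) (c : ℝ) :
    ∫⁻ x, f (m * x + c) = ENNReal.ofReal m⁻¹ * ∫⁻ x, f x := by
  have h1 : ∫⁻ x, f (m * x + c) = ∫⁻ y, f (y + c) ∂(Measure.map (m * ·) volume) :=
    (lintegral_map_equiv (fun y => f (y + c)) (Homeomorph.mulLeft₀ m hm.ne').toMeasurableEquiv).symm
  rw [h1, Real.map_volume_mul_left hm.ne', lintegral_smul_measure, smul_eq_mul,
    lintegral_add_right_eq_self f c, abs_of_pos (by positivity)]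

lemma setLIntegral_eq_of_forall_notMem {s : Set ℝ} (hs : MeasurableSet s) {f : ℝ → ℝ≥0∞}
    (h : ∀ x, x ∉ s → f x = 0) : ∫⁻ x in s, f x = ∫⁻ x, f x := by
  rw [← lintegral_indicator hs]
  refine lintegral_congr fun x => ?_
  by_cases hx : x ∈ s
  · rw [indicator_of_mem hx]
  · rw [indicator_of_notMem hx, h x hx]

/-- The value of the weight at the basis `(u + z, -y)`, `(z, -(w + y))` and the linear form
`(β, γ)`, provided that the form changes sign between the two basis vectors. -/
noncomputable def coneTerm (Φ : ℝ → ℝ → ℝ → ℝ → ℝ) (u w y z β γ : ℝ) : ℝ :=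
  if γ * y < β * (u + z) ∧ β * z ≤ γ * (w + y) then Φ (β * u) (γ * w) (γ * y) (β * z) else 0

section ConeTerm

variable {Φ : ℝ → ℝ → ℝ → ℝ → ℝ} {u w y z : ℝ}

lemma measurable_coneTerm (hΦ : IsWeight Φ) :
    Measurable (Function.uncurry (coneTerm Φ u w y z)) := by
  unfold coneTerm Function.uncurry
  refine Measurable.ite ?_ ?_ measurable_const
  · exact (measurableSet_lt (f := fun p : ℝ × ℝ => p.2 * y) (g := fun p => p.1 * (u + z))
      (by fun_prop) (by fun_prop)).inter (measurableSet_le (f := fun p : ℝ × ℝ => p.1 * z)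
      (g := fun p => p.2 * (w + y)) (by fun_prop) (by fun_prop))
  · exact (hΦ.cont.comp (by fun_prop : Continuous fun p : ℝ × ℝ =>
      (p.1 * u, p.2 * w, p.2 * y, p.1 * z))).measurable

lemma coneTerm_nonneg (hΦ : IsWeight Φ) (hu : 0 ≤ u) (hw : 0 ≤ w) (hy : 0 ≤ y) (hz : 0 ≤ z)
    {β γ : ℝ} (hβ : 0 ≤ β) (hγ : 0 ≤ γ) : 0 ≤ coneTerm Φ u w y z β γ := by
  unfold coneTerm
  split_ifs
  · exact hΦ.nonneg (by positivity) (by positivity) (by positivity) (by positivity)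
  · exact le_rfl

/-- The change of variables from `(j, k)` to the linear form `(β, γ)`. -/
lemma paramIntegral_eq (hΦ : IsWeight Φ) (hu : 0 < u) (hw : 0 < w) (hy : 0 ≤ y) (hz : 0 ≤ z)
    (Yb Zb : ℝ) :
    paramIntegral Φ Yb Zb u w y z = ENNReal.ofReal (u * w + u * y + w * z)⁻¹ *
      ∫⁻ β in Ioc 0 Yb, ∫⁻ γ in Ioc 0 Zb, ENNReal.ofReal (coneTerm Φ u w y z β γ) := by
  have hs : 0 < u + z := by linarith
  have hp : 0 < w + y := by linarith
  have ha : 0 < u * w + u * y + w * z := by positivity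
  set a := u * w + u * y + w * z with ha'
  set P := paramTerm Φ Yb Zb u w y z with hP
  have hPm := measurable_paramTerm (Yb := Yb) (Zb := Zb) (u := u) (w := w) (y := y) (z := z) hΦ
  have hnull : ∀ᵐ x : ℝ, x ≠ 0 := by
    rw [ae_iff]; simp
  -- The integrals extend over the whole line, where translations are available.
  have e1 : paramIntegral Φ Yb Zb u w y z = ∫⁻ k, ∫⁻ j, ENNReal.ofReal (P j k) := by
    unfold paramIntegral
    rw [← lintegral_indicator measurableSet_Ioi]
    refine lintegral_congr_ae ?_
    filter_upwards [hnull] with k hk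
    have hj : ∫⁻ j in Ioi (0 : ℝ), ENNReal.ofReal (P j k) = ∫⁻ j, ENNReal.ofReal (P j k) := by
      refine setLIntegral_eq_of_forall_notMem measurableSet_Ioi fun j hj => ?_
      rw [hP, paramTerm, if_neg (fun h => hj h.1), ENNReal.ofReal_zero]
    by_cases hk0 : k ∈ Ioi (0 : ℝ)
    · rw [indicator_of_mem hk0, hj]
    · rw [indicator_of_notMem hk0, ← hj]
      symm
      have : ∀ j, P j k = 0 := fun j => by
        rw [hP, paramTerm, if_neg]
        intro h
        exact hk0 (lt_of_le_of_ne h.2.1 (Ne.symm hk))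
      simp [this]
  -- the variable `b` instead of `j`
  have e2 : ∀ k, ∫⁻ j, ENNReal.ofReal (P j k) =
      ENNReal.ofReal (w + y)⁻¹ * ∫⁻ b, ENNReal.ofReal (P ((b - k * y) / (w + y)) k) := by
    intro k
    rw [← lintegral_affine (fun b => ENNReal.ofReal (P ((b - k * y) / (w + y)) k)) hp (k * y)]
    refine lintegral_congr fun j => ?_
    congr 2
    field_simp
    ring
  have hPm2 : Measurable (Function.uncurry fun k b => ENNReal.ofReal (P ((b - k * y) / (w + y)) k)) :=
    ENNReal.measurable_ofReal.comp (hPm.comp (by fun_prop :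
      Measurable fun p : ℝ × ℝ => ((p.2 - p.1 * y) / (w + y), p.1)))
  -- the variable `c` instead of `k`
  have e3 : ∀ b, ∫⁻ k, ENNReal.ofReal (P ((b - k * y) / (w + y)) k) =
      ENNReal.ofReal ((w + y) / a) * ∫⁻ c, ENNReal.ofReal
        (P ((b * (u + z) - c * y) / a) ((c * (w + y) - b * z) / a)) := by
    intro b
    have h1 := lintegral_affine (fun c => ENNReal.ofReal
        (P ((b * (u + z) - c * y) / a) ((c * (w + y) - b * z) / a)))
        (m := a / (w + y)) (by positivity) (b * z / (w + y))
    rw [inv_div] at h1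
    rw [← h1]
    refine lintegral_congr fun k => ?_
    have i1 : ((a / (w + y) * k + b * z / (w + y)) * (w + y) - b * z) / a = k := by
      field_simp; ring
    have i2 : (b * (u + z) - (a / (w + y) * k + b * z / (w + y)) * y) / a =
        (b - k * y) / (w + y) := by
      rw [ha']
      field_simp
      ring
    rw [i1, i2]
  have e4 : ∀ b c, P ((b * (u + z) - c * y) / a) ((c * (w + y) - b * z) / a) =
      if (c * y < b * (u + z) ∧ b * z ≤ c * (w + y)) ∧ 0 < c ∧ b ≤ Yb ∧ c ≤ Zb then
        Φ (b * u) (c * w) (c * y) (b * z) else 0 := by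
    intro b c
    have i1 : (b * (u + z) - c * y) / a * (w + y) + (c * (w + y) - b * z) / a * y = b := by
      rw [ha']; field_simp; ring
    have i2 : (b * (u + z) - c * y) / a * z + (c * (w + y) - b * z) / a * (u + z) = c := by
      rw [ha']; field_simp; ring
    rw [hP, paramTerm, i1, i2]
    have i3 : 0 < (b * (u + z) - c * y) / a ↔ c * y < b * (u + z) := by
      rw [div_pos_iff_of_pos_right ha, sub_pos]
    have i4 : 0 ≤ (c * (w + y) - b * z) / a ↔ b * z ≤ c * (w + y) := by
      rw [le_div_iff₀ ha, zero_mul, sub_nonneg]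
    simp only [i3, i4, and_assoc]
  rw [e1]
  simp only [e2]
  rw [lintegral_const_mul' _ _ ENNReal.ofReal_ne_top, lintegral_lintegral_swap hPm2.aemeasurable]
  simp only [e3]
  rw [lintegral_const_mul' _ _ ENNReal.ofReal_ne_top, ← mul_assoc,
    ← ENNReal.ofReal_mul (by positivity)]
  congr 1
  · congr 1; field_simp
  rw [← lintegral_indicator measurableSet_Ioc]
  refine lintegral_congr fun b => ?_
  have hbpos : ∀ c, (c * y < b * (u + z) ∧ b * z ≤ c * (w + y)) → 0 < b ∧ 0 ≤ c := by
    rintro c ⟨h1, h2⟩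
    have h3 : 0 < b * a := by
      have : b * a = (b * (u + z) - c * y) * (w + y) + (c * (w + y) - b * z) * y := by
        rw [ha']; ring
      rw [this]
      have := mul_pos (sub_pos.2 h1) hp
      have := mul_nonneg (sub_nonneg.2 h2) hy
      linarith
    have hb := pos_of_mul_pos_left h3 ha.le
    refine ⟨hb, ?_⟩
    have : 0 ≤ c * (w + y) := le_trans (by positivity) h2
    exact nonneg_of_mul_nonneg_left this hp
  by_cases hb : b ∈ Ioc 0 Yb
  · rw [indicator_of_mem hb, ← lintegral_indicator measurableSet_Ioc]
    refine lintegral_congr_ae ?_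
    filter_upwards [hnull] with c hc
    rw [e4]
    by_cases hcone : c * y < b * (u + z) ∧ b * z ≤ c * (w + y)
    · have hc0 : 0 < c := lt_of_le_of_ne (hbpos c hcone).2 (Ne.symm hc)
      by_cases hcZ : c ≤ Zb
      · rw [if_pos ⟨hcone, hc0, hb.2, hcZ⟩, indicator_of_mem (show c ∈ Ioc 0 Zb from ⟨hc0, hcZ⟩),
          coneTerm,
          if_pos hcone]
      · rw [if_neg (fun h => hcZ h.2.2.2),
          indicator_of_notMem (show c ∉ Ioc 0 Zb from fun h => hcZ h.2),
          ENNReal.ofReal_zero]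
    · rw [if_neg (fun h => hcone h.1), ENNReal.ofReal_zero]
      symm
      by_cases hcI : c ∈ Ioc 0 Zb
      · rw [indicator_of_mem hcI, coneTerm, if_neg hcone, ENNReal.ofReal_zero]
      · rw [indicator_of_notMem hcI]
  · rw [indicator_of_notMem hb]
    have : ∀ c, P ((b * (u + z) - c * y) / a) ((c * (w + y) - b * z) / a) = 0 := by
      intro c
      rw [e4, if_neg]
      rintro ⟨h1, -, h2, -⟩
      exact hb ⟨(hbpos c h1).1, h2⟩
    simp [this]

end ConeTerm

/-- `φ(n) / n`, written as a divisor sum. -/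
noncomputable def dens (n : ℕ) : ℝ := ∑ d ∈ n.divisors, (ArithmeticFunction.moebius d : ℝ) / d

lemma sum_divisors_moebius (n : ℕ) :
    ∑ d ∈ n.divisors, (ArithmeticFunction.moebius d : ℝ) = if n = 1 then 1 else 0 := by
  have h := congrArg (fun f : ArithmeticFunction ℤ => f n) ArithmeticFunction.moebius_mul_coe_zeta
  simp only [ArithmeticFunction.coe_mul_zeta_apply, ArithmeticFunction.one_apply] at h
  exact_mod_cast h

/-- The coprimality condition as a sum over the divisors of `a`. -/
lemma sum_divisors_moebius_ite {a : ℕ} (ha : a ≠ 0) (b c : ℕ) :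
    (if Nat.gcd (Nat.gcd a b) c = 1 then (1 : ℝ) else 0) =
      ∑ d ∈ a.divisors, (ArithmeticFunction.moebius d : ℝ) * if d ∣ b ∧ d ∣ c then 1 else 0 := by
  have hg : Nat.gcd (Nat.gcd a b) c ≠ 0 := Nat.gcd_ne_zero_left (Nat.gcd_ne_zero_left ha)
  rw [← sum_divisors_moebius]
  simp only [mul_ite, mul_one, mul_zero]
  rw [← Finset.sum_filter]
  refine Finset.sum_congr ?_ fun _ _ => rfl
  ext d
  simp only [Nat.mem_divisors, Finset.mem_filter, Nat.dvd_gcd_iff]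
  tauto

/-- The sum over `(j, k)` under the condition that `a, b, c` are coprime. -/
lemma param_sum_coprime {Φ : ℝ → ℝ → ℝ → ℝ → ℝ} (hΦ : IsWeight Φ) {Yb Zb J K B : ℝ} {u w y z : ℕ}
    (hu : 0 < u) (hw : 0 < w)
    (hprim : Nat.gcd (Nat.gcd u w) (Nat.gcd y z) = 1) (hJ0 : 0 ≤ J) (hK0 : 0 ≤ K) (hB0 : 0 ≤ B)
    (hJ : ∀ j k : ℝ, paramTerm Φ Yb Zb u w y z j k ≠ 0 → j ≤ J)
    (hK : ∀ j k : ℝ, paramTerm Φ Yb Zb u w y z j k ≠ 0 → k ≤ K)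
    (hB : ∀ j k : ℝ, paramTerm Φ Yb Zb u w y z j k ≤ B) :
    |(∑ j ∈ Finset.Icc 1 ⌊Yb⌋₊, ∑ k ∈ Finset.range (⌊Zb⌋₊ + 1),
        if Nat.gcd (Nat.gcd (u * w + u * y + w * z) (j * (w + y) + k * y)) (j * z + k * (u + z)) = 1
        then paramTerm Φ Yb Zb u w y z j k else 0)
      - dens (u * w + u * y + w * z) * (paramIntegral Φ Yb Zb u w y z).toReal|
      ≤ (u * w + u * y + w * z).divisors.card * ((J + K) * B) := by
  set a := u * w + u * y + w * z with ha
  have ha0 : a ≠ 0 := by have := Nat.mul_pos hu hw; omega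
  have e1 : (∑ j ∈ Finset.Icc 1 ⌊Yb⌋₊, ∑ k ∈ Finset.range (⌊Zb⌋₊ + 1),
        if Nat.gcd (Nat.gcd a (j * (w + y) + k * y)) (j * z + k * (u + z)) = 1
        then paramTerm Φ Yb Zb u w y z j k else 0) =
      ∑ d ∈ a.divisors, (ArithmeticFunction.moebius d : ℝ) *
        ∑ j ∈ Finset.Icc 1 ⌊Yb⌋₊, ∑ k ∈ Finset.range (⌊Zb⌋₊ + 1),
        if d ∣ j * (w + y) + k * y ∧ d ∣ j * z + k * (u + z) then
          paramTerm Φ Yb Zb u w y z j k else 0 := by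
    simp only [Finset.mul_sum]
    rw [Finset.sum_comm (s := a.divisors)]
    refine Finset.sum_congr rfl fun j _ => ?_
    rw [Finset.sum_comm (s := a.divisors)]
    refine Finset.sum_congr rfl fun k _ => ?_
    rw [← boole_mul, sum_divisors_moebius_ite ha0, Finset.sum_mul]
    refine Finset.sum_congr rfl fun d _ => ?_
    split_ifs <;> ring
  rw [e1, dens, Finset.sum_mul, ← Finset.sum_sub_distrib]
  refine (Finset.abs_sum_le_sum_abs _ _).trans ?_
  rw [← nsmul_eq_mul]
  refine Finset.sum_le_card_nsmul _ _ _ fun d hd => ?_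
  by_cases hsq : Squarefree d
  · have h1 := (param_sum_dvd hΦ hu hw hsq (Nat.dvd_of_mem_divisors hd) hprim hJ0 hK0 hB0 hJ hK hB).2
    have h2 : |(ArithmeticFunction.moebius d : ℝ)| ≤ 1 := by
      exact_mod_cast ArithmeticFunction.abs_moebius_le_one (n := d)
    rw [div_eq_mul_inv, mul_assoc, ← mul_sub, abs_mul]
    exact (mul_le_mul h2 h1 (abs_nonneg _) zero_le_one).trans (by rw [one_mul])
  · rw [ArithmeticFunction.moebius_eq_zero_of_not_squarefree hsq]
    simp only [Int.cast_zero, zero_mul, zero_div, sub_zero, abs_zero]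
    positivity

/-! ### Triples as pairs of a basis and a linear form -/

/-- The bases `(u + z, -y)`, `(z, -(w + y))`, encoded as `(u, w, y, z)`, of determinant at
most `n`. -/
def quads (n : ℕ) : Finset (ℕ × ℕ × ℕ × ℕ) :=
  (Finset.Icc 1 n ×ˢ Finset.Icc 1 n ×ˢ Finset.range (n + 1) ×ˢ Finset.range (n + 1)).filter
    fun q => q.1 * q.2.1 + q.1 * q.2.2.1 + q.2.1 * q.2.2.2 ≤ n

lemma mem_quads {n u w y z : ℕ} :
    (u, w, y, z) ∈ quads n ↔ 0 < u ∧ 0 < w ∧ u * w + u * y + w * z ≤ n := by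
  simp only [quads, Finset.mem_filter, Finset.mem_product, Finset.mem_Icc, Finset.mem_range]
  constructor
  · rintro ⟨⟨⟨h1, -⟩, ⟨h2, -⟩, -, -⟩, h3⟩
    exact ⟨h1, h2, h3⟩
  · rintro ⟨h1, h2, h3⟩
    have e1 : w ≤ u * w := Nat.le_mul_of_pos_left w h1
    have e2 : u ≤ u * w := Nat.le_mul_of_pos_right u h2
    have e3 : y ≤ u * y := Nat.le_mul_of_pos_left y h1
    have e4 : z ≤ w * z := Nat.le_mul_of_pos_left z h2
    refine ⟨⟨⟨h1, ?_⟩, ⟨h2, ?_⟩, ?_, ?_⟩, h3⟩ <;> omega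

/-- Summation over coprime triples in a box, in terms of the parameters. -/
lemma sum_triples_eq (Φ : ℝ → ℝ → ℝ → ℝ → ℝ) (v : ℕ → ℕ → ℕ → ℝ)
    (hv : ∀ a b c u w y z j k : ℕ, IsParam a b c u w y z j k → Nat.gcd (Nat.gcd a b) c = 1 →
      v a b c = Φ (b * u) (c * w) (c * y) (b * z)) (n : ℕ) (Yb Zb : ℝ) (hYb : 0 ≤ Yb)
    (hZb : 0 ≤ Zb) :
    ∑ a ∈ Finset.Icc 1 n, ∑ b ∈ Finset.Icc 1 ⌊Yb⌋₊,
        ∑ c ∈ Finset.Icc 1 ⌊Zb⌋₊ with Nat.gcd (Nat.gcd a b) c = 1, v a b c =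
      ∑ q ∈ quads n, ∑ j ∈ Finset.Icc 1 ⌊Yb⌋₊, ∑ k ∈ Finset.range (⌊Zb⌋₊ + 1),
        if Nat.gcd (Nat.gcd (q.1 * q.2.1 + q.1 * q.2.2.1 + q.2.1 * q.2.2.2)
            (j * (q.2.1 + q.2.2.1) + k * q.2.2.1)) (j * q.2.2.2 + k * (q.1 + q.2.2.2)) = 1
        then paramTerm Φ Yb Zb q.1 q.2.1 q.2.2.1 q.2.2.2 j k else 0 := by
  classical
  simp only [Finset.sum_filter]
  simp only [← Finset.sum_product']
  rw [← Finset.sum_filter, ← Finset.sum_filter]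
  symm
  have hterm : ∀ x ∈ (quads n ×ˢ Finset.Icc 1 ⌊Yb⌋₊ ×ˢ Finset.range (⌊Zb⌋₊ + 1)).filter
      (fun x => Nat.gcd (Nat.gcd (x.1.1 * x.1.2.1 + x.1.1 * x.1.2.2.1 + x.1.2.1 * x.1.2.2.2)
        (x.2.1 * (x.1.2.1 + x.1.2.2.1) + x.2.2 * x.1.2.2.1))
        (x.2.1 * x.1.2.2.2 + x.2.2 * (x.1.1 + x.1.2.2.2)) = 1),
      paramTerm Φ Yb Zb x.1.1 x.1.2.1 x.1.2.2.1 x.1.2.2.2 x.2.1 x.2.2 =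
      if 0 < x.2.1 * x.1.2.2.2 + x.2.2 * (x.1.1 + x.1.2.2.2) ∧
        x.2.1 * (x.1.2.1 + x.1.2.2.1) + x.2.2 * x.1.2.2.1 ≤ ⌊Yb⌋₊ ∧
        x.2.1 * x.1.2.2.2 + x.2.2 * (x.1.1 + x.1.2.2.2) ≤ ⌊Zb⌋₊ then
        paramTerm Φ Yb Zb x.1.1 x.1.2.1 x.1.2.2.1 x.1.2.2.2 x.2.1 x.2.2 else 0 := by
    intro x _
    split_ifs with h
    · rfl
    · rw [paramTerm, if_neg]
      rintro ⟨-, -, h0, h1, h2⟩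
      exact h ⟨by exact_mod_cast h0, Nat.le_floor (by exact_mod_cast h1), Nat.le_floor (by exact_mod_cast h2)⟩
  rw [Finset.sum_congr rfl hterm, ← Finset.sum_filter, Finset.filter_filter]
  refine Finset.sum_nbij
    (fun x => (x.1.1 * x.1.2.1 + x.1.1 * x.1.2.2.1 + x.1.2.1 * x.1.2.2.2,
      x.2.1 * (x.1.2.1 + x.1.2.2.1) + x.2.2 * x.1.2.2.1,
      x.2.1 * x.1.2.2.2 + x.2.2 * (x.1.1 + x.1.2.2.2))) ?_ ?_ ?_ ?_
  · rintro ⟨⟨u, w, y, z⟩, j, k⟩ hx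
    simp only [Finset.mem_filter, Finset.mem_product, Finset.mem_Icc, Finset.mem_range,
      mem_quads] at hx ⊢
    obtain ⟨⟨⟨hu, hw, hq⟩, ⟨hj, -⟩, hk⟩, hg, hc0, hb, hc⟩ := hx
    have h1 := Nat.mul_pos hu hw
    have h2 := Nat.mul_pos hj hw
    refine ⟨⟨⟨by omega, hq⟩, ⟨?_, hb⟩, hc0, hc⟩, hg⟩
    rw [mul_add]; omega
  · rintro ⟨⟨u, w, y, z⟩, j, k⟩ hx ⟨⟨u', w', y', z'⟩, j', k'⟩ hx' heq
    simp only [Finset.coe_filter, Finset.mem_product, Finset.mem_Icc, Finset.mem_range,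
      mem_quads, mem_ofPred_eq] at hx hx'
    simp only [Prod.mk.injEq] at heq
    have P : IsParam _ _ _ u w y z j k := ⟨hx.1.1.1, hx.1.1.2.1, hx.1.2.1.1, rfl, rfl, rfl⟩
    have P' : IsParam _ _ _ u' w' y' z' j' k' :=
      ⟨hx'.1.1.1, hx'.1.1.2.1, hx'.1.2.1.1, heq.1, heq.2.1, heq.2.2⟩
    obtain ⟨rfl, rfl, rfl, rfl, rfl, rfl⟩ := P.unique P' hx.2.1
    rfl
  · rintro ⟨a, b, c⟩ hx
    simp only [Finset.coe_filter, Finset.mem_product, Finset.mem_Icc, mem_ofPred_eq] at hx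
    obtain ⟨⟨⟨ha, han⟩, ⟨hb, hbn⟩, hc, hcn⟩, hg⟩ := hx
    obtain ⟨u, w, y, z, j, k, P⟩ := exists_isParam a b c ha hb hc hg
    refine ⟨((u, w, y, z), j, k), ?_, ?_⟩
    · simp only [Finset.coe_filter, Finset.mem_product, Finset.mem_Icc, Finset.mem_range,
        mem_quads, mem_ofPred_eq, ← P.a_eq, ← P.b_eq, ← P.c_eq]
      have hj : j ≤ b := by
        have h1 := Nat.le_mul_of_pos_right j P.w_pos
        have h2 := P.b_eq
        rw [mul_add] at h2
        omega
      have hk : k ≤ c := by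
        have h1 := Nat.le_mul_of_pos_right k P.u_pos
        have h2 := P.c_eq
        rw [mul_add] at h2
        omega
      exact ⟨⟨⟨P.u_pos, P.w_pos, han⟩, ⟨P.j_pos, by omega⟩, by omega⟩, hg, hc, hbn, hcn⟩
    · simp only [← P.a_eq, ← P.b_eq, ← P.c_eq]
  · rintro ⟨⟨u, w, y, z⟩, j, k⟩ hx
    simp only [Finset.mem_filter, Finset.mem_product, Finset.mem_Icc, Finset.mem_range,
      mem_quads] at hx ⊢
    obtain ⟨⟨⟨hu, hw, hq⟩, ⟨hj, -⟩, hk⟩, hg, hc0, hb, hc⟩ := hx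
    have P : IsParam _ _ _ u w y z j k := ⟨hu, hw, hj, rfl, rfl, rfl⟩
    rw [hv _ _ _ _ _ _ _ _ _ P hg, paramTerm, if_pos]
    · push_cast; rfl
    · refine ⟨by exact_mod_cast hj, by positivity, by exact_mod_cast hc0, ?_, ?_⟩
      · exact le_trans (by exact_mod_cast hb) (Nat.floor_le hYb)
      · exact le_trans (by exact_mod_cast hc) (Nat.floor_le hZb)

/-! ### The error terms, and the sum over triples as an integral over linear forms -/

/-- The harmonic sum `1 + 1/2 + ⋯ + 1/(n+1)`. -/
noncomputable def harmonicSum (n : ℕ) : ℝ := ∑ i ∈ Finset.range (n + 1), ((i : ℝ) + 1)⁻¹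

lemma one_le_harmonicSum (n : ℕ) : 1 ≤ harmonicSum n := by
  have h := Finset.single_le_sum (f := fun i : ℕ => ((i : ℝ) + 1)⁻¹) (s := Finset.range (n + 1))
    (fun i _ => by positivity) (Finset.mem_range.2 (Nat.succ_pos n))
  simpa [harmonicSum] using h

lemma sum_Icc_inv_le (n : ℕ) : ∑ i ∈ Finset.Icc 1 n, (i : ℝ)⁻¹ ≤ harmonicSum n := by
  have h : ∑ i ∈ Finset.Icc 1 n, (i : ℝ)⁻¹ = ∑ i ∈ Finset.range n, ((i : ℝ) + 1)⁻¹ := by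
    induction n with
    | zero => simp
    | succ m ih => rw [Finset.sum_Icc_succ_top (by omega), ih, Finset.sum_range_succ]; push_cast; rfl
  rw [h, harmonicSum, Finset.sum_range_succ]
  have : (0 : ℝ) ≤ ((n : ℝ) + 1)⁻¹ := by positivity
  linarith

/-- A sum over bases is bounded by summing over `(w, y, z)` first and counting the `u` by
`u (w + y) ≤ n`. -/
lemma sum_quads_le (n : ℕ) (F : ℕ → ℕ → ℕ → ℝ) (hF : ∀ w y z, 0 ≤ F w y z) :
    ∑ q ∈ quads n, F q.2.1 q.2.2.1 q.2.2.2 ≤ ∑ w ∈ Finset.Icc 1 n, ∑ y ∈ Finset.range (n + 1),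
      ∑ z ∈ Finset.range (n + 1), if w * z ≤ n then (n : ℝ) / (w + y) * F w y z else 0 := by
  have h1 : ∑ q ∈ quads n, F q.2.1 q.2.2.1 q.2.2.2 = ∑ u ∈ Finset.Icc 1 n, ∑ w ∈ Finset.Icc 1 n,
      ∑ y ∈ Finset.range (n + 1), ∑ z ∈ Finset.range (n + 1),
        if u * w + u * y + w * z ≤ n then F w y z else 0 := by
    rw [quads, Finset.sum_filter]
    simp only [Finset.sum_product]
  rw [h1, Finset.sum_comm]
  refine Finset.sum_le_sum fun w hw => ?_
  rw [Finset.sum_comm]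
  refine Finset.sum_le_sum fun y _ => ?_
  rw [Finset.sum_comm]
  refine Finset.sum_le_sum fun z _ => ?_
  have hw1 := (Finset.mem_Icc.1 hw).1
  have hwy : (0 : ℝ) < w + y := by exact_mod_cast (by omega : 0 < w + y)
  split_ifs with hwz
  · rw [← Finset.sum_filter, Finset.sum_const, nsmul_eq_mul]
    refine mul_le_mul_of_nonneg_right ?_ (hF w y z)
    have h2 : ((Finset.Icc 1 n).filter fun u => u * w + u * y + w * z ≤ n) ⊆
        Finset.Icc 1 (n / (w + y)) := by
      intro u hu
      rw [Finset.mem_filter, Finset.mem_Icc] at hu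
      rw [Finset.mem_Icc, Nat.le_div_iff_mul_le (by omega), mul_add]
      omega
    have h3 := Finset.card_le_card h2
    rw [Nat.card_Icc, Nat.add_sub_cancel] at h3
    calc (_ : ℝ) ≤ ((n / (w + y) : ℕ) : ℝ) := by exact_mod_cast h3
      _ ≤ _ := by exact_mod_cast Nat.cast_div_le
  · refine (Finset.sum_eq_zero fun u _ => if_neg ?_).le
    omega

lemma card_quads_le (n : ℕ) : ((quads n).card : ℝ) ≤ 2 * n ^ 2 * harmonicSum n ^ 2 := by
  have h := sum_quads_le n (fun _ _ _ => 1) (fun _ _ _ => zero_le_one)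
  simp only [Finset.sum_const, nsmul_eq_mul, mul_one] at h
  refine h.trans ?_
  have h2 : ∀ w ∈ Finset.Icc 1 n, ∀ y ∈ Finset.range (n + 1),
      (∑ z ∈ Finset.range (n + 1), if w * z ≤ n then (n : ℝ) / (w + y) else 0) ≤
        2 * n ^ 2 * ((w : ℝ)⁻¹ * ((y : ℝ) + 1)⁻¹) := by
    intro w hw y _
    obtain ⟨hw1, hwn⟩ := Finset.mem_Icc.1 hw
    have hw0 : (0 : ℝ) < w := by exact_mod_cast hw1
    have hw1' : (1 : ℝ) ≤ w := by exact_mod_cast hw1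
    rw [← Finset.sum_filter, Finset.sum_const, nsmul_eq_mul]
    have h3 : ((Finset.range (n + 1)).filter fun z => w * z ≤ n) ⊆ Finset.range (n / w + 1) := by
      intro z hz
      rw [Finset.mem_filter] at hz
      rw [Finset.mem_range, Nat.lt_succ_iff, Nat.le_div_iff_mul_le (by omega), mul_comm]
      exact hz.2
    have h4 := Finset.card_le_card h3
    rw [Finset.card_range] at h4
    have h5 : (((Finset.range (n + 1)).filter fun z => w * z ≤ n).card : ℝ) ≤ 2 * (n / w) := by
      have h6 : ((n / w : ℕ) : ℝ) ≤ n / w := Nat.cast_div_le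
      have h7 : (1 : ℝ) ≤ n / w := by
        rw [le_div_iff₀ hw0, one_mul]; exact_mod_cast hwn
      have : (((Finset.range (n + 1)).filter fun z => w * z ≤ n).card : ℝ) ≤ ((n / w : ℕ) : ℝ) + 1 := by
        exact_mod_cast h4
      linarith
    have h8 : (n : ℝ) / (w + y) ≤ n * ((y : ℝ) + 1)⁻¹ := by
      rw [← div_eq_mul_inv]
      exact div_le_div_of_nonneg_left (by positivity) (by positivity) (by linarith)
    calc _ ≤ 2 * ((n : ℝ) / w) * (n * ((y : ℝ) + 1)⁻¹) := mul_le_mul h5 h8 (by positivity)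
          (by positivity)
      _ = _ := by ring
  refine (Finset.sum_le_sum fun w hw => Finset.sum_le_sum fun y hy => h2 w hw y hy).trans ?_
  simp only [← Finset.mul_sum, ← Finset.sum_mul]
  rw [pow_two (harmonicSum n)]
  refine mul_le_mul_of_nonneg_left ?_ (by positivity)
  exact mul_le_mul_of_nonneg_right (sum_Icc_inv_le n) (zero_le_one.trans (one_le_harmonicSum n))

/-- The sum which governs the error term of `param_sum_error`. -/
lemma sum_quads_inv_le (n : ℕ) :
    ∑ q ∈ quads n, (((q.2.1 : ℝ) + q.2.2.1) * (q.2.2.2 + 1))⁻¹ ≤ n * harmonicSum n ^ 3 := by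
  have h := sum_quads_le n (fun w y z => (((w : ℝ) + y) * (z + 1))⁻¹) (fun _ _ _ => by positivity)
  refine h.trans ?_
  have h2 : ∀ w ∈ Finset.Icc 1 n, ∀ y ∈ Finset.range (n + 1), ∀ z ∈ Finset.range (n + 1),
      (if w * z ≤ n then (n : ℝ) / (w + y) * (((w : ℝ) + y) * (z + 1))⁻¹ else 0) ≤
        n * ((w : ℝ)⁻¹ * (((y : ℝ) + 1)⁻¹ * ((z : ℝ) + 1)⁻¹)) := by
    intro w hw y _ z _
    have hw1' : (1 : ℝ) ≤ w := by exact_mod_cast (Finset.mem_Icc.1 hw).1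
    split_ifs
    · rw [mul_inv, div_eq_mul_inv, mul_assoc]
      refine mul_le_mul_of_nonneg_left ?_ (by positivity)
      rw [← mul_assoc, ← mul_assoc]
      refine mul_le_mul_of_nonneg_right (mul_le_mul ?_ ?_ (by positivity) (by positivity))
        (by positivity)
      · exact inv_anti₀ (by positivity) (by linarith [Nat.cast_nonneg (α := ℝ) y])
      · exact inv_anti₀ (by positivity) (by linarith)
    · positivity
  refine (Finset.sum_le_sum fun w hw => Finset.sum_le_sum fun y hy => Finset.sum_le_sum
    fun z hz => h2 w hw y hy z hz).trans ?_
  simp only [← Finset.mul_sum, ← Finset.sum_mul]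
  refine mul_le_mul_of_nonneg_left ?_ (by positivity)
  have h0 := zero_le_one.trans (one_le_harmonicSum n)
  calc _ ≤ harmonicSum n * (harmonicSum n * harmonicSum n) :=
        mul_le_mul_of_nonneg_right (sum_Icc_inv_le n) (mul_nonneg h0 h0)
    _ = _ := by ring

/-- Interchanging the two basis vectors. -/
lemma sum_quads_swap (n : ℕ) (F : ℕ → ℕ → ℕ → ℕ → ℝ) :
    ∑ q ∈ quads n, F q.2.1 q.1 q.2.2.2 q.2.2.1 = ∑ q ∈ quads n, F q.1 q.2.1 q.2.2.1 q.2.2.2 := by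
  refine Finset.sum_nbij' (fun q => (q.2.1, q.1, q.2.2.2, q.2.2.1))
    (fun q => (q.2.1, q.1, q.2.2.2, q.2.2.1)) ?_ ?_ ?_ ?_ ?_
  · rintro ⟨u, w, y, z⟩ h
    rw [mem_quads] at h ⊢
    exact ⟨h.2.1, h.1, by linarith [mul_comm u w]⟩
  · rintro ⟨u, w, y, z⟩ h
    rw [mem_quads] at h ⊢
    exact ⟨h.2.1, h.1, by linarith [mul_comm u w]⟩
  · rintro ⟨u, w, y, z⟩ _; rfl
  · rintro ⟨u, w, y, z⟩ _; rfl
  · rintro ⟨u, w, y, z⟩ _; rfl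

/-- A parameter `D` subject to `D s ≤ S` and `D t ≤ T`, where `s ≥ 1` and `t = 0` or `t ≥ 1`. -/
lemma sq_le_of_mul_le {D S T s : ℝ} {t : ℕ} (hD : 0 ≤ D) (hs : 1 ≤ s) (h1 : D * s ≤ S)
    (h2 : D * t ≤ T) : D ^ 2 ≤ (S ^ 2 + T ^ 2) * (s * (t + 1))⁻¹ := by
  rw [← div_eq_mul_inv, le_div_iff₀ (by positivity)]
  have hS : (D * s) ^ 2 ≤ S ^ 2 := pow_le_pow_left₀ (by positivity) h1 2
  have hT : (D * t) ^ 2 ≤ T ^ 2 := pow_le_pow_left₀ (by positivity) h2 2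
  rcases Nat.eq_zero_or_pos t with rfl | ht
  · have h3 : D ^ 2 * s ≤ (D * s) ^ 2 := by nlinarith [mul_nonneg (sq_nonneg D) (by linarith : 0 ≤ s)]
    have h4 : (0 : ℝ) ≤ T ^ 2 := sq_nonneg T
    simp only [Nat.cast_zero, zero_add, mul_one]
    linarith
  · have ht1 : (1 : ℝ) ≤ t := by exact_mod_cast ht
    have h3 : D ^ 2 * (s * (t + 1)) ≤ 2 * ((D * s) * (D * t)) := by
      have := mul_nonneg (mul_nonneg (sq_nonneg D) (by linarith : 0 ≤ s)) (by linarith : (0 : ℝ) ≤ t - 1)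
      nlinarith
    nlinarith [sq_nonneg (D * s - D * t)]

/-- The largest possible value of the parameter `j`, or of `k`. -/
lemma exists_param_bound {S T s : ℝ} (t : ℕ) (hS : 0 ≤ S) (hT : 0 ≤ T) (hs : 0 < s) :
    ∃ D, 0 ≤ D ∧ D * s ≤ S ∧ D * t ≤ T ∧ ∀ x, x * s ≤ S → x * t ≤ T → x ≤ D := by
  rcases Nat.eq_zero_or_pos t with rfl | ht
  · exact ⟨S / s, by positivity, by field_simp; rfl, by simpa using hT,
      fun x h _ => (le_div_iff₀ hs).2 h⟩
  · have ht' : (0 : ℝ) < t := by exact_mod_cast ht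
    refine ⟨min (S / s) (T / t), by positivity, ?_, ?_, fun x h1 h2 => le_min
      ((le_div_iff₀ hs).2 h1) ((le_div_iff₀ ht').2 h2)⟩
    · exact (le_div_iff₀ hs).1 (min_le_left _ _)
    · exact (le_div_iff₀ ht').1 (min_le_right _ _)

/-- The error term for one basis. The parameters satisfy `j ≤ J` and `k ≤ K`, where the squares of
`J` and `K` are controlled by `sq_le_of_mul_le`. -/
lemma param_sum_error {Φ : ℝ → ℝ → ℝ → ℝ → ℝ} (hΦ : IsWeight Φ) {Yb Zb : ℝ} (hYb : 0 ≤ Yb)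
    (hZb : 0 ≤ Zb) {u w y z n : ℕ} (hq : (u, w, y, z) ∈ quads n)
    (hprim : Nat.gcd (Nat.gcd u w) (Nat.gcd y z) = 1) :
    |(∑ j ∈ Finset.Icc 1 ⌊Yb⌋₊, ∑ k ∈ Finset.range (⌊Zb⌋₊ + 1),
        if Nat.gcd (Nat.gcd (u * w + u * y + w * z) (j * (w + y) + k * y)) (j * z + k * (u + z)) = 1
        then paramTerm Φ Yb Zb u w y z j k else 0)
      - dens (u * w + u * y + w * z) * (paramIntegral Φ Yb Zb u w y z).toReal|
      ≤ (u * w + u * y + w * z).divisors.card * (2 * (Yb ^ 2 + Zb ^ 2) *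
        (n * ((((w : ℝ) + y) * (z + 1))⁻¹ + (((u : ℝ) + z) * (y + 1))⁻¹) + 1)) := by
  rw [mem_quads] at hq
  obtain ⟨hu, hw, ha⟩ := hq
  have hu1 : (1 : ℝ) ≤ u := by exact_mod_cast hu
  have hw1 : (1 : ℝ) ≤ w := by exact_mod_cast hw
  have hy0 : (0 : ℝ) ≤ y := by positivity
  have hz0 : (0 : ℝ) ≤ z := by positivity
  have ha' : (u : ℝ) * w + u * y + w * z ≤ n := by exact_mod_cast ha
  obtain ⟨J, hJ0, hJw, hJz, hJmax⟩ := exists_param_bound z hYb hZb (by positivity : (0 : ℝ) < w + y)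
  obtain ⟨K, hK0, hKu, hKy, hKmax⟩ := exists_param_bound y hZb hYb (by positivity : (0 : ℝ) < u + z)
  have hcond : ∀ j k : ℝ, paramTerm Φ Yb Zb u w y z j k ≠ 0 → j ≤ J ∧ k ≤ K := by
    intro j k hne
    have hjk : 0 < j ∧ 0 ≤ k ∧ 0 < j * z + k * (u + z) ∧
        j * (w + y) + k * y ≤ Yb ∧ j * z + k * (u + z) ≤ Zb := by
      by_contra hcon
      exact hne (by rw [paramTerm, if_neg hcon])
    obtain ⟨h1, h2, -, h3, h4⟩ := hjk
    have i1 := mul_nonneg h2 hy0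
    have i2 := mul_nonneg h2 (by positivity : (0 : ℝ) ≤ u + z)
    have i3 := mul_nonneg h1.le hz0
    have i4 := mul_nonneg h1.le (by positivity : (0 : ℝ) ≤ w + y)
    exact ⟨hJmax j (by linarith) (by linarith), hKmax k (by linarith) (by linarith)⟩
  have hB : ∀ j k : ℝ, paramTerm Φ Yb Zb u w y z j k ≤
      (J + K) * (u * w + u * y + w * z) + (Zb * y + Yb * z) := by
    intro j k
    by_cases hne : paramTerm Φ Yb Zb u w y z j k = 0
    · rw [hne]; positivity
    obtain ⟨h5, h6⟩ := hcond j k hne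
    unfold paramTerm at hne ⊢
    split_ifs at hne ⊢ with hjk
    · obtain ⟨h1, h2, -, h3, h4⟩ := hjk
      refine (hΦ.le_frob (by positivity) (by positivity) (by positivity) (by positivity)).trans ?_
      have e1 : (j * (w + y) + k * y) * u + (j * z + k * (u + z)) * w =
        (j + k) * (u * w + u * y + w * z) := by ring
      rw [e1]
      have i1 := mul_le_mul_of_nonneg_right h4 hy0
      have i2 := mul_le_mul_of_nonneg_right h3 hz0
      refine add_le_add (mul_le_mul_of_nonneg_right (add_le_add h5 h6) (by positivity)) ?_
      exact (max_le_add_of_nonneg (by positivity) (by positivity)).trans (add_le_add i1 i2)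
    · exact absurd rfl hne
  refine (param_sum_coprime hΦ hu hw hprim hJ0 hK0 (by positivity)
    (fun j k h => (hcond j k h).1) (fun j k h => (hcond j k h).2) hB).trans ?_
  refine mul_le_mul_of_nonneg_left ?_ (by positivity)
  have hJ2 := sq_le_of_mul_le hJ0 (by linarith) hJw hJz
  have hK2 := sq_le_of_mul_le hK0 (by linarith) hKu hKy
  have h1 : (J + K) * (Zb * y + Yb * z) ≤ 2 * (Yb ^ 2 + Zb ^ 2) := by
    have i1 : J * y ≤ Yb := by linarith [mul_nonneg hJ0 (by linarith : (0 : ℝ) ≤ w)]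
    have i2 : K * z ≤ Zb := by linarith [mul_nonneg hK0 (by linarith : (0 : ℝ) ≤ u)]
    have j1 := mul_le_mul_of_nonneg_left i1 hZb
    have j2 := mul_le_mul_of_nonneg_left i2 hYb
    have j3 := mul_le_mul_of_nonneg_left hJz hYb
    have j4 := mul_le_mul_of_nonneg_left hKy hZb
    have j5 := sq_nonneg (Yb - Zb)
    linarith
  have hn : (0 : ℝ) ≤ n := by positivity
  have h2 : (J + K) ^ 2 * (u * w + u * y + w * z) ≤ (2 * J ^ 2 + 2 * K ^ 2) * n :=
    mul_le_mul (by linarith [sq_nonneg (J - K)]) ha' (by positivity) (by positivity)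
  have h3 := mul_le_mul_of_nonneg_right hJ2 hn
  have h4 := mul_le_mul_of_nonneg_right hK2 hn
  linarith

/-- The value of the weight, as a function of the linear form `(β, γ)`, is integrable. -/
lemma integrableOn_coneTerm {Φ : ℝ → ℝ → ℝ → ℝ → ℝ} (hΦ : IsWeight Φ) {u w y z : ℝ} (hu : 0 < u)
    (hw : 0 < w) (hy : 0 ≤ y) (hz : 0 ≤ z) (Yb Zb : ℝ) :
    IntegrableOn (fun p : ℝ × ℝ => coneTerm Φ u w y z p.1 p.2) (Ioc 0 Yb ×ˢ Ioc 0 Zb) := by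
  refine Measure.integrableOn_of_bounded (M := |Yb| * u + |Zb| * w + (|Zb| * y + |Yb| * z)) ?_
    (measurable_coneTerm hΦ).aestronglyMeasurable ?_
  · rw [Measure.volume_eq_prod, Measure.prod_prod]
    exact ENNReal.mul_ne_top (by simp) (by simp)
  · refine ae_restrict_of_forall_mem (measurableSet_Ioc.prod measurableSet_Ioc) ?_
    rintro ⟨β, γ⟩ ⟨⟨h1, h2⟩, h3, h4⟩
    simp only at h1 h2 h3 h4 ⊢
    have hb : β ≤ |Yb| := h2.trans (le_abs_self _)
    have hc : γ ≤ |Zb| := h4.trans (le_abs_self _)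
    rw [Real.norm_of_nonneg (coneTerm_nonneg hΦ hu.le hw.le hy hz h1.le h3.le), coneTerm]
    split_ifs
    · refine (hΦ.le_frob (by positivity) (by positivity) (by positivity) (by positivity)).trans ?_
      refine add_le_add (by gcongr) ((max_le_add_of_nonneg (by positivity) (by positivity)).trans ?_)
      gcongr
    · positivity

lemma toReal_lintegral_coneTerm {Φ : ℝ → ℝ → ℝ → ℝ → ℝ} (hΦ : IsWeight Φ) {u w y z : ℝ}
    (hu : 0 < u) (hw : 0 < w) (hy : 0 ≤ y) (hz : 0 ≤ z) (Yb Zb : ℝ) :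
    (∫⁻ β in Ioc 0 Yb, ∫⁻ γ in Ioc 0 Zb, ENNReal.ofReal (coneTerm Φ u w y z β γ)).toReal =
      ∫ p in Ioc 0 Yb ×ˢ Ioc 0 Zb, coneTerm Φ u w y z p.1 p.2 := by
  have hm : Measurable fun p : ℝ × ℝ => coneTerm Φ u w y z p.1 p.2 := measurable_coneTerm hΦ
  rw [integral_eq_lintegral_of_nonneg_ae _ hm.aestronglyMeasurable]
  · rw [Measure.volume_eq_prod, ← Measure.prod_restrict, lintegral_prod _
      hm.ennreal_ofReal.aemeasurable]
  · refine ae_restrict_of_forall_mem (measurableSet_Ioc.prod measurableSet_Ioc) ?_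
    rintro ⟨β, γ⟩ ⟨⟨h1, h2⟩, h3, h4⟩
    exact coneTerm_nonneg hΦ hu.le hw.le hy hz h1.le h3.le

/-- The bases whose entries have no common factor. -/
def primQuads (n : ℕ) : Finset (ℕ × ℕ × ℕ × ℕ) :=
  (quads n).filter fun q => Nat.gcd (Nat.gcd q.1 q.2.1) (Nat.gcd q.2.2.1 q.2.2.2) = 1

/-- The determinant of a basis. -/
def qdet (q : ℕ × ℕ × ℕ × ℕ) : ℕ := q.1 * q.2.1 + q.1 * q.2.2.1 + q.2.1 * q.2.2.2

/-- The sum over bases of determinant at most `n`, as a function of the linear form. -/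
noncomputable def basisSum (Φ : ℝ → ℝ → ℝ → ℝ → ℝ) (n : ℕ) (β γ : ℝ) : ℝ :=
  ∑ q ∈ primQuads n, dens (qdet q) * (qdet q : ℝ)⁻¹ * coneTerm Φ q.1 q.2.1 q.2.2.1 q.2.2.2 β γ

lemma integrableOn_basisSum {Φ : ℝ → ℝ → ℝ → ℝ → ℝ} (hΦ : IsWeight Φ) (n : ℕ) (Yb Zb : ℝ) :
    IntegrableOn (fun p : ℝ × ℝ => basisSum Φ n p.1 p.2) (Ioc 0 Yb ×ˢ Ioc 0 Zb) := by
  refine integrable_finsetSum _ ?_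
  rintro ⟨u, w, y, z⟩ hq
  obtain ⟨hu, hw, -⟩ := mem_quads.1 (Finset.mem_filter.1 hq).1
  exact (integrableOn_coneTerm hΦ (by exact_mod_cast hu) (by exact_mod_cast hw) (by positivity)
    (by positivity) Yb Zb).const_mul _

/-- The sum over coprime triples in a box is the integral over `(b, c)` of a sum over bases. -/
lemma triple_sum_eq_integral {Φ : ℝ → ℝ → ℝ → ℝ → ℝ} (hΦ : IsWeight Φ) (v : ℕ → ℕ → ℕ → ℝ)
    (hv : ∀ a b c u w y z j k : ℕ, IsParam a b c u w y z j k → Nat.gcd (Nat.gcd a b) c = 1 →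
      v a b c = Φ (b * u) (c * w) (c * y) (b * z)) (n : ℕ) {Yb Zb T : ℝ} (hYb : 0 ≤ Yb)
    (hZb : 0 ≤ Zb) (hT : ∀ a : ℕ, 0 < a → a ≤ n → (a.divisors.card : ℝ) ≤ T) :
    |∑ a ∈ Finset.Icc 1 n, ∑ b ∈ Finset.Icc 1 ⌊Yb⌋₊,
        ∑ c ∈ Finset.Icc 1 ⌊Zb⌋₊ with Nat.gcd (Nat.gcd a b) c = 1, v a b c -
      ∫ p in Ioc 0 Yb ×ˢ Ioc 0 Zb, basisSum Φ n p.1 p.2| ≤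
      8 * T * (Yb ^ 2 + Zb ^ 2) * (n ^ 2 * harmonicSum n ^ 3) := by
  rw [sum_triples_eq Φ v hv n Yb Zb hYb hZb]
  unfold basisSum
  rw [integral_finsetSum]
  swap
  · rintro ⟨u, w, y, z⟩ hq
    obtain ⟨hu, hw, -⟩ := mem_quads.1 (Finset.mem_filter.1 hq).1
    exact (integrableOn_coneTerm hΦ (by exact_mod_cast hu) (by exact_mod_cast hw) (by positivity)
      (by positivity) Yb Zb).const_mul _
  -- a common factor of the basis divides `a`, `b` and `c`
  have hnon : ∀ q ∈ quads n, q ∉ primQuads n → (∑ j ∈ Finset.Icc 1 ⌊Yb⌋₊,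
      ∑ k ∈ Finset.range (⌊Zb⌋₊ + 1),
        if Nat.gcd (Nat.gcd (q.1 * q.2.1 + q.1 * q.2.2.1 + q.2.1 * q.2.2.2)
            (j * (q.2.1 + q.2.2.1) + k * q.2.2.1)) (j * q.2.2.2 + k * (q.1 + q.2.2.2)) = 1
        then paramTerm Φ Yb Zb q.1 q.2.1 q.2.2.1 q.2.2.2 j k else 0) = 0 := by
    rintro ⟨u, w, y, z⟩ hq hq2
    refine Finset.sum_eq_zero fun j _ => Finset.sum_eq_zero fun k _ => if_neg fun hg => hq2 ?_
    simp only at hg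
    refine Finset.mem_filter.2 ⟨hq, ?_⟩
    simp only
    set g := Nat.gcd (Nat.gcd u w) (Nat.gcd y z) with hgdef
    have g1 : g ∣ u := (Nat.gcd_dvd_left _ _).trans (Nat.gcd_dvd_left _ _)
    have g2 : g ∣ w := (Nat.gcd_dvd_left _ _).trans (Nat.gcd_dvd_right _ _)
    have g3 : g ∣ y := (Nat.gcd_dvd_right _ _).trans (Nat.gcd_dvd_left _ _)
    have g4 : g ∣ z := (Nat.gcd_dvd_right _ _).trans (Nat.gcd_dvd_right _ _)
    refine Nat.dvd_one.1 (hg ▸ Nat.dvd_gcd (Nat.dvd_gcd ?_ ?_) ?_)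
    · exact dvd_add (dvd_add (g1.mul_right _) (g1.mul_right _)) (g2.mul_right _)
    · exact dvd_add ((dvd_add g2 g3).mul_left _) (g3.mul_left _)
    · exact dvd_add (g4.mul_left _) ((dvd_add g1 g4).mul_left _)
  have hss : primQuads n ⊆ quads n := Finset.filter_subset _ _
  rw [← Finset.sum_subset hss hnon, ← Finset.sum_sub_distrib]
  have hn0 : (0 : ℝ) ≤ n := by positivity
  have hYZ : 0 ≤ Yb ^ 2 + Zb ^ 2 := by positivity
  rcases Nat.eq_zero_or_pos n with rfl | hn
  · have : primQuads 0 = ∅ := rfl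
    simp [this]
  have hT0 : 0 ≤ T := le_trans (by positivity) (hT 1 one_pos hn)
  refine (Finset.abs_sum_le_sum_abs _ _).trans ?_
  have hterm : ∀ q ∈ primQuads n, |(∑ j ∈ Finset.Icc 1 ⌊Yb⌋₊, ∑ k ∈ Finset.range (⌊Zb⌋₊ + 1),
        if Nat.gcd (Nat.gcd (q.1 * q.2.1 + q.1 * q.2.2.1 + q.2.1 * q.2.2.2)
            (j * (q.2.1 + q.2.2.1) + k * q.2.2.1)) (j * q.2.2.2 + k * (q.1 + q.2.2.2)) = 1
        then paramTerm Φ Yb Zb q.1 q.2.1 q.2.2.1 q.2.2.2 j k else 0) -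
      ∫ p in Ioc 0 Yb ×ˢ Ioc 0 Zb, dens (qdet q) * (qdet q : ℝ)⁻¹ *
        coneTerm Φ q.1 q.2.1 q.2.2.1 q.2.2.2 p.1 p.2| ≤ T * (2 * (Yb ^ 2 + Zb ^ 2)) *
        (n * ((((q.2.1 : ℝ) + q.2.2.1) * (q.2.2.2 + 1))⁻¹ +
          (((q.1 : ℝ) + q.2.2.2) * (q.2.2.1 + 1))⁻¹) + 1) := by
    rintro ⟨u, w, y, z⟩ hq
    obtain ⟨hq1, hq2⟩ := Finset.mem_filter.1 hq
    obtain ⟨hu, hw, ha⟩ := mem_quads.1 hq1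
    have h1 := param_sum_error hΦ hYb hZb hq1 hq2
    rw [paramIntegral_eq hΦ (by exact_mod_cast hu) (by exact_mod_cast hw) (by positivity)
      (by positivity), ENNReal.toReal_mul, toReal_lintegral_coneTerm hΦ (by exact_mod_cast hu)
      (by exact_mod_cast hw) (by positivity) (by positivity),
      ENNReal.toReal_ofReal (by positivity), ← mul_assoc] at h1
    rw [integral_const_mul]
    simp only [qdet]
    push_cast at h1 ⊢
    refine h1.trans ?_
    rw [mul_assoc T]
    refine mul_le_mul_of_nonneg_right (hT _ ?_ ha) (by positivity)
    have := Nat.mul_pos hu hw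
    omega
  refine (Finset.sum_le_sum hterm).trans ?_
  have hsub : ∀ q ∈ quads n, q ∉ primQuads n → 0 ≤ T * (2 * (Yb ^ 2 + Zb ^ 2)) *
        (n * ((((q.2.1 : ℝ) + q.2.2.1) * (q.2.2.2 + 1))⁻¹ +
          (((q.1 : ℝ) + q.2.2.2) * (q.2.2.1 + 1))⁻¹) + 1) := fun q _ _ => by positivity
  refine (Finset.sum_le_sum_of_subset_of_nonneg (Finset.filter_subset _ _) hsub).trans ?_
  have hs := sum_quads_swap n fun u w y z => (((w : ℝ) + y) * (z + 1))⁻¹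
  rw [← Finset.mul_sum, Finset.sum_add_distrib, ← Finset.mul_sum, Finset.sum_add_distrib]
  rw [hs, Finset.sum_const, nsmul_one]
  have h1 := sum_quads_inv_le n
  have h2 := card_quads_le n
  have h3 := one_le_harmonicSum n
  have h4 : harmonicSum n ^ 2 ≤ harmonicSum n ^ 3 := pow_le_pow_right₀ h3 (by norm_num)
  have h5 := mul_le_mul_of_nonneg_left h1 hn0
  have h6 := mul_le_mul_of_nonneg_left h4 (by positivity : (0 : ℝ) ≤ 2 * n ^ 2)
  calc _ ≤ T * (2 * (Yb ^ 2 + Zb ^ 2)) * (4 * (n ^ 2 * harmonicSum n ^ 3)) := by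
        refine mul_le_mul_of_nonneg_left ?_ (by positivity)
        nlinarith
    _ = _ := by ring

/-! ### The sum over bases with fixed `u` and `w` -/

/-- For fixed `u, w`, the `(z, y)` for which `d` divides the determinant form a coset of a lattice
of index `d / gcd(d, u, w)`. -/
lemma exists_row_structure_det {d : ℕ} (hd : 0 < d) (u w : ℕ) :
    ∃ q₁ q₂ : ℕ, 0 < q₁ ∧ 0 < q₂ ∧ q₁ * q₂ * Nat.gcd d (Nat.gcd u w) = d ∧
      ∃ r : ℕ → ℕ, (∀ z, r z < q₂) ∧ ∀ z y : ℕ,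
        d ∣ u * w + u * y + w * z ↔ (q₁ ∣ z ∧ y % q₂ = r z) := by
  obtain ⟨q₂, hq₂⟩ : Nat.gcd d u ∣ d := Nat.gcd_dvd_left _ _
  obtain ⟨u', hu'⟩ : Nat.gcd d u ∣ u := Nat.gcd_dvd_right _ _
  obtain ⟨q₁, hq₁⟩ : Nat.gcd (Nat.gcd d u) w ∣ Nat.gcd d u := Nat.gcd_dvd_left _ _
  obtain ⟨w', hw'⟩ : Nat.gcd (Nat.gcd d u) w ∣ w := Nat.gcd_dvd_right _ _
  have hd₁0 : 0 < Nat.gcd d u := Nat.gcd_pos_of_pos_left _ hd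
  have hg0 : 0 < Nat.gcd (Nat.gcd d u) w := Nat.gcd_pos_of_pos_left _ hd₁0
  have hco₁ : Nat.Coprime q₂ u' := by
    have h := Nat.coprime_div_gcd_div_gcd hd₁0
    rwa [Nat.div_eq_of_eq_mul_right hd₁0 hq₂, Nat.div_eq_of_eq_mul_right hd₁0 hu'] at h
  have hco₂ : Nat.Coprime q₁ w' := by
    have h := Nat.coprime_div_gcd_div_gcd hg0
    rwa [Nat.div_eq_of_eq_mul_right hg0 hq₁, Nat.div_eq_of_eq_mul_right hg0 hw'] at h
  set d₁ := Nat.gcd d u with hd₁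
  set g := Nat.gcd d₁ w with hg
  have hq₁0 : 0 < q₁ := Nat.pos_of_ne_zero fun h => by rw [h] at hq₁; omega
  have hq₂0 : 0 < q₂ := Nat.pos_of_ne_zero fun h => by rw [h] at hq₂; omega
  have hq₂z : (0 : ℤ) < q₂ := by exact_mod_cast hq₂0
  obtain ⟨α, γ, hbez⟩ : ∃ α γ : ℤ, α * u' + γ * q₂ = 1 := by
    have h1 := Nat.gcd_eq_gcd_ab q₂ u'
    rw [Nat.Coprime.gcd_eq_one hco₁] at h1
    push_cast at h1
    exact ⟨q₂.gcdB u', q₂.gcdA u', by linear_combination -h1⟩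
  -- the class of `y` modulo `q₂` when `z = q₁ m`
  refine ⟨q₁, q₂, hq₁0, hq₂0, ?_,
    fun z => ((-(u' * w + (z / q₁ : ℕ) * w') * α) % (q₂ : ℤ)).toNat, ?_, ?_⟩
  · rw [← Nat.gcd_assoc, ← hd₁, ← hg]
    calc q₁ * q₂ * g = (g * q₁) * q₂ := by ring
      _ = d := by rw [← hq₁, ← hq₂]
  · intro z
    have h1 := Int.emod_nonneg (-(u' * w + (z / q₁ : ℕ) * w') * α) hq₂z.ne'
    have h2 := Int.emod_lt_of_pos (-(u' * w + (z / q₁ : ℕ) * w') * α) hq₂z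
    simp only
    omega
  intro z y
  beta_reduce
  have hz : d ∣ u * w + u * y + w * z → q₁ ∣ z := by
    intro h
    have h1 : d₁ ∣ u * w + u * y + w * z := (Dvd.intro _ hq₂.symm).trans h
    have h2 : d₁ ∣ w * z := (Nat.dvd_add_right (dvd_add ((Dvd.intro _ hu'.symm).mul_right _)
      ((Dvd.intro _ hu'.symm).mul_right _))).1 h1
    rw [hq₁] at h2
    have h3 : g * q₁ ∣ g * (w' * z) := by
      refine h2.trans (dvd_of_eq ?_)
      rw [← mul_assoc, ← hw']
    exact hco₂.dvd_of_dvd_mul_left (Nat.dvd_of_mul_dvd_mul_left hg0 h3)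
  have key : ∀ m : ℕ, d ∣ u * w + u * y + w * (q₁ * m) ↔
      y % q₂ = ((-(u' * w + m * w') * α) % (q₂ : ℤ)).toNat := by
    intro m
    have e1 : u * w + u * y + w * (q₁ * m) = d₁ * (u' * w + u' * y + w' * m) := by
      have e2 : w * (q₁ * m) = d₁ * (w' * m) := by
        calc w * (q₁ * m) = (g * w') * (q₁ * m) := by rw [← hw']
          _ = (g * q₁) * (w' * m) := by ring
          _ = _ := by rw [← hq₁]
      rw [e2]
      nth_rewrite 1 2 [hu']
      ring
    have e3 : d ∣ u * w + u * y + w * (q₁ * m) ↔ q₂ ∣ u' * w + u' * y + w' * m := by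
      rw [e1]
      nth_rewrite 1 [hq₂]
      exact Nat.mul_dvd_mul_iff_left hd₁0
    have h1 := Int.emod_nonneg (-(u' * w + m * w') * α) hq₂z.ne'
    have e4 : y % q₂ = ((-(u' * w + m * w') * α) % (q₂ : ℤ)).toNat ↔
        (q₂ : ℤ) ∣ y + (u' * w + m * w') * α := by
      have h2 : (q₂ : ℤ) ∣ y + (u' * w + m * w') * α ↔
          (y : ℤ) % q₂ = (-(u' * w + m * w') * α) % q₂ := by
        rw [Int.emod_eq_emod_iff_emod_sub_eq_zero, ← Int.dvd_iff_emod_eq_zero, neg_mul,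
          sub_neg_eq_add]
      rw [h2, ← Int.natCast_mod]
      omega
    rw [e3, e4, ← Int.natCast_dvd_natCast]
    push_cast
    constructor
    · rintro ⟨x, hx⟩
      exact ⟨α * x + γ * y, by linear_combination α * hx - (y : ℤ) * hbez⟩
    · rintro ⟨x, hx⟩
      exact ⟨u' * x + γ * (u' * w + w' * m), by
        linear_combination (u' : ℤ) * hx - (u' * w + w' * m : ℤ) * hbez⟩
  constructor
  · intro h
    obtain ⟨m, rfl⟩ := hz h
    refine ⟨Dvd.intro _ rfl, ?_⟩
    rw [Nat.mul_div_cancel_left m hq₁0]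
    exact (key m).1 h
  · rintro ⟨⟨m, rfl⟩, h⟩
    rw [Nat.mul_div_cancel_left m hq₁0] at h
    exact (key m).2 h

/-- `coneTerm`, restricted to nonnegative `y`, `z` and to determinants at most `X`. -/
noncomputable def cellTerm (Φ : ℝ → ℝ → ℝ → ℝ → ℝ) (β γ X u w z y : ℝ) : ℝ :=
  if 0 ≤ y ∧ 0 ≤ z ∧ γ * y < β * (u + z) ∧ β * z ≤ γ * (w + y) ∧ u * w + u * y + w * z ≤ X then
    Φ (β * u) (γ * w) (γ * y) (β * z) else 0

section CellTerm

variable {Φ : ℝ → ℝ → ℝ → ℝ → ℝ} {β γ X u w : ℝ}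

lemma cellTerm_nonneg (hΦ : IsWeight Φ) (hβ : 0 ≤ β) (hγ : 0 ≤ γ) (hu : 0 ≤ u) (hw : 0 ≤ w)
    (z y : ℝ) : 0 ≤ cellTerm Φ β γ X u w z y := by
  unfold cellTerm
  split_ifs with h
  · have := h.1
    have := h.2.1
    exact hΦ.nonneg (by positivity) (by positivity) (by positivity) (by positivity)
  · exact le_rfl

lemma measurable_cellTerm (hΦ : IsWeight Φ) :
    Measurable (Function.uncurry (cellTerm Φ β γ X u w)) := by
  unfold cellTerm Function.uncurry
  refine Measurable.ite ?_ ?_ measurable_const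
  · exact (measurableSet_le measurable_const measurable_snd).inter
      ((measurableSet_le measurable_const measurable_fst).inter
      ((measurableSet_lt (f := fun p : ℝ × ℝ => γ * p.2) (g := fun p => β * (u + p.1))
        (by fun_prop) (by fun_prop)).inter
      ((measurableSet_le (f := fun p : ℝ × ℝ => β * p.1) (g := fun p => γ * (w + p.2))
        (by fun_prop) (by fun_prop)).inter
      (measurableSet_le (f := fun p : ℝ × ℝ => u * w + u * p.2 + w * p.1) (by fun_prop)
        measurable_const))))
  · exact (hΦ.cont.comp (by fun_prop : Continuous fun p : ℝ × ℝ =>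
      (β * u, γ * w, γ * p.2, β * p.1))).measurable

lemma unimodal_cellTerm_right (hΦ : IsWeight Φ) (hβ : 0 ≤ β) (hγ : 0 ≤ γ) (hu : 0 ≤ u)
    (hw : 0 ≤ w) (z : ℝ) : Unimodal fun y => cellTerm Φ β γ X u w z y := by
  classical
  unfold cellTerm
  refine unimodal_ite (C := {y | 0 ≤ y ∧ 0 ≤ z ∧ γ * y < β * (u + z) ∧ β * z ≤ γ * (w + y) ∧
    u * w + u * y + w * z ≤ X}) ⟨?_⟩ ?_
  · rintro y₁ ⟨h1, h2, -, h4, -⟩ y₂ ⟨-, -, h5, -, h6⟩ y ⟨hy1, hy2⟩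
    have i1 := mul_le_mul_of_nonneg_left hy2 hγ
    have i2 := mul_le_mul_of_nonneg_left hy1 hγ
    have i3 := mul_le_mul_of_nonneg_left hy2 hu
    exact ⟨h1.trans hy1, h2, by linarith, by linarith, by linarith⟩
  · rintro y₁ ⟨h1, h2, -⟩ y₂ - hy
    exact hΦ.mono (by positivity) (by positivity) (by positivity) (by positivity)
      le_rfl le_rfl (by gcongr) le_rfl

lemma unimodal_cellTerm_left (hΦ : IsWeight Φ) (hβ : 0 ≤ β) (hγ : 0 ≤ γ) (hu : 0 ≤ u)
    (hw : 0 ≤ w) (y : ℝ) : Unimodal fun z => cellTerm Φ β γ X u w z y := by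
  classical
  unfold cellTerm
  refine unimodal_ite (C := {z | 0 ≤ y ∧ 0 ≤ z ∧ γ * y < β * (u + z) ∧ β * z ≤ γ * (w + y) ∧
    u * w + u * y + w * z ≤ X}) ⟨?_⟩ ?_
  · rintro y₁ ⟨h1, h2, h4, -, -⟩ y₂ ⟨-, -, -, h5, h6⟩ z ⟨hy1, hy2⟩
    have i1 := mul_le_mul_of_nonneg_left hy2 hβ
    have i2 := mul_le_mul_of_nonneg_left hy1 hβ
    have i3 := mul_le_mul_of_nonneg_left hy2 hw
    exact ⟨h1, h2.trans hy1, by linarith, by linarith, by linarith⟩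
  · rintro y₁ ⟨h1, h2, -⟩ y₂ - hy
    exact hΦ.mono (by positivity) (by positivity) (by positivity) (by positivity)
      le_rfl le_rfl le_rfl (by gcongr)

/-- On the cone, both `γ y` and `β z` are at most `X β γ / (β u + γ w)`. -/
lemma cellTerm_support (hβ : 0 < β) (hγ : 0 < γ) (hu : 0 < u) (hw : 0 < w) {z y : ℝ}
    (h : cellTerm Φ β γ X u w z y ≠ 0) : 0 ≤ y ∧ 0 ≤ z ∧ u * w + u * y + w * z ≤ X ∧
      γ * y ≤ X * β * γ / (β * u + γ * w) ∧ β * z ≤ X * β * γ / (β * u + γ * w) := by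
  have h' : 0 ≤ y ∧ 0 ≤ z ∧ γ * y < β * (u + z) ∧ β * z ≤ γ * (w + y) ∧
      u * w + u * y + w * z ≤ X := by
    by_contra hcon
    exact h (by rw [cellTerm, if_neg hcon])
  obtain ⟨h1, h2, h3, h4, h5⟩ := h'
  have i1 := mul_le_mul_of_nonneg_left h5 (mul_pos hβ hγ).le
  have i2 := mul_le_mul_of_nonneg_left h3.le (mul_pos hγ hw).le
  have i3 := mul_le_mul_of_nonneg_left h4 (mul_pos hβ hu).le
  refine ⟨h1, h2, h5, ?_, ?_⟩ <;> rw [le_div_iff₀ (by positivity)] <;> nlinarith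

lemma apMeasure_Icc_le {q H : ℝ} (hq : 1 ≤ q) (hH : 0 ≤ H) :
    apMeasure q 0 (Icc 0 H) ≤ ENNReal.ofReal (H + 1) := by
  classical
  rw [apMeasure_apply q 0 measurableSet_Icc]
  have h : ∀ n : ℕ, (Icc 0 H).indicator (fun _ => (1 : ℝ≥0∞)) (0 + q * n) ≤
      if n ∈ Finset.range (⌊H⌋₊ + 1) then 1 else 0 := by
    intro n
    by_cases hn : 0 + q * n ∈ Icc 0 H
    · rw [indicator_of_mem hn, if_pos]
      rw [Finset.mem_range, Nat.lt_succ_iff]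
      rw [zero_add] at hn
      refine Nat.le_floor (le_trans ?_ hn.2)
      nlinarith [Nat.cast_nonneg (α := ℝ) n]
    · rw [indicator_of_notMem hn]; exact zero_le
  refine (ENNReal.tsum_le_tsum h).trans ?_
  rw [tsum_eq_sum (s := Finset.range (⌊H⌋₊ + 1)) (fun n hn => if_neg hn), Finset.sum_ite_mem,
    Finset.inter_self, Finset.sum_const, Finset.card_range, nsmul_one, ← ENNReal.ofReal_natCast]
  refine ENNReal.ofReal_le_ofReal ?_
  push_cast
  linarith [Nat.floor_le hH]

/-- The integral which approximates the sum over `(y, z)` for fixed `u` and `w`. -/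
noncomputable def cellIntegral (Φ : ℝ → ℝ → ℝ → ℝ → ℝ) (β γ X u w : ℝ) : ℝ≥0∞ :=
  ∫⁻ y in Ioi (0 : ℝ), ∫⁻ z in Ioi (0 : ℝ), ENNReal.ofReal (cellTerm Φ β γ X u w z y)

/-- The sum over `(y, z)` with `d ∣ u w + u y + w z`, for fixed `u` and `w`. -/
lemma cell_sum_close (hΦ : IsWeight Φ) (hβ : 0 < β) (hγ : 0 < γ) {d u w n : ℕ} (hd : 0 < d)
    (hu : 0 < u) (hw : 0 < w) :
    cellIntegral Φ β γ n u w ≠ ⊤ ∧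
    |∑ z ∈ Finset.range (n + 1), ∑ y ∈ Finset.range (n + 1),
        (if d ∣ u * w + u * y + w * z then cellTerm Φ β γ n u w z y else 0) -
      (Nat.gcd d (Nat.gcd u w) : ℝ) / d * (cellIntegral Φ β γ n u w).toReal| ≤
      (n * γ / (β * u + γ * w) + 1 + n * β / (β * u + γ * w)) *
        (β * u + γ * w + n * β * γ / (β * u + γ * w)) := by
  obtain ⟨q₁, q₂, hq₁, hq₂, hq, r, hr, hiff⟩ := exists_row_structure_det hd u w
  have hu' : (0 : ℝ) < u := by exact_mod_cast hu
  have hw' : (0 : ℝ) < w := by exact_mod_cast hw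
  have hA : 0 < β * u + γ * w := by positivity
  have hsup := fun z y : ℝ => cellTerm_support (Φ := Φ) (X := n) (z := z) (y := y) hβ hγ hu' hw'
  have hout : ∀ z y : ℕ, cellTerm Φ β γ n u w z y ≠ 0 →
      z ∈ Finset.range (n + 1) ∧ y ∈ Finset.range (n + 1) := by
    intro z y h
    obtain ⟨-, -, h3, -⟩ := hsup z y h
    have h4 : u * w + u * y + w * z ≤ n := by exact_mod_cast h3
    have e3 : y ≤ u * y := Nat.le_mul_of_pos_left y hu
    have e4 : z ≤ w * z := Nat.le_mul_of_pos_left z hw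
    rw [Finset.mem_range, Finset.mem_range]
    omega
  have hB : ∀ z y : ℝ, cellTerm Φ β γ n u w z y ≤
      β * u + γ * w + n * β * γ / (β * u + γ * w) := by
    intro z y
    by_cases hne : cellTerm Φ β γ n u w z y = 0
    · rw [hne]; positivity
    obtain ⟨h1, h2, h3, h4, h5⟩ := hsup z y hne
    unfold cellTerm at hne ⊢
    split_ifs at hne ⊢
    · refine (hΦ.le_frob (by positivity) (by positivity) (by positivity) (by positivity)).trans ?_
      gcongr
      exact max_le h4 h5
    · exact absurd rfl hne
  have hg : ((Nat.gcd d (Nat.gcd u w) : ℕ) : ℝ) / d = ((q₁ * q₂ : ℕ) : ℝ)⁻¹ := by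
    have hg0 : 0 < Nat.gcd d (Nat.gcd u w) := Nat.gcd_pos_of_pos_left _ hd
    have hg0' : (0 : ℝ) < (Nat.gcd d (Nat.gcd u w) : ℕ) := by exact_mod_cast hg0
    have h1 : ((q₁ * q₂ : ℕ) : ℝ) * (Nat.gcd d (Nat.gcd u w) : ℕ) = d := by exact_mod_cast hq
    have h2 : (0 : ℝ) < ((q₁ * q₂ : ℕ) : ℝ) := by exact_mod_cast Nat.mul_pos hq₁ hq₂
    rw [← h1]
    field_simp
  rw [hg]
  refine row_sum_close (S := Icc 0 (n * γ / (β * u + γ * w))) hq₁ hq₂ hr hiff _ _ hout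
    (by positivity) (by positivity) (by positivity) (cellTerm_nonneg hΦ hβ.le hγ.le hu'.le hw'.le)
    (measurable_cellTerm hΦ) hB measurableSet_Icc ?_
    (apMeasure_Icc_le (by exact_mod_cast hq₁) (by positivity)) ?_
    (unimodal_cellTerm_right hΦ hβ.le hγ.le hu'.le hw'.le)
    (unimodal_cellTerm_left hΦ hβ.le hγ.le hu'.le hw'.le)
  · intro z y h
    obtain ⟨-, h2, -, -, h5⟩ := hsup z y h
    refine ⟨h2, ?_⟩
    rw [le_div_iff₀ hA] at h5 ⊢
    exact le_of_mul_le_mul_left (by linarith) hβ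
  · intro z y h
    obtain ⟨-, h2, -, h5, -⟩ := hsup z y h
    rw [le_div_iff₀ hA] at h5 ⊢
    exact le_of_mul_le_mul_left (by linarith) hγ

end CellTerm

section CellSum

variable {Φ : ℝ → ℝ → ℝ → ℝ → ℝ} {β γ : ℝ}

lemma cell_error_le (hβ : 0 < β) (hγ : 0 < γ) {u w n : ℕ} (hu : 0 < u) (hw : 0 < w)
    (huw : u * w ≤ n) :
    (n * γ / (β * u + γ * w) + 1 + n * β / (β * u + γ * w)) *
        (β * u + γ * w + n * β * γ / (β * u + γ * w)) ≤
      4 * (β + γ) * n ^ 2 * ((u : ℝ)⁻¹ * (w : ℝ)⁻¹) := by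
  have hu1 : (1 : ℝ) ≤ u := by exact_mod_cast hu
  have hw1 : (1 : ℝ) ≤ w := by exact_mod_cast hw
  have hun : (u : ℝ) ≤ n := by exact_mod_cast (Nat.le_mul_of_pos_right u hw).trans huw
  have hwn : (w : ℝ) ≤ n := by exact_mod_cast (Nat.le_mul_of_pos_left w hu).trans huw
  have huw' : (u : ℝ) * w ≤ n := by exact_mod_cast huw
  have hn : (0 : ℝ) ≤ n := by positivity
  have hA : 0 < β * u + γ * w := by positivity
  have huw0 : (0 : ℝ) < u * w := by positivity
  set A := β * u + γ * w with hAdef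
  have h1 : β * γ / A ^ 2 ≤ (u * w : ℝ)⁻¹ := by
    rw [div_le_iff₀ (by positivity), inv_mul_eq_div, le_div_iff₀ huw0]
    nlinarith [sq_nonneg (β * u - γ * w),
      mul_pos (mul_pos hβ (by linarith : (0 : ℝ) < u)) (mul_pos hγ (by linarith : (0 : ℝ) < w))]
  have h2 : β * γ / A ≤ γ := by
    rw [div_le_iff₀ hA, hAdef]
    nlinarith [mul_pos hβ hγ, mul_pos hγ hγ]
  have h3 : A ≤ (β + γ) * n := by
    rw [hAdef]; nlinarith
  have h4 : (n : ℝ) ≤ n ^ 2 * (u * w : ℝ)⁻¹ := by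
    rw [← div_eq_mul_inv, le_div_iff₀ huw0]; nlinarith
  have e : (n * γ / A + 1 + n * β / A) * (A + n * β * γ / A) =
      n * (β + γ) + A + n * (β * γ / A) + n ^ 2 * (β + γ) * (β * γ / A ^ 2) := by
    field_simp
    ring
  rw [e, ← mul_inv]
  have h5 := mul_le_mul_of_nonneg_left h1 (by positivity : 0 ≤ (n : ℝ) ^ 2 * (β + γ))
  have h6 := mul_le_mul_of_nonneg_left h2 hn
  have h7 := mul_le_mul_of_nonneg_left h4 (by positivity : 0 ≤ β + γ)
  have h8 : (0 : ℝ) ≤ n * β := by positivity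
  nlinarith

lemma cellTerm_eq_zero (hu : 0 ≤ u) (hw : 0 ≤ w) {X : ℝ} (h : X < u * w) (z y : ℝ) :
    cellTerm Φ β γ X u w z y = 0 := by
  rw [cellTerm, if_neg]
  rintro ⟨h1, h2, -, -, h3⟩
  have := mul_nonneg hu h1
  have := mul_nonneg hw h2
  linarith

lemma cellIntegral_eq_zero {u w X : ℝ} (hu : 0 ≤ u) (hw : 0 ≤ w) (h : X < u * w) :
    cellIntegral Φ β γ X u w = 0 := by
  unfold cellIntegral
  simp [cellTerm_eq_zero hu hw h]

/-- The condition on the determinant is part of `cellTerm`. -/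
lemma sum_quads_dvd_eq (n d : ℕ) :
    ∑ q ∈ quads n with d ∣ qdet q, coneTerm Φ q.1 q.2.1 q.2.2.1 q.2.2.2 β γ =
      ∑ u ∈ Finset.Icc 1 n, ∑ w ∈ Finset.Icc 1 n,
        ∑ z ∈ Finset.range (n + 1), ∑ y ∈ Finset.range (n + 1),
          if d ∣ u * w + u * y + w * z then cellTerm Φ β γ n u w z y else 0 := by
  rw [Finset.sum_filter, quads, Finset.sum_filter]
  simp only [Finset.sum_product, qdet]
  refine Finset.sum_congr rfl fun u _ => Finset.sum_congr rfl fun w _ => ?_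
  rw [Finset.sum_comm]
  refine Finset.sum_congr rfl fun z _ => Finset.sum_congr rfl fun y _ => ?_
  unfold cellTerm coneTerm
  by_cases h1 : u * w + u * y + w * z ≤ n
  · have h2 : (u * w + u * y + w * z : ℝ) ≤ n := by exact_mod_cast h1
    have h3 : (0 : ℝ) ≤ y := by positivity
    have h4 : (0 : ℝ) ≤ z := by positivity
    simp only [h1, h2, h3, h4, true_and, and_true, if_true]
    congr
  · have h2 : ¬ (u * w + u * y + w * z : ℝ) ≤ n := by
      intro h; exact h1 (by exact_mod_cast h)
    simp only [h1, h2, and_false, if_false, ite_self]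

/-- The sum over bases of determinant divisible by `d`, as a sum of integrals over `(u, w)`. -/
lemma sum_quads_dvd_close (hΦ : IsWeight Φ) (hβ : 0 < β) (hγ : 0 < γ) {d : ℕ} (hd : 0 < d) (n : ℕ) :
    |∑ q ∈ quads n with d ∣ qdet q, coneTerm Φ q.1 q.2.1 q.2.2.1 q.2.2.2 β γ -
      (d : ℝ)⁻¹ * ∑ t ∈ d.divisors, (Nat.totient t : ℝ) *
        ∑ u ∈ Finset.Icc 1 n, ∑ w ∈ Finset.Icc 1 n,
          if t ∣ u ∧ t ∣ w then (cellIntegral Φ β γ n u w).toReal else 0| ≤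
      4 * (β + γ) * n ^ 2 * harmonicSum n ^ 2 := by
  -- `gcd(d, u, w)` is the sum of `φ(t)` over its divisors
  have hg : ∀ u w : ℕ, (Nat.gcd d (Nat.gcd u w) : ℝ) =
      ∑ t ∈ d.divisors, (Nat.totient t : ℝ) * if t ∣ u ∧ t ∣ w then 1 else 0 := by
    intro u w
    have hg0 : Nat.gcd d (Nat.gcd u w) ≠ 0 := (Nat.gcd_pos_of_pos_left _ hd).ne'
    have h1 := Nat.sum_totient (Nat.gcd d (Nat.gcd u w))
    simp only [mul_ite, mul_one, mul_zero]
    rw [← Finset.sum_filter]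
    conv_lhs => rw [← h1]
    push_cast
    refine Finset.sum_congr ?_ fun _ _ => rfl
    ext t
    simp only [Nat.mem_divisors, Finset.mem_filter, Nat.dvd_gcd_iff]
    have := hd.ne'
    tauto
  have e1 : (d : ℝ)⁻¹ * ∑ t ∈ d.divisors, (Nat.totient t : ℝ) *
        ∑ u ∈ Finset.Icc 1 n, ∑ w ∈ Finset.Icc 1 n,
          (if t ∣ u ∧ t ∣ w then (cellIntegral Φ β γ n u w).toReal else 0) =
      ∑ u ∈ Finset.Icc 1 n, ∑ w ∈ Finset.Icc 1 n,
        (Nat.gcd d (Nat.gcd u w) : ℝ) / d * (cellIntegral Φ β γ n u w).toReal := by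
    simp only [Finset.mul_sum]
    rw [Finset.sum_comm]
    refine Finset.sum_congr rfl fun u _ => ?_
    rw [Finset.sum_comm]
    refine Finset.sum_congr rfl fun w _ => ?_
    rw [hg, Finset.sum_div, Finset.sum_mul]
    refine Finset.sum_congr rfl fun t _ => ?_
    split_ifs <;> ring
  rw [e1, sum_quads_dvd_eq, ← Finset.sum_sub_distrib]
  simp only [← Finset.sum_sub_distrib]
  have hterm : ∀ u ∈ Finset.Icc 1 n, ∀ w ∈ Finset.Icc 1 n,
      |∑ z ∈ Finset.range (n + 1), ∑ y ∈ Finset.range (n + 1),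
        (if d ∣ u * w + u * y + w * z then cellTerm Φ β γ n u w z y else 0) -
      (Nat.gcd d (Nat.gcd u w) : ℝ) / d * (cellIntegral Φ β γ n u w).toReal| ≤
      4 * (β + γ) * n ^ 2 * ((u : ℝ)⁻¹ * (w : ℝ)⁻¹) := by
    intro u hu w hw
    have hu1 := (Finset.mem_Icc.1 hu).1
    have hw1 := (Finset.mem_Icc.1 hw).1
    by_cases huw : u * w ≤ n
    · exact (cell_sum_close hΦ hβ hγ hd hu1 hw1).2.trans (cell_error_le hβ hγ hu1 hw1 huw)
    · have h1 : (n : ℝ) < u * w := by exact_mod_cast not_le.1 huw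
      rw [cellIntegral_eq_zero (by positivity) (by positivity) h1]
      simp only [cellTerm_eq_zero (Φ := Φ) (β := β) (γ := γ) (Nat.cast_nonneg u) (Nat.cast_nonneg w) h1,
        ite_self, Finset.sum_const_zero, ENNReal.toReal_zero, mul_zero, sub_zero, abs_zero]
      positivity
  refine (Finset.abs_sum_le_sum_abs _ _).trans ((Finset.sum_le_sum fun u hu =>
    (Finset.abs_sum_le_sum_abs _ _).trans (Finset.sum_le_sum fun w hw => hterm u hu w hw)).trans ?_)
  simp only [← Finset.mul_sum, ← Finset.sum_mul]
  refine mul_le_mul_of_nonneg_left ?_ (by positivity)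
  rw [pow_two]
  exact mul_le_mul (sum_Icc_inv_le n) (sum_Icc_inv_le n) (by positivity)
    (zero_le_one.trans (one_le_harmonicSum n))

end CellSum

/-! ### The coordinates of the strip -/

/-- The weight in the coordinates `Y = η - τ W`, `Z = η - (1 - τ) U` of the strip
`-W ≤ Y - Z ≤ U`, multiplied by the Jacobian `U + W`. -/
noncomputable def stripTerm (Φ : ℝ → ℝ → ℝ → ℝ → ℝ) (N U W η τ : ℝ) : ℝ :=
  if 0 ≤ U ∧ 0 ≤ W ∧ 0 ≤ τ ∧ τ ≤ 1 ∧ 0 < η ∧ τ * W ≤ η ∧ (1 - τ) * U ≤ η ∧ (U + W) * η ≤ N then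
    (U + W) * Φ U W (η - τ * W) (η - (1 - τ) * U) else 0

/-- The integral of the weight over `Y, Z ≥ 0` in the strip `-W ≤ Y - Z ≤ U` with
`U W + U Y + W Z ≤ N`. -/
noncomputable def stripIntegral (Φ : ℝ → ℝ → ℝ → ℝ → ℝ) (N U W : ℝ) : ℝ≥0∞ :=
  ∫⁻ η, ∫⁻ τ, ENNReal.ofReal (stripTerm Φ N U W η τ)

section Strip

variable {Φ : ℝ → ℝ → ℝ → ℝ → ℝ} {N : ℝ}

lemma measurable_stripTerm (hΦ : IsWeight Φ) :
    Measurable fun p : ℝ × ℝ × ℝ × ℝ => stripTerm Φ N p.1 p.2.1 p.2.2.1 p.2.2.2 := by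
  unfold stripTerm
  refine Measurable.ite ?_ ?_ measurable_const
  · exact (measurableSet_le (f := fun p : ℝ × ℝ × ℝ × ℝ => 0)
      (g := fun p => p.1) (by fun_prop) (by fun_prop)).inter
      ((measurableSet_le (f := fun p : ℝ × ℝ × ℝ × ℝ => 0)
      (g := fun p => p.2.1) (by fun_prop) (by fun_prop)).inter
      ((measurableSet_le (f := fun p : ℝ × ℝ × ℝ × ℝ => 0)
      (g := fun p => p.2.2.2) (by fun_prop) (by fun_prop)).inter
      ((measurableSet_le (f := fun p : ℝ × ℝ × ℝ × ℝ => p.2.2.2)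
      (g := fun p => 1) (by fun_prop) (by fun_prop)).inter
      ((measurableSet_lt (f := fun p : ℝ × ℝ × ℝ × ℝ => 0)
      (g := fun p => p.2.2.1) (by fun_prop) (by fun_prop)).inter
      ((measurableSet_le (f := fun p : ℝ × ℝ × ℝ × ℝ => p.2.2.2 * p.2.1)
      (g := fun p => p.2.2.1) (by fun_prop) (by fun_prop)).inter
      ((measurableSet_le (f := fun p : ℝ × ℝ × ℝ × ℝ => (1 - p.2.2.2) * p.1)
      (g := fun p => p.2.2.1) (by fun_prop) (by fun_prop)).inter
      ((measurableSet_le (f := fun p : ℝ × ℝ × ℝ × ℝ => (p.1 + p.2.1) * p.2.2.1)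
      (g := fun p => N) (by fun_prop) (by fun_prop)))))))))
  · exact ((continuous_fst.add (continuous_fst.comp continuous_snd)).mul (hΦ.cont.comp
      (by fun_prop : Continuous fun p : ℝ × ℝ × ℝ × ℝ => (p.1, p.2.1,
        p.2.2.1 - p.2.2.2 * p.2.1, p.2.2.1 - (1 - p.2.2.2) * p.1)))).measurable

lemma measurable_ofReal_stripTerm (hΦ : IsWeight Φ) {α : Type*} [MeasurableSpace α]
    {f g h k : α → ℝ} (hf : Measurable f) (hg : Measurable g) (hh : Measurable h)
    (hk : Measurable k) :
    Measurable fun x => ENNReal.ofReal (stripTerm Φ N (f x) (g x) (h x) (k x)) :=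
  ((measurable_stripTerm hΦ).comp (hf.prodMk (hg.prodMk (hh.prodMk hk)))).ennreal_ofReal

lemma stripTerm_nonneg (hΦ : IsWeight Φ) (U W η τ : ℝ) : 0 ≤ stripTerm Φ N U W η τ := by
  unfold stripTerm
  split_ifs with h
  · obtain ⟨h1, h2, h3, h4, h5, h6, h7, h8⟩ := h
    exact mul_nonneg (by positivity) (hΦ.nonneg h1 h2 (by linarith) (by linarith))
  · exact le_rfl

lemma stripTerm_symm (hΦ : IsWeight Φ) (U W η τ : ℝ) :
    stripTerm Φ N W U η (1 - τ) = stripTerm Φ N U W η τ := by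
  unfold stripTerm
  rw [show 1 - (1 - τ) = τ by ring, hΦ.symm, add_comm W U]
  refine if_congr ?_ rfl rfl
  constructor <;> rintro ⟨h1, h2, h3, h4, h5, h6, h7, h8⟩ <;>
    exact ⟨h2, h1, by linarith, by linarith, h5, h7, h6, h8⟩

lemma stripIntegral_symm (hΦ : IsWeight Φ) (U W : ℝ) :
    stripIntegral Φ N W U = stripIntegral Φ N U W := by
  unfold stripIntegral
  refine lintegral_congr fun η => ?_
  rw [← lintegral_sub_left_eq_self _ 1]
  simp only [stripTerm_symm hΦ]

/-- For fixed `(η, τ)`, the term is monotone in `W` on an interval and vanishes outside it. -/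
lemma unimodal_stripTerm (hΦ : IsWeight Φ) (U η τ : ℝ) :
    Unimodal fun W => stripTerm Φ N U W η τ := by
  classical
  unfold stripTerm
  refine unimodal_ite (C := {W | 0 ≤ U ∧ 0 ≤ W ∧ 0 ≤ τ ∧ τ ≤ 1 ∧ 0 < η ∧ τ * W ≤ η ∧
    (1 - τ) * U ≤ η ∧ (U + W) * η ≤ N}) ⟨?_⟩ ?_
  · rintro W₁ ⟨h1, h2, h3, h4, h5, h6, h7, -⟩ W₂ ⟨-, -, -, -, -, h8, -, h9⟩ W ⟨hW1, hW2⟩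
    have i1 := mul_le_mul_of_nonneg_left hW2 h3
    have i2 := mul_le_mul_of_nonneg_right hW2 h5.le
    exact ⟨h1, h2.trans hW1, h3, h4, h5, by linarith, h7, by linarith⟩
  · rintro W₁ ⟨h1, h2, h3, h4, h5, h6, h7, -⟩ W₂ ⟨-, -, -, -, -, h8, -, -⟩ hW
    exact hΦ.strip h1 h2 hW h3 h4 h5.le h8 h7

lemma stripTerm_le (hΦ : IsWeight Φ) {U W η τ : ℝ} (h : 0 ≤ U ∧ 0 ≤ W ∧ 0 ≤ τ ∧ τ ≤ 1 ∧ 0 < η ∧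
    τ * W ≤ η ∧ (1 - τ) * U ≤ η ∧ (U + W) * η ≤ N) :
    stripTerm Φ N U W η τ ≤ (U + W) ^ 2 + N := by
  rw [stripTerm, if_pos h]
  obtain ⟨h1, h2, h3, h4, h5, h6, h7, h8⟩ := h
  have i1 := hΦ.le_frob h1 h2 (sub_nonneg.2 h6) (sub_nonneg.2 h7)
  have i2 : max (η - τ * W) (η - (1 - τ) * U) ≤ η := max_le
    (by linarith [mul_nonneg h3 h2]) (by linarith [mul_nonneg (sub_nonneg.2 h4) h1])
  have i3 := mul_le_mul_of_nonneg_left (i1.trans (add_le_add_right i2 _)) (add_nonneg h1 h2)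
  nlinarith

/-- A bound for `stripTerm` which does not depend on `W`, and whose integral over `η` and `τ` is
`O(N ^ 2 / U)`. -/
noncomputable def stripBound (N U η τ : ℝ) : ℝ :=
  (if η ∈ Ioc 0 (N / U) then
    (if τ ∈ Icc (0 : ℝ) 1 then 3 * N else 0) + (if τ ∈ Icc (1 - η / U) 1 then N * U / η else 0)
    else 0) + if η ∈ Ioi (U / 2) then (if τ ∈ Icc (0 : ℝ) 1 then N ^ 2 * (η ^ 2)⁻¹ else 0) else 0

lemma stripTerm_le_stripBound (hΦ : IsWeight Φ) (hN : 0 ≤ N) {U : ℝ} (hU : 0 < U) (W η τ : ℝ) :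
    stripTerm Φ N U W η τ ≤ stripBound N U η τ := by
  unfold stripBound
  by_cases h : 0 ≤ U ∧ 0 ≤ W ∧ 0 ≤ τ ∧ τ ≤ 1 ∧ 0 < η ∧ τ * W ≤ η ∧ (1 - τ) * U ≤ η ∧ (U + W) * η ≤ N
  · have hle := stripTerm_le hΦ h
    obtain ⟨h1, h2, h3, h4, h5, h6, h7, h8⟩ := h
    have hA : U + W ≤ N / η := by rwa [le_div_iff₀ h5]
    have i1 : η ∈ Ioc 0 (N / U) := ⟨h5, by rw [le_div_iff₀ hU]; nlinarith⟩
    have i2 : τ ∈ Icc (0 : ℝ) 1 := ⟨h3, h4⟩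
    have i3 : τ ∈ Icc (1 - η / U) 1 := by
      refine ⟨?_, h4⟩
      have : 1 - τ ≤ η / U := by rwa [le_div_iff₀ hU]
      linarith
    rw [if_pos i1, if_pos i2, if_pos i3]
    refine hle.trans ?_
    have h9 : N * U / η = N / η * U := by ring
    have h10 : N ^ 2 * (η ^ 2)⁻¹ = (N / η) ^ 2 := by field_simp
    by_cases hη : U / 2 < η
    · rw [if_pos (show η ∈ Ioi (U / 2) from hη), if_pos i2, h10]
      have := pow_le_pow_left₀ (by positivity) hA 2
      have : 0 ≤ N * U / η := by positivity
      linarith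
    · rw [if_neg (show η ∉ Ioi (U / 2) from hη), h9]
      -- here `τ ≥ 1/2`, and so `W ≤ 2 η`
      have hη' := not_lt.1 hη
      have hτ : 1 / 2 ≤ τ := by
        by_contra! hcon
        nlinarith
      have hW : W ≤ 2 * η := by nlinarith
      have j1 : (U + W) ^ 2 ≤ (U + W) * (U + 2 * η) := by
        rw [pow_two]; exact mul_le_mul_of_nonneg_left (by linarith) (by positivity)
      have j2 := mul_le_mul_of_nonneg_right hA h1
      nlinarith
  · rw [stripTerm, if_neg h]
    refine add_nonneg ?_ ?_
    · split_ifs with h1 <;> try positivity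
      all_goals have := h1.1; positivity
    · split_ifs <;> positivity

lemma measurable_ofReal_ite_Icc (p q c : ℝ) :
    Measurable fun τ => ENNReal.ofReal (if τ ∈ Icc p q then c else 0) :=
  (Measurable.ite measurableSet_Icc measurable_const measurable_const).ennreal_ofReal

lemma lintegral_ofReal_ite_Icc (p q c : ℝ) :
    ∫⁻ τ, ENNReal.ofReal (if τ ∈ Icc p q then c else 0) =
      ENNReal.ofReal c * ENNReal.ofReal (q - p) := by
  have h : ∀ τ, ENNReal.ofReal (if τ ∈ Icc p q then c else 0) =
      (Icc p q).indicator (fun _ => ENNReal.ofReal c) τ := by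
    intro τ
    by_cases hτ : τ ∈ Icc p q
    · rw [if_pos hτ, indicator_of_mem hτ]
    · rw [if_neg hτ, indicator_of_notMem hτ, ENNReal.ofReal_zero]
  simp only [h]
  rw [lintegral_indicator_const measurableSet_Icc, Real.volume_Icc]

lemma lintegral_Ioi_inv_sq {c : ℝ} (hc : 0 < c) :
    ∫⁻ x in Ioi c, ENNReal.ofReal ((x ^ 2)⁻¹) = ENNReal.ofReal c⁻¹ := by
  have h1 : ∀ x ∈ Ioi c, (x ^ 2)⁻¹ = x ^ (-2 : ℝ) := by
    intro x hx
    rw [Real.rpow_neg (hc.trans hx).le, Real.rpow_two]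
  have h2 := integrableOn_Ioi_rpow_of_lt (by norm_num : (-2 : ℝ) < -1) hc
  have h3 := integral_Ioi_rpow_of_lt (by norm_num : (-2 : ℝ) < -1) hc
  rw [setLIntegral_congr_fun measurableSet_Ioi fun x hx => by rw [h1 x hx],
    ← ofReal_integral_eq_lintegral_ofReal h2, h3]
  · congr 1
    rw [show (-2 : ℝ) + 1 = -1 by norm_num, Real.rpow_neg_one]
    ring
  · refine ae_restrict_of_forall_mem measurableSet_Ioi fun x hx => ?_
    exact Real.rpow_nonneg (hc.trans hx).le _

lemma lintegral_stripBound_le (hN : 0 ≤ N) {U : ℝ} (hU : 0 < U) :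
    ∫⁻ η, ∫⁻ τ, ENNReal.ofReal (stripBound N U η τ) ≤ ENNReal.ofReal (6 * N ^ 2 / U) := by
  have h : ∀ η, ∫⁻ τ, ENNReal.ofReal (stripBound N U η τ) ≤
      (Ioc 0 (N / U)).indicator (fun _ => ENNReal.ofReal (4 * N)) η +
        (Ioi (U / 2)).indicator (fun η => ENNReal.ofReal (N ^ 2) * ENNReal.ofReal ((η ^ 2)⁻¹)) η := by
    intro η
    unfold stripBound
    have hm2 : Measurable fun τ => ENNReal.ofReal (if η ∈ Ioc 0 (N / U) then
      (if τ ∈ Icc (0 : ℝ) 1 then 3 * N else 0) + (if τ ∈ Icc (1 - η / U) 1 then N * U / η else 0)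
      else 0) := by
      split_ifs
      · exact ((Measurable.ite measurableSet_Icc measurable_const measurable_const).add
          (Measurable.ite measurableSet_Icc measurable_const measurable_const)).ennreal_ofReal
      · exact measurable_const
    refine (lintegral_mono fun τ => ENNReal.ofReal_add_le).trans ?_
    rw [lintegral_add_left hm2]
    refine add_le_add ?_ ?_
    · by_cases hη : η ∈ Ioc 0 (N / U)
      · simp only [if_pos hη]
        rw [indicator_of_mem hη]
        refine (lintegral_mono fun τ => ENNReal.ofReal_add_le).trans ?_
        have hη0 := hη.1
        rw [lintegral_add_left (measurable_ofReal_ite_Icc _ _ _), lintegral_ofReal_ite_Icc,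
          lintegral_ofReal_ite_Icc,
          ← ENNReal.ofReal_mul (by positivity), ← ENNReal.ofReal_mul (by positivity),
          ← ENNReal.ofReal_add (by positivity)]
        · refine ENNReal.ofReal_le_ofReal (le_of_eq ?_)
          field_simp
          ring
        · rw [sub_sub_cancel]; positivity
      · simp [hη]
    · by_cases hη : η ∈ Ioi (U / 2)
      · simp only [if_pos hη]
        rw [indicator_of_mem hη, lintegral_ofReal_ite_Icc, ENNReal.ofReal_mul (by positivity)]
        simp
      · simp only [if_neg hη]
        simp
  refine (lintegral_mono h).trans ?_
  rw [lintegral_add_left (measurable_const.indicator measurableSet_Ioc),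
    lintegral_indicator_const measurableSet_Ioc, Real.volume_Ioc, sub_zero,
    lintegral_indicator measurableSet_Ioi, lintegral_const_mul _ (by fun_prop),
    lintegral_Ioi_inv_sq (by positivity), ← ENNReal.ofReal_mul (by positivity),
    ← ENNReal.ofReal_mul (by positivity), ← ENNReal.ofReal_add (by positivity) (by positivity)]
  refine ENNReal.ofReal_le_ofReal (le_of_eq ?_)
  field_simp
  ring

lemma measurable_lintegral_stripTerm (hΦ : IsWeight Φ) (U η : ℝ) {f : ℝ → ℝ} (hf : Measurable f)
    (μ : Measure ℝ) [SFinite μ] :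
    Measurable fun τ => ∫⁻ w, ENNReal.ofReal (stripTerm Φ N U (f w) η τ) ∂μ :=
  (measurable_ofReal_stripTerm hΦ (α := ℝ × ℝ) measurable_const (hf.comp measurable_snd)
    measurable_const measurable_fst).lintegral_prod_right'

lemma lintegral_stripIntegral (hΦ : IsWeight Φ) (U : ℝ) {f : ℝ → ℝ} (hf : Measurable f)
    (μ : Measure ℝ) [SFinite μ] :
    ∫⁻ w, stripIntegral Φ N U (f w) ∂μ =
      ∫⁻ η, ∫⁻ τ, ∫⁻ w, ENNReal.ofReal (stripTerm Φ N U (f w) η τ) ∂μ := by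
  unfold stripIntegral
  rw [lintegral_lintegral_swap]
  · refine lintegral_congr fun η => ?_
    rw [lintegral_lintegral_swap]
    exact (measurable_ofReal_stripTerm hΦ (α := ℝ × ℝ) measurable_const (hf.comp measurable_fst)
      measurable_const measurable_snd).aemeasurable
  · exact (measurable_ofReal_stripTerm hΦ (α := (ℝ × ℝ) × ℝ) (measurable_const (a := U))
      (hf.comp (measurable_fst.comp measurable_fst)) (measurable_snd.comp measurable_fst)
      measurable_snd).lintegral_prod_right'.aemeasurable

/-- Summing over `w` in an arithmetic progression against integrating over `w`. -/
lemma lintegral_stripIntegral_le (hΦ : IsWeight Φ) (hN : 0 ≤ N) {U c : ℝ} (hU : 0 < U)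
    (hc : 0 ≤ c) {μ ν : Measure ℝ} [SFinite μ] [SFinite ν] (h : IntervalClose μ ν) :
    ∫⁻ w, stripIntegral Φ N U (c * w) ∂μ ≤
      ∫⁻ w, stripIntegral Φ N U (c * w) ∂ν + ENNReal.ofReal (6 * N ^ 2 / U) := by
  have hf : Measurable fun w : ℝ => c * w := by fun_prop
  rw [lintegral_stripIntegral hΦ U hf, lintegral_stripIntegral hΦ U hf]
  have h1 : ∀ η τ, ∫⁻ w, ENNReal.ofReal (stripTerm Φ N U (c * w) η τ) ∂μ ≤
      ∫⁻ w, ENNReal.ofReal (stripTerm Φ N U (c * w) η τ) ∂ν +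
        ENNReal.ofReal (stripBound N U η τ) := by
    intro η τ
    refine h.lintegral_le (fun w => stripTerm_nonneg hΦ _ _ _ _)
      ((measurable_stripTerm hΦ).comp (by fun_prop : Measurable fun w : ℝ => (U, c * w, η, τ)))
      (fun w => stripTerm_le_stripBound hΦ hN hU _ _ _) ?_
    intro t ht
    exact (unimodal_stripTerm hΦ U η τ t ht).preimage_mono
      (fun a b hab => mul_le_mul_of_nonneg_left hab hc)
  refine (lintegral_mono fun η => lintegral_mono fun τ => h1 η τ).trans ?_
  simp only [lintegral_add_left (measurable_lintegral_stripTerm hΦ _ _ hf ν)]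
  rw [lintegral_add_left]
  · exact add_le_add_right (lintegral_stripBound_le hN hU) _
  · have h2 : Measurable fun p : ℝ × ℝ =>
        ∫⁻ w, ENNReal.ofReal (stripTerm Φ N U (c * w) p.1 p.2) ∂ν :=
      (measurable_ofReal_stripTerm hΦ (α := (ℝ × ℝ) × ℝ) (measurable_const (a := U))
        (hf.comp measurable_snd) (measurable_fst.comp measurable_fst)
        (measurable_snd.comp measurable_fst)).lintegral_prod_right'
    exact h2.lintegral_prod_right'

lemma stripIntegral_le_of_le (hΦ : IsWeight Φ) (hN : 0 ≤ N) {U W : ℝ} (hU : 0 < U) (hW : 0 < W)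
    (hWU : W ≤ U) : stripIntegral Φ N U W ≤ ENNReal.ofReal (3 * N ^ 2 / (U + W)) := by
  have hA : 0 < U + W := by positivity
  have h : ∀ η, ∫⁻ τ, ENNReal.ofReal (stripTerm Φ N U W η τ) ≤
      (Ioc 0 (N / (U + W))).indicator (fun _ => ENNReal.ofReal (3 * N)) η := by
    intro η
    by_cases hη : η ∈ Ioc 0 (N / (U + W))
    · rw [indicator_of_mem hη]
      have h1 : ∀ τ, ENNReal.ofReal (stripTerm Φ N U W η τ) ≤
          ENNReal.ofReal (if τ ∈ Icc (1 - 2 * N / (U + W) ^ 2) 1 then (U + W) ^ 2 else 0) +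
          ENNReal.ofReal (if τ ∈ Icc (0 : ℝ) 1 then N else 0) := by
        intro τ
        by_cases h : 0 ≤ U ∧ 0 ≤ W ∧ 0 ≤ τ ∧ τ ≤ 1 ∧ 0 < η ∧ τ * W ≤ η ∧ (1 - τ) * U ≤ η ∧
            (U + W) * η ≤ N
        · have hle := stripTerm_le hΦ h
          obtain ⟨-, -, h3, h4, h5, h6, h7, h8⟩ := h
          have i1 : τ ∈ Icc (1 - 2 * N / (U + W) ^ 2) 1 := by
            refine ⟨?_, h4⟩
            have : 1 - τ ≤ 2 * N / (U + W) ^ 2 := by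
              rw [le_div_iff₀ (by positivity)]
              have j1 := mul_le_mul_of_nonneg_left h7 hA.le
              have j2 := mul_le_mul_of_nonneg_left (by linarith : U + W ≤ 2 * U)
                (mul_nonneg (sub_nonneg.2 h4) hA.le)
              nlinarith
            linarith
          rw [if_pos i1, if_pos (show τ ∈ Icc (0 : ℝ) 1 from ⟨h3, h4⟩),
            ← ENNReal.ofReal_add (by positivity) hN]
          exact ENNReal.ofReal_le_ofReal hle
        · rw [stripTerm, if_neg h, ENNReal.ofReal_zero]
          exact zero_le
      refine (lintegral_mono h1).trans ?_
      rw [lintegral_add_left (measurable_ofReal_ite_Icc _ _ _), lintegral_ofReal_ite_Icc,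
        lintegral_ofReal_ite_Icc,
        ← ENNReal.ofReal_mul (by positivity), ← ENNReal.ofReal_mul (by positivity),
        ← ENNReal.ofReal_add (by rw [sub_sub_cancel]; positivity) (by linarith)]
      refine ENNReal.ofReal_le_ofReal (le_of_eq ?_)
      field_simp
      ring
    · rw [indicator_of_notMem hη]
      have : ∀ τ, stripTerm Φ N U W η τ = 0 := by
        intro τ
        rw [stripTerm, if_neg]
        rintro ⟨-, -, -, -, h5, -, -, h8⟩
        refine hη ⟨h5, ?_⟩
        rw [le_div_iff₀ hA]
        linarith
      simp [this]
  unfold stripIntegral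
  refine (lintegral_mono h).trans ?_
  rw [lintegral_indicator_const measurableSet_Ioc, Real.volume_Ioc, sub_zero,
    ← ENNReal.ofReal_mul (by positivity)]
  refine ENNReal.ofReal_le_ofReal (le_of_eq ?_)
  field_simp

lemma stripIntegral_le (hΦ : IsWeight Φ) (hN : 0 ≤ N) {U W : ℝ} (hU : 0 < U) (hW : 0 < W) :
    stripIntegral Φ N U W ≤ ENNReal.ofReal (3 * N ^ 2 / (U + W)) := by
  rcases le_total W U with h | h
  · exact stripIntegral_le_of_le hΦ hN hU hW h
  · rw [← stripIntegral_symm hΦ, add_comm]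
    exact stripIntegral_le_of_le hΦ hN hW hU h

/-- The change of variables from `(y, z)` to the coordinates of the strip. -/
lemma cellIntegral_eq (hΦ : IsWeight Φ) {β γ u w : ℝ} (hβ : 0 < β) (hγ : 0 < γ) (hu : 0 < u)
    (hw : 0 < w) (X : ℝ) :
    cellIntegral Φ β γ X u w =
      ENNReal.ofReal (β * γ)⁻¹ * stripIntegral Φ (X * β * γ) (β * u) (γ * w) := by
  have hU : 0 < β * u := by positivity
  have hW : 0 < γ * w := by positivity
  have hscale : ∀ z y, cellTerm Φ β γ X u w z y =
      cellTerm Φ 1 1 (X * β * γ) (β * u) (γ * w) (β * z) (γ * y) := by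
    intro z y
    unfold cellTerm
    simp only [one_mul]
    refine if_congr ?_ rfl rfl
    have e1 : 0 ≤ β * z ↔ 0 ≤ z := mul_nonneg_iff_of_pos_left hβ
    have e2 : 0 ≤ γ * y ↔ 0 ≤ y := mul_nonneg_iff_of_pos_left hγ
    have e3 : β * u * (γ * w) + β * u * (γ * y) + γ * w * (β * z) ≤ X * β * γ ↔
        u * w + u * y + w * z ≤ X := by
      rw [show β * u * (γ * w) + β * u * (γ * y) + γ * w * (β * z) =
        (u * w + u * y + w * z) * (β * γ) by ring, mul_assoc]
      exact mul_le_mul_iff_of_pos_right (by positivity)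
    rw [e1, e2, e3, mul_add, mul_add]
  set U := β * u with hUdef
  set W := γ * w with hWdef
  set M := X * β * γ with hMdef
  set K := cellTerm Φ 1 1 M U W with hK
  have hA : 0 < U + W := by positivity
  have hKm : Measurable (Function.uncurry K) := measurable_cellTerm hΦ
  have hnull : ∀ᵐ x : ℝ, x ≠ 0 := by
    rw [ae_iff]; simp
  have hK0 : ∀ z y, K z y ≠ 0 → 0 ≤ y ∧ 0 ≤ z := by
    intro z y h
    by_contra hcon
    exact h (by rw [hK, cellTerm, if_neg fun h => hcon ⟨h.1, h.2.1⟩])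
  have hpos : ∀ f : ℝ → ℝ≥0∞, (∀ x, f x ≠ 0 → 0 ≤ x) → ∫⁻ x in Ioi (0 : ℝ), f x = ∫⁻ x, f x := by
    intro f hf
    rw [← lintegral_indicator measurableSet_Ioi]
    refine lintegral_congr_ae ?_
    filter_upwards [hnull] with x hx
    by_cases hx0 : x ∈ Ioi (0 : ℝ)
    · rw [indicator_of_mem hx0]
    · rw [indicator_of_notMem hx0]
      by_contra hcon
      exact hx0 (lt_of_le_of_ne (hf x (Ne.symm hcon)) (Ne.symm hx))
  have e1 : cellIntegral Φ β γ X u w = ENNReal.ofReal (β * γ)⁻¹ *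
      ∫⁻ y, ∫⁻ z, ENNReal.ofReal (K z y) := by
    unfold cellIntegral
    simp only [hscale]
    have h1 : ∀ y, ∫⁻ z in Ioi (0 : ℝ), ENNReal.ofReal (K (β * z) (γ * y)) =
        ENNReal.ofReal β⁻¹ * ∫⁻ z, ENNReal.ofReal (K z (γ * y)) := by
      intro y
      rw [hpos]
      · have := lintegral_affine (fun z => ENNReal.ofReal (K z (γ * y))) hβ 0
        simpa using this
      · intro z hz
        have h2 : K (β * z) (γ * y) ≠ 0 := fun h => hz (by rw [h, ENNReal.ofReal_zero])
        exact (mul_nonneg_iff_of_pos_left hβ).1 (hK0 _ _ h2).2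
    simp only [h1]
    rw [lintegral_const_mul' _ _ ENNReal.ofReal_ne_top, hpos]
    · have := lintegral_affine (fun y => ∫⁻ z, ENNReal.ofReal (K z y)) hγ 0
      simp only [add_zero] at this
      rw [this, ← mul_assoc, ← ENNReal.ofReal_mul (by positivity), mul_inv]
    · intro y hy
      by_contra hcon
      refine hy ?_
      have : ∀ z, K z (γ * y) = 0 := by
        intro z
        by_contra h
        exact hcon ((mul_nonneg_iff_of_pos_left hγ).1 (hK0 _ _ h).1)
      simp [this]
  rw [e1]
  congr 1
  -- for fixed `z`, the variable `τ` instead of `y`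
  have hswap1 : ∫⁻ y, ∫⁻ z, ENNReal.ofReal (K z y) = ∫⁻ z, ∫⁻ y, ENNReal.ofReal (K z y) :=
    lintegral_lintegral_swap (hKm.comp measurable_swap).ennreal_ofReal.aemeasurable
  have e2 : ∀ z, ∫⁻ y, ENNReal.ofReal (K z y) =
      ENNReal.ofReal (U + W) * ∫⁻ τ, ENNReal.ofReal (K z (z + U - (U + W) * τ)) := by
    intro z
    have h1 := lintegral_affine (fun y => ENNReal.ofReal (K z y)) hA (z - W)
    rw [← lintegral_sub_left_eq_self _ 1] at h1
    have h2 : ∀ τ : ℝ, (U + W) * (1 - τ) + (z - W) = z + U - (U + W) * τ := fun τ => by ring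
    simp only [h2] at h1
    rw [h1, ← mul_assoc, ← ENNReal.ofReal_mul hA.le, mul_inv_cancel₀ hA.ne', ENNReal.ofReal_one,
      one_mul]
  have e3 : ∀ τ, ∫⁻ z, ENNReal.ofReal (K z (z + U - (U + W) * τ)) =
      ∫⁻ η, ENNReal.ofReal (K (η - (1 - τ) * U) (η - τ * W)) := by
    intro τ
    rw [← lintegral_sub_right_eq_self _ ((1 - τ) * U)]
    refine lintegral_congr fun η => ?_
    congr 2
    ring
  have hm3 : Measurable (Function.uncurry fun z τ => ENNReal.ofReal (K z (z + U - (U + W) * τ))) :=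
    (hKm.comp (by fun_prop : Measurable fun p : ℝ × ℝ =>
      (p.1, p.1 + U - (U + W) * p.2))).ennreal_ofReal
  have hm4 : Measurable (Function.uncurry fun τ η =>
      ENNReal.ofReal (K (η - (1 - τ) * U) (η - τ * W))) :=
    (hKm.comp (by fun_prop : Measurable fun p : ℝ × ℝ =>
      (p.2 - (1 - p.1) * U, p.2 - p.1 * W))).ennreal_ofReal
  rw [hswap1]
  simp only [e2]
  rw [lintegral_const_mul' _ _ ENNReal.ofReal_ne_top, lintegral_lintegral_swap hm3.aemeasurable]
  simp only [e3]
  rw [lintegral_lintegral_swap hm4.aemeasurable, ← lintegral_const_mul' _ _ ENNReal.ofReal_ne_top]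
  unfold stripIntegral
  refine lintegral_congr_ae ?_
  filter_upwards [hnull] with η hη
  rw [← lintegral_const_mul' _ _ ENNReal.ofReal_ne_top]
  refine lintegral_congr_ae ?_
  filter_upwards [hnull] with τ hτ
  rw [← ENNReal.ofReal_mul hA.le, hK, cellTerm, stripTerm, mul_ite, mul_zero]
  simp only [one_mul]
  congr 1
  refine if_congr ?_ rfl rfl
  constructor
  · rintro ⟨h1, h2, h3, h4, h5⟩
    have i1 : 0 < τ := by
      have : 0 < τ * (U + W) := by nlinarith
      exact pos_of_mul_pos_left this hA.le
    have i2 : τ ≤ 1 := by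
      have : 0 ≤ (1 - τ) * (U + W) := by nlinarith
      linarith [nonneg_of_mul_nonneg_left this hA]
    have i3 : 0 ≤ η := by linarith [mul_pos i1 hW]
    exact ⟨hU.le, hW.le, i1.le, i2, lt_of_le_of_ne i3 (Ne.symm hη), by linarith, by linarith,
      by linarith⟩
  · rintro ⟨-, -, h3, h4, h5, h6, h7, h8⟩
    have i1 : 0 < τ * (U + W) := mul_pos (lt_of_le_of_ne h3 (Ne.symm hτ)) hA
    have i2 : 0 ≤ (1 - τ) * (U + W) := mul_nonneg (by linarith) hA.le
    exact ⟨by linarith, by linarith, by linarith, by linarith, by linarith⟩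

end Strip

/-! ### The sum over `u` and `w` -/

/-- `cellIntegral` in the coordinates of the strip; unlike `cellIntegral`, it is symmetric under
interchanging `(β, u)` and `(γ, w)`. -/
noncomputable def scaledStrip (Φ : ℝ → ℝ → ℝ → ℝ → ℝ) (β γ X u w : ℝ) : ℝ≥0∞ :=
  ENNReal.ofReal (β * γ)⁻¹ * stripIntegral Φ (X * β * γ) (β * u) (γ * w)

section ScaledStrip

variable {Φ : ℝ → ℝ → ℝ → ℝ → ℝ} {β γ X : ℝ}

lemma scaledStrip_symm (hΦ : IsWeight Φ) (u w : ℝ) :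
    scaledStrip Φ γ β X w u = scaledStrip Φ β γ X u w := by
  unfold scaledStrip
  rw [stripIntegral_symm hΦ, mul_comm γ β, mul_right_comm]

lemma measurable_scaledStrip (hΦ : IsWeight Φ) :
    Measurable fun p : ℝ × ℝ => scaledStrip Φ β γ X p.1 p.2 := by
  unfold scaledStrip stripIntegral
  refine Measurable.const_mul ?_ _
  have h1 : Measurable fun p : ((ℝ × ℝ) × ℝ) × ℝ =>
      ENNReal.ofReal (stripTerm Φ (X * β * γ) (β * p.1.1.1) (γ * p.1.1.2) p.1.2 p.2) :=
    measurable_ofReal_stripTerm hΦ (by fun_prop) (by fun_prop) (by fun_prop) (by fun_prop)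
  exact h1.lintegral_prod_right'.lintegral_prod_right'

lemma scaledStrip_eq_zero (hβ : 0 < β) (hγ : 0 < γ) {u w : ℝ} (h : X < u * w) :
    scaledStrip Φ β γ X u w = 0 := by
  have h1 : ∀ η τ, stripTerm Φ (X * β * γ) (β * u) (γ * w) η τ = 0 := by
    intro η τ
    rw [stripTerm, if_neg]
    rintro ⟨h1, h2, h3, h4, h5, h6, h7, h8⟩
    have i1 := mul_le_mul_of_nonneg_right h6 h1
    have i2 := mul_le_mul_of_nonneg_right h7 h2
    have i3 := mul_lt_mul_of_pos_right h (mul_pos hβ hγ)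
    nlinarith
  simp [scaledStrip, stripIntegral, h1]

lemma scaledStrip_le (hΦ : IsWeight Φ) (hβ : 0 < β) (hγ : 0 < γ) (hX : 0 ≤ X) {u w : ℝ}
    (hu : 0 < u) (hw : 0 < w) :
    scaledStrip Φ β γ X u w ≤ ENNReal.ofReal (3 * X ^ 2 * (β * γ / (β * u + γ * w))) := by
  unfold scaledStrip
  have h := stripIntegral_le hΦ (by positivity : 0 ≤ X * β * γ) (mul_pos hβ hu) (mul_pos hγ hw)
  calc _ ≤ ENNReal.ofReal (β * γ)⁻¹ * ENNReal.ofReal (3 * (X * β * γ) ^ 2 / (β * u + γ * w)) := by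
        gcongr
    _ = _ := by
        rw [← ENNReal.ofReal_mul (by positivity)]
        congr 1
        field_simp

/-- Replacing the measure in the variable `w`. The total error is that of
`lintegral_stripIntegral_le`, integrated over `u`. -/
lemma lintegral_scaledStrip_le (hΦ : IsWeight Φ) (hβ : 0 < β) (hγ : 0 < γ) (hX : 0 ≤ X)
    {ρ σ σ' : Measure ℝ} [SFinite ρ] [SFinite σ] [SFinite σ'] (h : IntervalClose σ σ')
    (hρ : ∀ᵐ u ∂ρ, 1 ≤ u) (hσ : ∀ᵐ w ∂σ, 1 ≤ w) :
    ∫⁻ u, ∫⁻ w, scaledStrip Φ β γ X u w ∂σ ∂ρ ≤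
      ∫⁻ u, ∫⁻ w, scaledStrip Φ β γ X u w ∂σ' ∂ρ +
        ENNReal.ofReal (6 * X ^ 2 * γ) * ∫⁻ u, (Icc 1 X).indicator
          (fun u => ENNReal.ofReal u⁻¹) u ∂ρ := by
  have hm : Measurable ((Icc 1 X).indicator (fun u : ℝ => ENNReal.ofReal u⁻¹)) :=
    Measurable.indicator (by fun_prop) measurableSet_Icc
  rw [← lintegral_const_mul _ hm, ← lintegral_add_right _ (hm.const_mul _)]
  refine lintegral_mono_ae ?_
  filter_upwards [hρ] with u hu
  by_cases huX : u ≤ X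
  · rw [indicator_of_mem (show u ∈ Icc 1 X from ⟨hu, huX⟩), ← ENNReal.ofReal_mul (by positivity)]
    unfold scaledStrip
    rw [lintegral_const_mul' _ _ ENNReal.ofReal_ne_top,
      lintegral_const_mul' _ _ ENNReal.ofReal_ne_top]
    have h1 := lintegral_stripIntegral_le (N := X * β * γ) (U := β * u) (c := γ) hΦ (by positivity)
      (by positivity) hγ.le h
    refine (mul_le_mul_right h1 _).trans ?_
    rw [mul_add, ← ENNReal.ofReal_mul (by positivity)]
    refine add_le_add_right (ENNReal.ofReal_le_ofReal (le_of_eq ?_)) _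
    have : 0 < u := by linarith
    field_simp
  · have : ∫⁻ w, scaledStrip Φ β γ X u w ∂σ = 0 := by
      rw [lintegral_congr_ae (g := fun _ => 0)]
      · simp
      · filter_upwards [hσ] with w hw
        refine scaledStrip_eq_zero hβ hγ ?_
        nlinarith
    rw [this]
    exact zero_le

lemma ae_one_le_apMeasure {t : ℕ} (ht : 0 < t) : ∀ᵐ u ∂(apMeasure t t), 1 ≤ u := by
  rw [ae_iff]
  have hm : MeasurableSet {a : ℝ | ¬ 1 ≤ a} := by
    simp only [not_le]; exact measurableSet_Iio
  rw [apMeasure_apply _ _ hm, ENNReal.tsum_eq_zero]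
  intro n
  refine indicator_of_notMem ?_ _
  simp only [mem_ofPred_eq, not_not]
  have : (1 : ℝ) ≤ t := by exact_mod_cast ht
  nlinarith [Nat.cast_nonneg (α := ℝ) n]

lemma ae_one_le_densityMeasure (t : ℝ) : ∀ᵐ u ∂(densityMeasure t 1), 1 ≤ u := by
  unfold densityMeasure
  refine Measure.ae_smul_measure ?_ _
  exact ae_restrict_of_forall_mem measurableSet_Ioi fun u hu => le_of_lt hu

lemma log_le_harmonicSum (n : ℕ) : Real.log n ≤ harmonicSum n := by
  have h := log_add_one_le_harmonic n
  rw [harmonic] at h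
  push_cast at h
  rcases Nat.eq_zero_or_pos n with rfl | hn
  · simpa using zero_le_one.trans (one_le_harmonicSum 0)
  have h1 : Real.log n ≤ Real.log (n + 1) :=
    Real.log_le_log (by exact_mod_cast hn) (by linarith)
  rw [harmonicSum, Finset.sum_range_succ]
  have : (0 : ℝ) ≤ ((n : ℝ) + 1)⁻¹ := by positivity
  linarith

lemma lintegral_Ioc_inv {a b : ℝ} (ha : 0 < a) (hab : a ≤ b) :
    ∫⁻ u in Ioc a b, ENNReal.ofReal u⁻¹ = ENNReal.ofReal (Real.log (b / a)) := by
  rw [← integral_inv_of_pos ha (ha.trans_le hab), intervalIntegral.integral_of_le hab,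
    ofReal_integral_eq_lintegral_ofReal]
  · exact (intervalIntegrable_iff_integrableOn_Ioc_of_le hab).1
      (intervalIntegral.intervalIntegrable_inv (fun x hx => by
        rw [uIcc_of_le hab] at hx
        exact (ha.trans_le hx.1).ne') continuousOn_id)
  · exact ae_restrict_of_forall_mem measurableSet_Ioc fun u hu => (inv_pos.2 (ha.trans hu.1)).le

lemma lintegral_inv_apMeasure_le {t : ℕ} (ht : 0 < t) (n : ℕ) :
    ∫⁻ u, (Icc (1 : ℝ) n).indicator (fun u => ENNReal.ofReal u⁻¹) u ∂(apMeasure t t) ≤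
      ENNReal.ofReal ((t : ℝ)⁻¹ * harmonicSum n) := by
  classical
  have ht1 : (1 : ℝ) ≤ t := by exact_mod_cast ht
  rw [lintegral_apMeasure]
  have h : ∀ m : ℕ, (Icc (1 : ℝ) n).indicator (fun u => ENNReal.ofReal u⁻¹) (t + t * m) ≤
      if m ∈ Finset.range (n + 1) then ENNReal.ofReal ((t : ℝ)⁻¹ * ((m : ℝ) + 1)⁻¹) else 0 := by
    intro m
    by_cases hm : (t + t * m : ℝ) ∈ Icc (1 : ℝ) n
    · rw [indicator_of_mem hm, if_pos]
      · refine ENNReal.ofReal_le_ofReal (le_of_eq ?_)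
        rw [← mul_inv]; congr 1; ring
      · rw [Finset.mem_range]
        have h1 : (m : ℝ) ≤ n := by nlinarith [hm.2, Nat.cast_nonneg (α := ℝ) m]
        have : m ≤ n := by exact_mod_cast h1
        omega
    · rw [indicator_of_notMem hm]; exact zero_le
  refine (ENNReal.tsum_le_tsum h).trans ?_
  rw [tsum_eq_sum (s := Finset.range (n + 1)) (fun n hn => if_neg hn), Finset.sum_ite_mem,
    Finset.inter_self, ← ENNReal.ofReal_sum_of_nonneg (fun m _ => by positivity),
    ← Finset.mul_sum, harmonicSum]

lemma lintegral_inv_densityMeasure_le {t : ℝ} (ht : 0 < t) {n : ℕ} (hn : 0 < n) :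
    ∫⁻ u, (Icc (1 : ℝ) n).indicator (fun u => ENNReal.ofReal u⁻¹) u ∂(densityMeasure t 1) ≤
      ENNReal.ofReal (t⁻¹ * harmonicSum n) := by
  rw [lintegral_densityMeasure, ENNReal.ofReal_mul (by positivity)]
  refine mul_le_mul_right ?_ _
  rw [lintegral_indicator measurableSet_Icc, Measure.restrict_restrict measurableSet_Icc]
  have h1 : Icc (1 : ℝ) n ∩ Ioi 1 = Ioc 1 (n : ℝ) := by
    ext x; simp only [mem_inter_iff, mem_Icc, mem_Ioi, mem_Ioc]
    constructor
    · rintro ⟨⟨-, h2⟩, h3⟩; exact ⟨h3, h2⟩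
    · rintro ⟨h1, h2⟩; exact ⟨⟨h1.le, h2⟩, h1⟩
  rw [h1, lintegral_Ioc_inv one_pos (by exact_mod_cast hn), div_one]
  exact ENNReal.ofReal_le_ofReal (log_le_harmonicSum n)

lemma lintegral_swap_scaledStrip (hΦ : IsWeight Φ) (ρ σ : Measure ℝ) [SFinite ρ] [SFinite σ] :
    ∫⁻ u, ∫⁻ w, scaledStrip Φ β γ X u w ∂σ ∂ρ = ∫⁻ w, ∫⁻ u, scaledStrip Φ γ β X w u ∂ρ ∂σ := by
  rw [lintegral_lintegral_swap (measurable_scaledStrip hΦ).aemeasurable]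
  simp only [scaledStrip_symm hΦ]

/-- Summing over multiples of `t` against integrating over `u, w > 1`. -/
lemma lattice_scaledStrip_close (hΦ : IsWeight Φ) (hβ : 0 < β) (hγ : 0 < γ) {t n : ℕ} (ht : 0 < t)
    (hn : 0 < n) :
    ∫⁻ u, ∫⁻ w, scaledStrip Φ β γ n u w ∂(apMeasure t t) ∂(apMeasure t t) ≤
      ∫⁻ u, ∫⁻ w, scaledStrip Φ β γ n u w ∂(densityMeasure t 1) ∂(densityMeasure t 1) +
        ENNReal.ofReal (6 * n ^ 2 * (β + γ) * ((t : ℝ)⁻¹ * harmonicSum n)) ∧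
    ∫⁻ u, ∫⁻ w, scaledStrip Φ β γ n u w ∂(densityMeasure t 1) ∂(densityMeasure t 1) ≤
      ∫⁻ u, ∫⁻ w, scaledStrip Φ β γ n u w ∂(apMeasure t t) ∂(apMeasure t t) +
        ENNReal.ofReal (6 * n ^ 2 * (β + γ) * ((t : ℝ)⁻¹ * harmonicSum n)) := by
  have ht1 : (1 : ℝ) ≤ t := by exact_mod_cast ht
  have ht0 : (0 : ℝ) < t := by linarith
  have hclose : IntervalClose (apMeasure t t) (densityMeasure t 1) :=
    intervalClose_ap ht0 ht1 (by linarith)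
  have hμ := ae_one_le_apMeasure ht
  have hν := ae_one_le_densityMeasure t
  have hn0 : (0 : ℝ) ≤ n := by positivity
  have hh := zero_le_one.trans (one_le_harmonicSum n)
  have hsplit : ENNReal.ofReal (6 * n ^ 2 * (β + γ) * ((t : ℝ)⁻¹ * harmonicSum n)) =
      ENNReal.ofReal (6 * n ^ 2 * γ) * ENNReal.ofReal ((t : ℝ)⁻¹ * harmonicSum n) +
      ENNReal.ofReal (6 * n ^ 2 * β) * ENNReal.ofReal ((t : ℝ)⁻¹ * harmonicSum n) := by
    rw [← ENNReal.ofReal_mul (by positivity), ← ENNReal.ofReal_mul (by positivity),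
      ← ENNReal.ofReal_add (by positivity) (by positivity)]
    congr 1; ring
  have e1 := lintegral_inv_apMeasure_le ht n
  have e2 := lintegral_inv_densityMeasure_le ht0 hn
  have a1 := lintegral_scaledStrip_le hΦ hβ hγ hn0 hclose hμ hμ
  have a2 := lintegral_scaledStrip_le hΦ hβ hγ hn0 hclose.symm hμ hν
  have a3 := lintegral_scaledStrip_le hΦ hγ hβ hn0 hclose hν hμ
  have a4 := lintegral_scaledStrip_le hΦ hγ hβ hn0 hclose.symm hν hν
  have s1 := lintegral_swap_scaledStrip (β := β) (γ := γ) (X := n) hΦ (apMeasure t t)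
    (densityMeasure t 1)
  have s2 := lintegral_swap_scaledStrip (β := β) (γ := γ) (X := n) hΦ (densityMeasure t 1)
    (densityMeasure t 1)
  rw [← s1, ← s2] at a3
  rw [← s1, ← s2] at a4
  replace a1 := a1.trans (add_le_add_right (mul_le_mul_right e1 _) _)
  replace a2 := a2.trans (add_le_add_right (mul_le_mul_right e1 _) _)
  replace a3 := a3.trans (add_le_add_right (mul_le_mul_right e2 _) _)
  replace a4 := a4.trans (add_le_add_right (mul_le_mul_right e2 _) _)
  rw [hsplit]
  constructor
  · refine a1.trans ?_
    rw [add_comm (_ * _) (ENNReal.ofReal (6 * n ^ 2 * β) * _), ← add_assoc]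
    exact add_le_add_left a3 _
  · refine a4.trans ?_
    rw [← add_assoc]
    exact add_le_add_left a2 _

/-- The integral over all `u, w > 0`. -/
noncomputable def totalStrip (Φ : ℝ → ℝ → ℝ → ℝ → ℝ) (β γ X : ℝ) : ℝ≥0∞ :=
  ∫⁻ u in Ioi (0 : ℝ), ∫⁻ w in Ioi (0 : ℝ), scaledStrip Φ β γ X u w

/-- The part `u ≤ 1 < w`. -/
lemma lintegral_scaledStrip_edge_le (hΦ : IsWeight Φ) (hβ : 0 < β) (hγ : 0 < γ) {n : ℕ}
    (hn : 0 < n) :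
    ∫⁻ w in Ioi (1 : ℝ), ∫⁻ u in Ioc (0 : ℝ) 1, scaledStrip Φ β γ n u w ≤
      ENNReal.ofReal (3 * n ^ 2 * β * (2 * harmonicSum n)) := by
  have hn1 : (1 : ℝ) ≤ n := by exact_mod_cast hn
  have hn0 : (0 : ℝ) < n := by linarith
  have h1 : ∀ w ∈ Ioi (1 : ℝ), ∫⁻ u in Ioc (0 : ℝ) 1, scaledStrip Φ β γ n u w ≤
      ENNReal.ofReal (3 * n ^ 2 * β) * ((Ioc 1 (n : ℝ)).indicator (fun w => ENNReal.ofReal w⁻¹) w +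
        (Ioi (n : ℝ)).indicator (fun w => ENNReal.ofReal n * ENNReal.ofReal (w ^ 2)⁻¹) w) := by
    intro w hw
    have hw1 : 1 < w := hw
    have hw0 : 0 < w := by linarith
    have h2 : ∀ u ∈ Ioc (0 : ℝ) 1, scaledStrip Φ β γ n u w ≤
        (Ioc 0 (n / w)).indicator (fun _ => ENNReal.ofReal (3 * n ^ 2 * β * w⁻¹)) u := by
      intro u hu
      by_cases huw : u * w ≤ n
      · rw [indicator_of_mem (show u ∈ Ioc 0 (n / w) from ⟨hu.1, by rwa [le_div_iff₀ hw0]⟩)]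
        refine (scaledStrip_le hΦ hβ hγ hn0.le hu.1 hw0).trans (ENNReal.ofReal_le_ofReal ?_)
        rw [mul_assoc _ β]
        refine mul_le_mul_of_nonneg_left ?_ (by positivity)
        have := hu.1
        rw [div_le_iff₀ (by positivity), ← div_eq_mul_inv, div_mul_eq_mul_div, le_div_iff₀ hw0]
        nlinarith [mul_pos hβ (mul_pos hβ this)]
      · rw [scaledStrip_eq_zero hβ hγ (not_le.1 huw)]
        exact zero_le
    refine (setLIntegral_mono' measurableSet_Ioc h2).trans ?_
    rw [lintegral_indicator_const measurableSet_Ioc, Measure.restrict_apply measurableSet_Ioc,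
      ENNReal.ofReal_mul (by positivity), mul_assoc]
    refine mul_le_mul_right ?_ _
    by_cases hwn : w ≤ n
    · rw [indicator_of_mem (show w ∈ Ioc 1 (n : ℝ) from ⟨hw1, hwn⟩)]
      refine le_trans ?_ le_self_add
      calc _ ≤ ENNReal.ofReal w⁻¹ * volume (Ioc (0 : ℝ) 1) :=
            mul_le_mul_right (measure_mono inter_subset_right) _
        _ = _ := by simp
    · rw [indicator_of_mem (show w ∈ Ioi (n : ℝ) from not_le.1 hwn)]
      refine le_trans ?_ le_add_self
      calc _ ≤ ENNReal.ofReal w⁻¹ * volume (Ioc (0 : ℝ) (n / w)) :=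
            mul_le_mul_right (measure_mono inter_subset_left) _
        _ = _ := by
          rw [Real.volume_Ioc, ← ENNReal.ofReal_mul (by positivity),
            ← ENNReal.ofReal_mul (by positivity)]
          congr 1; field_simp; ring
  refine (setLIntegral_mono' measurableSet_Ioi h1).trans ?_
  have hm1 : Measurable ((Ioc 1 (n : ℝ)).indicator (fun w => ENNReal.ofReal w⁻¹)) :=
    Measurable.indicator (by fun_prop) measurableSet_Ioc
  have hm2 : Measurable ((Ioi (n : ℝ)).indicator
      (fun w => ENNReal.ofReal n * ENNReal.ofReal (w ^ 2)⁻¹)) :=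
    Measurable.indicator (by fun_prop) measurableSet_Ioi
  rw [lintegral_const_mul' _ _ ENNReal.ofReal_ne_top,
    ENNReal.ofReal_mul (p := 3 * n ^ 2 * β) (by positivity)]
  refine mul_le_mul_right ?_ _
  refine (setLIntegral_le_lintegral _ _).trans ?_
  rw [lintegral_add_left hm1, lintegral_indicator measurableSet_Ioc,
    lintegral_indicator measurableSet_Ioi, lintegral_const_mul _ (by fun_prop),
    lintegral_Ioi_inv_sq hn0, lintegral_Ioc_inv one_pos hn1, div_one,
    ← ENNReal.ofReal_mul hn0.le, mul_inv_cancel₀ hn0.ne',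
    ← ENNReal.ofReal_add (Real.log_nonneg hn1) zero_le_one]
  refine ENNReal.ofReal_le_ofReal ?_
  linarith [log_le_harmonicSum n, one_le_harmonicSum n]

lemma lintegral_Ioc_rpow_neg_half :
    ∫⁻ u in Ioc (0 : ℝ) 1, ENNReal.ofReal (√u)⁻¹ = 2 := by
  have h1 : ∀ u ∈ Ioc (0 : ℝ) 1, (√u)⁻¹ = u ^ (-(1 / 2) : ℝ) := by
    intro u hu
    rw [Real.rpow_neg hu.1.le, Real.sqrt_eq_rpow]
  rw [setLIntegral_congr_fun measurableSet_Ioc fun x hx => by rw [h1 x hx],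
    ← ofReal_integral_eq_lintegral_ofReal,
    ← intervalIntegral.integral_of_le zero_le_one, integral_rpow (Or.inl (by norm_num))]
  · norm_num
  · exact (intervalIntegrable_iff_integrableOn_Ioc_of_le zero_le_one).1
      (intervalIntegral.intervalIntegrable_rpow' (by norm_num))
  · exact ae_restrict_of_forall_mem measurableSet_Ioc fun u hu => Real.rpow_nonneg hu.1.le _

/-- The part `u, w ≤ 1`. -/
lemma lintegral_scaledStrip_corner_le (hΦ : IsWeight Φ) (hβ : 0 < β) (hγ : 0 < γ) (hX : 0 ≤ X) :
    ∫⁻ w in Ioc (0 : ℝ) 1, ∫⁻ u in Ioc (0 : ℝ) 1, scaledStrip Φ β γ X u w ≤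
      ENNReal.ofReal (3 * X ^ 2 * (β + γ)) := by
  have h : ∀ w ∈ Ioc (0 : ℝ) 1, ∫⁻ u in Ioc (0 : ℝ) 1, scaledStrip Φ β γ X u w ≤
      ∫⁻ u in Ioc (0 : ℝ) 1, ENNReal.ofReal (3 * X ^ 2 * ((β + γ) / 4)) *
        ENNReal.ofReal (√w)⁻¹ * ENNReal.ofReal (√u)⁻¹ := by
    intro w hw
    refine setLIntegral_mono' measurableSet_Ioc fun u hu => ?_
    refine (scaledStrip_le hΦ hβ hγ hX hu.1 hw.1).trans ?_
    have hu0 := hu.1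
    have hw0 := hw.1
    rw [← ENNReal.ofReal_mul (by positivity), ← ENNReal.ofReal_mul (by positivity)]
    refine ENNReal.ofReal_le_ofReal ?_
    rw [mul_assoc (3 * X ^ 2 * ((β + γ) / 4)), mul_assoc (3 * X ^ 2) ((β + γ) / 4)]
    refine mul_le_mul_of_nonneg_left ?_ (by positivity)
    have hs := Real.sqrt_pos.2 hu0
    have hr := Real.sqrt_pos.2 hw0
    have hs2 := Real.sq_sqrt hu0.le
    have hr2 := Real.sq_sqrt hw0.le
    set s := √u
    set r := √w
    rw [← hs2, ← hr2, ← mul_inv, ← div_eq_mul_inv, div_div, div_le_div_iff₀ (by positivity)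
      (by positivity)]
    nlinarith [mul_nonneg (mul_pos hβ hγ).le (sq_nonneg (s - r)), sq_nonneg (β * s - γ * r)]
  refine (setLIntegral_mono' measurableSet_Ioc h).trans ?_
  have h2 : ∀ w : ℝ, ∫⁻ u in Ioc (0 : ℝ) 1, ENNReal.ofReal (3 * X ^ 2 * ((β + γ) / 4)) *
        ENNReal.ofReal (√w)⁻¹ * ENNReal.ofReal (√u)⁻¹ =
      ENNReal.ofReal (3 * X ^ 2 * ((β + γ) / 4)) * 2 * ENNReal.ofReal (√w)⁻¹ := by
    intro w
    rw [lintegral_const_mul _ (by fun_prop), lintegral_Ioc_rpow_neg_half, mul_right_comm]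
  simp only [h2]
  rw [lintegral_const_mul _ (by fun_prop), lintegral_Ioc_rpow_neg_half, mul_assoc,
    show (2 : ℝ≥0∞) * 2 = ENNReal.ofReal 4 by norm_num, ← ENNReal.ofReal_mul (by positivity)]
  exact ENNReal.ofReal_le_ofReal (le_of_eq (by ring))

/-- The part of the integral over `u, w > 0` in which `u` or `w` is at most `1` is negligible. -/
lemma totalStrip_le (hΦ : IsWeight Φ) (hβ : 0 < β) (hγ : 0 < γ) {n : ℕ} (hn : 0 < n) :
    totalStrip Φ β γ n ≤ (∫⁻ u in Ioi (1 : ℝ), ∫⁻ w in Ioi (1 : ℝ), scaledStrip Φ β γ n u w) +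
      ENNReal.ofReal (9 * n ^ 2 * (β + γ) * harmonicSum n) := by
  have hI : Ioi (0 : ℝ) = Ioc 0 1 ∪ Ioi 1 := (Ioc_union_Ioi_eq_Ioi zero_le_one).symm
  have hd : Disjoint (Ioc (0 : ℝ) 1) (Ioi 1) := Ioc_disjoint_Ioi le_rfl
  have hsplit : ∀ f : ℝ → ℝ≥0∞, ∫⁻ x in Ioi (0 : ℝ), f x =
      (∫⁻ x in Ioc (0 : ℝ) 1, f x) + ∫⁻ x in Ioi (1 : ℝ), f x := by
    intro f
    rw [hI, lintegral_union measurableSet_Ioi hd]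
  have hm : ∀ s : Set ℝ, Measurable fun u => ∫⁻ w in s, scaledStrip Φ β γ n u w :=
    fun s => (measurable_scaledStrip hΦ).lintegral_prod_right'
  have hn0 : (0 : ℝ) ≤ n := by positivity
  have hh := one_le_harmonicSum n
  unfold totalStrip
  rw [hsplit]
  simp only [hsplit fun w => scaledStrip Φ β γ n _ w]
  rw [lintegral_add_left (hm _), lintegral_add_left (hm _)]
  have i1 := lintegral_scaledStrip_corner_le hΦ hγ hβ hn0 (X := n)
  have i2 := lintegral_scaledStrip_edge_le hΦ hβ hγ hn
  have i3 := lintegral_scaledStrip_edge_le hΦ hγ hβ hn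
  simp only [scaledStrip_symm hΦ] at i1 i3
  have s1 := lintegral_lintegral_swap (μ := volume.restrict (Ioc (0 : ℝ) 1))
    (ν := volume.restrict (Ioi (1 : ℝ))) (f := fun u w => scaledStrip Φ β γ n u w)
    (measurable_scaledStrip hΦ).aemeasurable
  rw [s1]
  have hsum : ENNReal.ofReal (9 * n ^ 2 * (β + γ) * harmonicSum n) ≥
      ENNReal.ofReal (3 * n ^ 2 * (γ + β)) + ENNReal.ofReal (3 * n ^ 2 * β * (2 * harmonicSum n)) +
        ENNReal.ofReal (3 * n ^ 2 * γ * (2 * harmonicSum n)) := by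
    rw [← ENNReal.ofReal_add (by positivity) (by positivity),
      ← ENNReal.ofReal_add (by positivity) (by positivity)]
    refine ENNReal.ofReal_le_ofReal ?_
    have := mul_le_mul_of_nonneg_left hh (by positivity : 0 ≤ 3 * (n : ℝ) ^ 2 * (γ + β))
    nlinarith
  refine le_trans ?_ (add_le_add_right hsum _)
  calc _ ≤ ENNReal.ofReal (3 * n ^ 2 * (γ + β)) +
          ENNReal.ofReal (3 * n ^ 2 * β * (2 * harmonicSum n)) +
          (ENNReal.ofReal (3 * n ^ 2 * γ * (2 * harmonicSum n)) +
            ∫⁻ u in Ioi (1 : ℝ), ∫⁻ w in Ioi (1 : ℝ), scaledStrip Φ β γ n u w) := by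
        gcongr
    _ = _ := by ring

lemma tsum_multiples {t : ℕ} (ht : 0 < t) (n : ℕ) (f : ℕ → ℝ≥0∞) (hf : ∀ u, n < u → f u = 0) :
    ∑' m : ℕ, f (t + t * m) = ∑ u ∈ Finset.Icc 1 n, if t ∣ u then f u else 0 := by
  rw [tsum_eq_sum (s := Finset.range (n / t)), ← Finset.sum_filter]
  · refine Finset.sum_nbij' (fun m => t + t * m) (fun u => u / t - 1) ?_ ?_ ?_ ?_ ?_
    · intro m hm
      rw [Finset.mem_range] at hm
      rw [Finset.mem_filter, Finset.mem_Icc]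
      have h1 : (m + 1) * t ≤ n := (Nat.le_div_iff_mul_le ht).1 hm
      refine ⟨⟨by omega, le_trans (le_of_eq (by ring)) h1⟩, Dvd.intro (m + 1) (by ring)⟩
    · intro u hu
      rw [Finset.mem_filter, Finset.mem_Icc] at hu
      obtain ⟨⟨h1, h2⟩, v, rfl⟩ := hu
      rw [Nat.mul_div_cancel_left v ht, Finset.mem_range]
      have hv : 0 < v := Nat.pos_of_mul_pos_left h1
      have : v ≤ n / t := (Nat.le_div_iff_mul_le ht).2 (by rwa [mul_comm])
      omega
    · intro m _
      rw [show t + t * m = t * (m + 1) by ring, Nat.mul_div_cancel_left _ ht, Nat.add_sub_cancel]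
    · intro u hu
      rw [Finset.mem_filter, Finset.mem_Icc] at hu
      obtain ⟨⟨h1, h2⟩, v, rfl⟩ := hu
      have hv : 0 < v := Nat.pos_of_mul_pos_left h1
      rw [Nat.mul_div_cancel_left v ht]
      obtain ⟨v', rfl⟩ : ∃ v', v = v' + 1 := ⟨v - 1, by omega⟩
      rw [Nat.add_sub_cancel]; ring
    · intro m _; rfl
  · intro m hm
    apply hf
    rw [Finset.mem_range, not_lt] at hm
    have := (Nat.div_lt_iff_lt_mul ht).1 (Nat.lt_succ_of_le hm)
    calc n < (m + 1) * t := this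
      _ = _ := by ring

/-- Summing over multiples of `t` against integrating over `u, w > 0`. -/
lemma sum_cellIntegral_close (hΦ : IsWeight Φ) (hβ : 0 < β) (hγ : 0 < γ) {t n : ℕ} (ht : 0 < t)
    (hn : 0 < n) :
    |∑ u ∈ Finset.Icc 1 n, ∑ w ∈ Finset.Icc 1 n,
        (if t ∣ u ∧ t ∣ w then (cellIntegral Φ β γ n u w).toReal else 0) -
      ((t : ℝ) ^ 2)⁻¹ * (totalStrip Φ β γ n).toReal| ≤
      15 * n ^ 2 * (β + γ) * harmonicSum n / t := by
  have ht1 : (1 : ℝ) ≤ t := by exact_mod_cast ht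
  have hh := one_le_harmonicSum n
  have hfin : ∀ u w : ℕ, 0 < u → 0 < w → scaledStrip Φ β γ n u w ≠ ⊤ ∧
      cellIntegral Φ β γ n u w = scaledStrip Φ β γ n u w := by
    intro u w hu hw
    have e := cellIntegral_eq hΦ hβ hγ (u := u) (w := w) (by exact_mod_cast hu)
      (by exact_mod_cast hw) n
    exact ⟨ne_top_of_le_ne_top ENNReal.ofReal_ne_top (scaledStrip_le hΦ hβ hγ (by positivity)
      (by exact_mod_cast hu) (by exact_mod_cast hw)), e⟩
  have hsum : ∫⁻ u, ∫⁻ w, scaledStrip Φ β γ n u w ∂(apMeasure t t) ∂(apMeasure t t) =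
      ENNReal.ofReal (∑ u ∈ Finset.Icc 1 n, ∑ w ∈ Finset.Icc 1 n,
        (if t ∣ u ∧ t ∣ w then (cellIntegral Φ β γ n u w).toReal else 0)) := by
    have hzero : ∀ u w : ℕ, 0 < u → n < w → scaledStrip Φ β γ n u w = 0 := by
      intro u w hu hw
      refine scaledStrip_eq_zero hβ hγ ?_
      have : n < u * w := hw.trans_le (Nat.le_mul_of_pos_left w hu)
      exact_mod_cast this
    have hzero' : ∀ u w : ℕ, n < u → 0 < w → scaledStrip Φ β γ n u w = 0 := by
      intro u w hu hw
      refine scaledStrip_eq_zero hβ hγ ?_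
      have : n < u * w := hu.trans_le (Nat.le_mul_of_pos_right u hw)
      exact_mod_cast this
    rw [lintegral_apMeasure]
    simp only [lintegral_apMeasure]
    have e1 : ∀ u : ℕ, 0 < u → ∑' m : ℕ, scaledStrip Φ β γ n u ((t : ℝ) + t * m) =
        ∑ w ∈ Finset.Icc 1 n, if t ∣ w then scaledStrip Φ β γ n u w else 0 := by
      intro u hu
      have := tsum_multiples ht n (fun w : ℕ => scaledStrip Φ β γ n u w)
        (fun w hw => hzero u w hu hw)
      push_cast at this
      exact this
    have e2 := tsum_multiples ht n (fun u : ℕ => ∑' m : ℕ, scaledStrip Φ β γ n u ((t : ℝ) + t * m))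
      (fun u hu => by
        rw [ENNReal.tsum_eq_zero]
        intro m
        have := hzero' u (t + t * m) hu (by omega)
        push_cast at this
        exact this)
    push_cast at e2
    rw [e2, ENNReal.ofReal_sum_of_nonneg fun u _ => Finset.sum_nonneg fun w _ => by
      split_ifs; exacts [ENNReal.toReal_nonneg, le_rfl]]
    refine Finset.sum_congr rfl fun u hu => ?_
    have hu1 := (Finset.mem_Icc.1 hu).1
    rw [ENNReal.ofReal_sum_of_nonneg fun w _ => by
      split_ifs; exacts [ENNReal.toReal_nonneg, le_rfl], e1 u hu1]
    by_cases htu : t ∣ u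
    · rw [if_pos htu]
      refine Finset.sum_congr rfl fun w hw => ?_
      obtain ⟨f1, f2⟩ := hfin u w hu1 (Finset.mem_Icc.1 hw).1
      by_cases htw : t ∣ w
      · rw [if_pos htw, if_pos ⟨htu, htw⟩, f2, ENNReal.ofReal_toReal f1]
      · rw [if_neg htw, if_neg (fun h => htw h.2), ENNReal.ofReal_zero]
    · simp [htu]
  obtain ⟨h1, h2⟩ := lattice_scaledStrip_close hΦ hβ hγ ht hn
  rw [hsum] at h1 h2
  simp only [lintegral_densityMeasure] at h1 h2
  rw [lintegral_const_mul' _ _ ENNReal.ofReal_ne_top, ← mul_assoc,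
    ← ENNReal.ofReal_mul (by positivity), ← mul_inv, ← pow_two] at h1 h2
  have h3 : ∫⁻ u in Ioi (1 : ℝ), ∫⁻ w in Ioi (1 : ℝ), scaledStrip Φ β γ n u w ≤
      totalStrip Φ β γ n :=
    (lintegral_mono_set (Ioi_subset_Ioi zero_le_one)).trans
      (lintegral_mono fun u => lintegral_mono_set (Ioi_subset_Ioi zero_le_one))
  have h4 := totalStrip_le hΦ hβ hγ hn
  refine (abs_sub_le_of_ennreal (H := totalStrip Φ β γ n) (Finset.sum_nonneg fun u _ => Finset.sum_nonneg fun w _ => by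
    split_ifs; exacts [ENNReal.toReal_nonneg, le_rfl]) (by positivity) (by positivity) ?_ ?_).2
  · refine h1.trans (add_le_add (mul_le_mul_right h3 _) (ENNReal.ofReal_le_ofReal ?_))
    rw [mul_div_assoc, div_eq_inv_mul]
    refine mul_le_mul_of_nonneg_right ?_ (by positivity)
    nlinarith [mul_nonneg (sq_nonneg (n : ℝ)) (add_pos hβ hγ).le]
  · refine (mul_le_mul_right h4 _).trans ?_
    rw [mul_add]
    refine (add_le_add_left h2 _).trans ?_
    rw [add_assoc, ← ENNReal.ofReal_mul (by positivity), ← ENNReal.ofReal_add (by positivity)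
      (by positivity)]
    refine add_le_add_right (ENNReal.ofReal_le_ofReal ?_) _
    have h5 : ((t : ℝ) ^ 2)⁻¹ ≤ (t : ℝ)⁻¹ := inv_anti₀ (by positivity) (by nlinarith)
    have h6 := mul_le_mul_of_nonneg_right h5
      (by positivity : 0 ≤ 9 * n ^ 2 * (β + γ) * harmonicSum n)
    rw [div_eq_inv_mul]
    linarith

end ScaledStrip

/-! ### Explicit integrals and polar coordinates -/

lemma lintegral_Ioi_rpow {a c : ℝ} (ha : a < -1) (hc : 0 < c) :
    ∫⁻ x in Ioi c, ENNReal.ofReal (x ^ a) = ENNReal.ofReal (-c ^ (a + 1) / (a + 1)) := by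
  rw [← integral_Ioi_rpow_of_lt ha hc, ofReal_integral_eq_lintegral_ofReal
    (integrableOn_Ioi_rpow_of_lt ha hc)]
  exact ae_restrict_of_forall_mem measurableSet_Ioi fun x hx => Real.rpow_nonneg (hc.trans hx).le _

lemma lintegral_Ioo_rpow {a b c : ℝ} (ha : a ≠ -1) (hb : 0 < b) (hbc : b ≤ c) :
    ∫⁻ x in Ioo b c, ENNReal.ofReal (x ^ a) =
      ENNReal.ofReal ((c ^ (a + 1) - b ^ (a + 1)) / (a + 1)) := by
  have h0 : (0 : ℝ) ∉ uIcc b c := by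
    rw [uIcc_of_le hbc]; exact fun h => absurd h.1 (not_le.2 hb)
  rw [← integral_rpow (Or.inr ⟨ha, h0⟩), intervalIntegral.integral_of_le hbc,
    integral_Ioc_eq_integral_Ioo, ofReal_integral_eq_lintegral_ofReal]
  · exact ((intervalIntegrable_iff_integrableOn_Ioo_of_le hbc).1
      (intervalIntegral.intervalIntegrable_rpow (Or.inr h0)))
  · exact ae_restrict_of_forall_mem measurableSet_Ioo fun x hx =>
      Real.rpow_nonneg (hb.trans hx.1).le _

lemma lintegral_Ioo_inv {a b : ℝ} (ha : 0 < a) (hab : a ≤ b) :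
    ∫⁻ u in Ioo a b, ENNReal.ofReal u⁻¹ = ENNReal.ofReal (Real.log (b / a)) := by
  rw [← lintegral_Ioc_inv ha hab, setLIntegral_congr Ioo_ae_eq_Ioc]

lemma tsum_ofReal_inv_sq :
    ∑' n : ℕ, ENNReal.ofReal (1 / ((n : ℝ) + 1) ^ 2) = ENNReal.ofReal (Real.pi ^ 2 / 6) := by
  have h := hasSum_zeta_two
  have h1 := (hasSum_nat_add_iff' 1).2 h
  simp only [Finset.range_one, Finset.sum_singleton, Nat.cast_zero, ne_eq, OfNat.ofNat_ne_zero,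
    not_false_eq_true, zero_pow, div_zero, sub_zero, Nat.cast_add, Nat.cast_one] at h1
  rw [← h1.tsum_eq, ENNReal.ofReal_tsum_of_nonneg (fun n => by positivity) h1.summable]

/-- The integral of `1 / (τ q)` over the triangle `τ + q > 1` in the unit square. The inner integral
is `-log(1 - q) / q`, whose power series integrates to `∑ 1 / n²`. -/
lemma lintegral_triangle_inv :
    ∫⁻ q in Ioo (0 : ℝ) 1, ∫⁻ τ in Ioo (1 - q) 1, ENNReal.ofReal (q⁻¹ * τ⁻¹) =
      ENNReal.ofReal (Real.pi ^ 2 / 6) := by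
  have h1 : ∀ q ∈ Ioo (0 : ℝ) 1, ∫⁻ τ in Ioo (1 - q) 1, ENNReal.ofReal (q⁻¹ * τ⁻¹) =
      ∑' n : ℕ, ENNReal.ofReal (q ^ n / (n + 1)) := by
    intro q hq
    have hq0 := hq.1
    have hq1 : 0 < 1 - q := by linarith [hq.2]
    have hs := Real.hasSum_pow_div_log_of_abs_lt_one (x := q) (by
      rw [abs_of_pos hq0]; exact hq.2)
    have hs2 := hs.mul_left q⁻¹
    have e : ∀ n : ℕ, q⁻¹ * (q ^ (n + 1) / (n + 1)) = q ^ n / (n + 1) := by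
      intro n; field_simp; ring
    simp only [e] at hs2
    simp only [ENNReal.ofReal_mul (inv_pos.2 hq0).le]
    rw [lintegral_const_mul' _ _ ENNReal.ofReal_ne_top, lintegral_Ioo_inv hq1 (by linarith),
      ← ENNReal.ofReal_mul (by positivity), one_div, Real.log_inv, ← hs2.tsum_eq,
      ENNReal.ofReal_tsum_of_nonneg (fun n => by positivity) hs2.summable]
  rw [setLIntegral_congr_fun measurableSet_Ioo h1, lintegral_tsum (fun n => by fun_prop),
    ← tsum_ofReal_inv_sq]
  refine tsum_congr fun n => ?_
  have h2 : ∀ q ∈ Ioc (0 : ℝ) 1, 0 ≤ q ^ n / ((n : ℝ) + 1) := by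
    intro q hq
    have := hq.1
    positivity
  rw [setLIntegral_congr Ioo_ae_eq_Ioc, ← ofReal_integral_eq_lintegral_ofReal,
    ← intervalIntegral.integral_of_le zero_le_one, intervalIntegral.integral_div, integral_pow]
  · congr 1
    field_simp
    simp
  · exact (intervalIntegrable_iff_integrableOn_Ioc_of_le zero_le_one).1
      (Continuous.intervalIntegrable (by fun_prop) _ _)
  · exact ae_restrict_of_forall_mem measurableSet_Ioc h2

/-- `B(3/2, 1/2) = π / 2`. -/
lemma lintegral_beta :
    ∫⁻ τ in Ioo (0 : ℝ) 1, ENNReal.ofReal (τ ^ (1 / 2 : ℝ) * (1 - τ) ^ (-1 / 2 : ℝ)) =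
      ENNReal.ofReal (Real.pi / 2) := by
  have hb : ProbabilityTheory.beta (3 / 2) (1 / 2) = Real.pi / 2 := by
    rw [ProbabilityTheory.beta, show (3 / 2 : ℝ) + 1 / 2 = 1 + 1 by norm_num,
      Real.Gamma_add_one one_ne_zero, Real.Gamma_one, show (3 / 2 : ℝ) = 1 / 2 + 1 by norm_num,
      Real.Gamma_add_one (by norm_num), Real.Gamma_one_half_eq]
    have := Real.mul_self_sqrt Real.pi_pos.le
    linarith
  have h := ProbabilityTheory.lintegral_betaPDF_eq_one (α := 3 / 2) (β := 1 / 2) (by norm_num)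
    (by norm_num)
  rw [ProbabilityTheory.lintegral_betaPDF, hb] at h
  have hpi := Real.pi_pos
  have e : ∀ τ ∈ Ioo (0 : ℝ) 1, ENNReal.ofReal (1 / (Real.pi / 2) * τ ^ (3 / 2 - 1 : ℝ) *
      (1 - τ) ^ (1 / 2 - 1 : ℝ)) = ENNReal.ofReal (1 / (Real.pi / 2)) *
        ENNReal.ofReal (τ ^ (1 / 2 : ℝ) * (1 - τ) ^ (-1 / 2 : ℝ)) := by
    intro τ _
    rw [← ENNReal.ofReal_mul (by positivity), mul_assoc]
    norm_num
  rw [setLIntegral_congr_fun measurableSet_Ioo e,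
    lintegral_const_mul' _ _ ENNReal.ofReal_ne_top] at h
  calc _ = ENNReal.ofReal (Real.pi / 2) * (ENNReal.ofReal (1 / (Real.pi / 2)) *
        ∫⁻ τ in Ioo (0 : ℝ) 1, ENNReal.ofReal (τ ^ (1 / 2 : ℝ) * (1 - τ) ^ (-1 / 2 : ℝ))) := by
        rw [← mul_assoc, ← ENNReal.ofReal_mul (by positivity), mul_one_div_cancel (by positivity),
          ENNReal.ofReal_one, one_mul]
    _ = _ := by rw [h, mul_one]

/-- The inner integral is `2 τ ^ (1 / 2) (1 - τ) ^ (-1 / 2)`. -/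
lemma lintegral_triangle_rpow :
    ∫⁻ τ in Ioo (0 : ℝ) 1, ∫⁻ q in Ioo (1 - τ) 1,
      ENNReal.ofReal (τ ^ (-1 / 2 : ℝ) * (q ^ (-3 / 2 : ℝ) + q ^ (-1 / 2 : ℝ))) =
      ENNReal.ofReal Real.pi := by
  have h1 : ∀ τ ∈ Ioo (0 : ℝ) 1, ∫⁻ q in Ioo (1 - τ) 1,
      ENNReal.ofReal (τ ^ (-1 / 2 : ℝ) * (q ^ (-3 / 2 : ℝ) + q ^ (-1 / 2 : ℝ))) =
      ENNReal.ofReal 2 * ENNReal.ofReal (τ ^ (1 / 2 : ℝ) * (1 - τ) ^ (-1 / 2 : ℝ)) := by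
    intro τ hτ
    have hτ0 := hτ.1
    have hτ1 : 0 < 1 - τ := by linarith [hτ.2]
    have e1 : ∀ q ∈ Ioo (1 - τ) 1,
        ENNReal.ofReal (τ ^ (-1 / 2 : ℝ) * (q ^ (-3 / 2 : ℝ) + q ^ (-1 / 2 : ℝ))) =
        ENNReal.ofReal (τ ^ (-1 / 2 : ℝ)) * (ENNReal.ofReal (q ^ (-3 / 2 : ℝ)) +
          ENNReal.ofReal (q ^ (-1 / 2 : ℝ))) := by
      intro q hq
      have hq0 : 0 < q := hτ1.trans hq.1
      rw [ENNReal.ofReal_mul (by positivity), ENNReal.ofReal_add (by positivity) (by positivity)]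
    rw [setLIntegral_congr_fun measurableSet_Ioo e1, lintegral_const_mul' _ _ ENNReal.ofReal_ne_top,
      lintegral_add_left (by fun_prop), lintegral_Ioo_rpow (by norm_num) hτ1 (by linarith),
      lintegral_Ioo_rpow (by norm_num) hτ1 (by linarith)]
    have e2 : (1 - τ) ^ (-3 / 2 + 1 : ℝ) = (1 - τ) ^ (-1 / 2 : ℝ) := by norm_num
    have e3 : (1 - τ) ^ (-1 / 2 + 1 : ℝ) = (1 - τ) * (1 - τ) ^ (-1 / 2 : ℝ) := by
      rw [Real.rpow_add hτ1, Real.rpow_one, mul_comm]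
    have e4 : τ ^ (1 / 2 : ℝ) = τ ^ (-1 / 2 : ℝ) * τ := by
      rw [← Real.rpow_add_one hτ0.ne']; norm_num
    have h1 : 1 ≤ (1 - τ) ^ (-1 / 2 : ℝ) :=
      Real.one_le_rpow_of_pos_of_le_one_of_nonpos hτ1 (by linarith) (by norm_num)
    have h2 : (1 - τ) * (1 - τ) ^ (-1 / 2 : ℝ) ≤ 1 := by
      rw [← e3]; exact Real.rpow_le_one hτ1.le (by linarith) (by norm_num)
    rw [Real.one_rpow, Real.one_rpow, e2, e3, e4]
    set x := (1 - τ) ^ (-1 / 2 : ℝ)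
    have hp : 0 ≤ τ ^ (-1 / 2 : ℝ) := by positivity
    rw [← ENNReal.ofReal_add (div_nonneg_of_nonpos (by linarith) (by norm_num))
      (div_nonneg (by linarith) (by norm_num)), ← ENNReal.ofReal_mul hp,
      ← ENNReal.ofReal_mul (by norm_num)]
    congr 1
    ring
  rw [setLIntegral_congr_fun measurableSet_Ioo h1, lintegral_const_mul' _ _ ENNReal.ofReal_ne_top,
    lintegral_beta, ← ENNReal.ofReal_mul (by norm_num)]
  congr 1
  ring

/-- The weight on the line `U + W = 1`, in the coordinates `U = s`, `Y = μ - τ (1 - s)`,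
`Z = μ - (1 - τ) s`. -/
noncomputable def unitTerm (Φ : ℝ → ℝ → ℝ → ℝ → ℝ) (s μ τ : ℝ) : ℝ :=
  if 0 ≤ s ∧ s ≤ 1 ∧ 0 ≤ τ ∧ τ ≤ 1 ∧ 0 < μ ∧ τ * (1 - s) ≤ μ ∧ (1 - τ) * s ≤ μ then
    Φ s (1 - s) (μ - τ * (1 - s)) (μ - (1 - τ) * s) else 0

section UnitTerm

variable {Φ : ℝ → ℝ → ℝ → ℝ → ℝ}

lemma measurable_unitTerm (hΦ : IsWeight Φ) :
    Measurable fun p : ℝ × ℝ × ℝ => unitTerm Φ p.1 p.2.1 p.2.2 := by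
  unfold unitTerm
  refine Measurable.ite ?_ ?_ measurable_const
  · exact (measurableSet_le (f := fun p : ℝ × ℝ × ℝ => 0)
      (g := fun p => p.1) (by fun_prop) (by fun_prop)).inter
      ((measurableSet_le (f := fun p : ℝ × ℝ × ℝ => p.1)
      (g := fun p => 1) (by fun_prop) (by fun_prop)).inter
      ((measurableSet_le (f := fun p : ℝ × ℝ × ℝ => 0)
      (g := fun p => p.2.2) (by fun_prop) (by fun_prop)).inter
      ((measurableSet_le (f := fun p : ℝ × ℝ × ℝ => p.2.2)
      (g := fun p => 1) (by fun_prop) (by fun_prop)).inter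
      ((measurableSet_lt (f := fun p : ℝ × ℝ × ℝ => 0)
      (g := fun p => p.2.1) (by fun_prop) (by fun_prop)).inter
      ((measurableSet_le (f := fun p : ℝ × ℝ × ℝ => p.2.2 * (1 - p.1))
      (g := fun p => p.2.1) (by fun_prop) (by fun_prop)).inter
      (measurableSet_le (f := fun p : ℝ × ℝ × ℝ => (1 - p.2.2) * p.1)
      (g := fun p => p.2.1) (by fun_prop) (by fun_prop)))))))
  · exact (hΦ.cont.comp (by fun_prop : Continuous fun p : ℝ × ℝ × ℝ => (p.1, 1 - p.1,
        p.2.1 - p.2.2 * (1 - p.1), p.2.1 - (1 - p.2.2) * p.1))).measurable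

lemma measurable_ofReal_unitTerm (hΦ : IsWeight Φ) {α : Type*} [MeasurableSpace α]
    {f g h : α → ℝ} (hf : Measurable f) (hg : Measurable g) (hh : Measurable h) :
    Measurable fun x => ENNReal.ofReal (unitTerm Φ (f x) (g x) (h x)) :=
  ((measurable_unitTerm hΦ).comp (hf.prodMk (hg.prodMk hh))).ennreal_ofReal

/-- On the line `U + W = l`, `stripTerm` is a multiple of `unitTerm`. -/
lemma stripTerm_scale (hΦ : IsWeight Φ) {N l : ℝ} (hl : 0 < l) (s μ τ : ℝ) :
    stripTerm Φ N (l * s) (l - l * s) (l * μ) τ =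
      if l ^ 2 * μ ≤ N then l ^ 2 * unitTerm Φ s μ τ else 0 := by
  have e0 : l - l * s = l * (1 - s) := by ring
  unfold stripTerm unitTerm
  rw [mul_ite, mul_zero, ← ite_and, e0]
  have e1 : (l * s + l * (1 - s)) * Φ (l * s) (l * (1 - s)) (l * μ - τ * (l * (1 - s)))
      (l * μ - (1 - τ) * (l * s)) =
      l ^ 2 * Φ s (1 - s) (μ - τ * (1 - s)) (μ - (1 - τ) * s) := by
    have e2 : l * μ - τ * (l * (1 - s)) = l * (μ - τ * (1 - s)) := by ring
    have e3 : l * μ - (1 - τ) * (l * s) = l * (μ - (1 - τ) * s) := by ring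
    rw [e2, e3, hΦ.hom hl.le]; ring
  rw [e1]
  refine if_congr ?_ rfl rfl
  have f1 : 0 ≤ l * s ↔ 0 ≤ s := mul_nonneg_iff_of_pos_left hl
  have f2 : 0 ≤ l * (1 - s) ↔ s ≤ 1 := by rw [mul_nonneg_iff_of_pos_left hl, sub_nonneg]
  have f3 : 0 < l * μ ↔ 0 < μ := mul_pos_iff_of_pos_left hl
  have f4 : τ * (l * (1 - s)) ≤ l * μ ↔ τ * (1 - s) ≤ μ := by
    rw [mul_left_comm]; exact mul_le_mul_iff_of_pos_left hl
  have f5 : (1 - τ) * (l * s) ≤ l * μ ↔ (1 - τ) * s ≤ μ := by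
    rw [mul_left_comm]; exact mul_le_mul_iff_of_pos_left hl
  have f6 : (l * s + l * (1 - s)) * (l * μ) = l ^ 2 * μ := by ring
  rw [f1, f2, f3, f4, f5, f6]
  tauto

lemma setLIntegral_Ioi_eq {f : ℝ → ℝ≥0∞} (hf : ∀ x, f x ≠ 0 → 0 ≤ x) :
    ∫⁻ x in Ioi (0 : ℝ), f x = ∫⁻ x, f x := by
  rw [setLIntegral_congr Ioi_ae_eq_Ici]
  refine setLIntegral_eq_of_forall_notMem measurableSet_Ici fun x hx => ?_
  by_contra hcon
  exact hx (hf x hcon)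

lemma stripIntegral_ne_zero {N U W : ℝ} (h : stripIntegral Φ N U W ≠ 0) : 0 ≤ U ∧ 0 ≤ W := by
  by_contra hcon
  refine h ?_
  have : ∀ η τ, stripTerm Φ N U W η τ = 0 := fun η τ => by
    rw [stripTerm, if_neg fun h => hcon ⟨h.1, h.2.1⟩]
  simp [stripIntegral, this]

lemma measurable_stripIntegral (hΦ : IsWeight Φ) {N : ℝ} {α : Type*} [MeasurableSpace α]
    {f g : α → ℝ} (hf : Measurable f) (hg : Measurable g) :
    Measurable fun x => stripIntegral Φ N (f x) (g x) := by
  unfold stripIntegral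
  have h1 : Measurable fun p : (α × ℝ) × ℝ =>
      ENNReal.ofReal (stripTerm Φ N (f p.1.1) (g p.1.1) p.1.2 p.2) :=
    measurable_ofReal_stripTerm hΦ (hf.comp (by fun_prop)) (hg.comp (by fun_prop)) (by fun_prop)
      (by fun_prop)
  exact h1.lintegral_prod_right'.lintegral_prod_right'

lemma lintegral_pow_four {N μ : ℝ} (hN : 0 ≤ N) (hμ : 0 < μ) :
    ∫⁻ l in Ioi (0 : ℝ), (if l ^ 2 * μ ≤ N then ENNReal.ofReal (l ^ 4) else 0) =
      ENNReal.ofReal (N ^ (5 / 2 : ℝ) / 5) * ENNReal.ofReal (μ ^ (-5 / 2 : ℝ)) := by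
  have h0 : 0 ≤ √(N / μ) := Real.sqrt_nonneg _
  have h1 : ∀ l ∈ Ioi (0 : ℝ), (if l ^ 2 * μ ≤ N then ENNReal.ofReal (l ^ 4) else 0) =
      (Ioc 0 √(N / μ)).indicator (fun l => ENNReal.ofReal (l ^ 4)) l := by
    intro l hl
    have hl0 : 0 ≤ l := le_of_lt hl
    have h2 : l ^ 2 * μ ≤ N ↔ l ∈ Ioc 0 √(N / μ) := by
      rw [← le_div_iff₀ hμ, mem_Ioc, Real.le_sqrt hl0 (by positivity)]
      exact ⟨fun h => ⟨hl, h⟩, fun h => h.2⟩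
    by_cases h3 : l ^ 2 * μ ≤ N
    · rw [if_pos h3, indicator_of_mem (h2.1 h3)]
    · rw [if_neg h3, indicator_of_notMem (fun h => h3 (h2.2 h))]
  rw [setLIntegral_congr_fun measurableSet_Ioi h1, lintegral_indicator measurableSet_Ioc,
    Measure.restrict_restrict measurableSet_Ioc,
    inter_eq_left.2 (Ioc_subset_Ioi_self : Ioc 0 √(N / μ) ⊆ Ioi 0),
    ← ofReal_integral_eq_lintegral_ofReal, ← intervalIntegral.integral_of_le h0, integral_pow,
    ← ENNReal.ofReal_mul (by positivity)]
  · congr 1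
    have h2 : √(N / μ) ^ 5 = N ^ (5 / 2 : ℝ) * μ ^ (-5 / 2 : ℝ) := by
      rw [Real.sqrt_eq_rpow, ← Real.rpow_natCast, ← Real.rpow_mul (by positivity),
        Real.div_rpow hN hμ.le, neg_div, Real.rpow_neg hμ.le, ← div_eq_mul_inv]
      norm_num
    norm_num
    rw [h2]
    norm_num
    ring
  · exact (intervalIntegrable_iff_integrableOn_Ioc_of_le h0).1
      (Continuous.intervalIntegrable (by fun_prop) _ _)
  · exact ae_restrict_of_forall_mem measurableSet_Ioc fun l hl => pow_nonneg hl.1.le _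

/-- The integral of `stripIntegral` over `U, W > 0`, in polar coordinates `U + W = l`,
`U = l s`. -/
lemma lintegral_stripIntegral_polar (hΦ : IsWeight Φ) {N : ℝ} (hN : 0 ≤ N) :
    ∫⁻ U in Ioi (0 : ℝ), ∫⁻ W in Ioi (0 : ℝ), stripIntegral Φ N U W =
      ENNReal.ofReal (N ^ (5 / 2 : ℝ) / 5) * ∫⁻ s, ∫⁻ τ, ∫⁻ μ in Ioi (0 : ℝ),
        ENNReal.ofReal (μ ^ (-5 / 2 : ℝ)) * ENNReal.ofReal (unitTerm Φ s μ τ) := by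
  have e1 : ∫⁻ U in Ioi (0 : ℝ), ∫⁻ W in Ioi (0 : ℝ), stripIntegral Φ N U W =
      ∫⁻ U, ∫⁻ l, stripIntegral Φ N U (l - U) := by
    rw [setLIntegral_Ioi_eq]
    · refine lintegral_congr fun U => ?_
      rw [setLIntegral_Ioi_eq fun W h => (stripIntegral_ne_zero h).2,
        lintegral_sub_right_eq_self (fun W => stripIntegral Φ N U W)]
    · intro U hU
      by_contra hcon
      refine hU ?_
      have : ∀ W, stripIntegral Φ N U W = 0 := fun W => by
        by_contra h
        exact hcon (stripIntegral_ne_zero h).1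
      simp [this]
  have hm1 : Measurable (Function.uncurry fun U l => stripIntegral Φ N U (l - U)) :=
    measurable_stripIntegral hΦ (α := ℝ × ℝ) (by fun_prop) (by fun_prop)
  have e2 : ∫⁻ U, ∫⁻ l, stripIntegral Φ N U (l - U) =
      ∫⁻ l in Ioi (0 : ℝ), ENNReal.ofReal l * ∫⁻ s, stripIntegral Φ N (l * s) (l - l * s) := by
    rw [lintegral_lintegral_swap hm1.aemeasurable, ← setLIntegral_Ioi_eq]
    · refine setLIntegral_congr_fun measurableSet_Ioi fun l hl => ?_
      have hl0 : 0 < l := hl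
      have h1 := lintegral_affine (fun U => stripIntegral Φ N U (l - U)) hl0 0
      simp only [add_zero] at h1
      rw [h1, ← mul_assoc, ← ENNReal.ofReal_mul hl0.le, mul_inv_cancel₀ hl0.ne', ENNReal.ofReal_one,
        one_mul]
    · intro l hl
      by_contra hcon
      refine hl ?_
      have : ∀ U, stripIntegral Φ N U (l - U) = 0 := fun U => by
        by_contra h
        have := stripIntegral_ne_zero h
        exact hcon (by linarith)
      simp [this]
  have e3 : ∀ l ∈ Ioi (0 : ℝ), ENNReal.ofReal l * ∫⁻ s, stripIntegral Φ N (l * s) (l - l * s) =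
      ∫⁻ μ, (if l ^ 2 * μ ≤ N then ENNReal.ofReal (l ^ 4) else 0) *
        ∫⁻ s, ∫⁻ τ, ENNReal.ofReal (unitTerm Φ s μ τ) := by
    intro l hl
    have hl0 : 0 < l := hl
    have h1 : ∀ s, stripIntegral Φ N (l * s) (l - l * s) = ENNReal.ofReal l *
        ∫⁻ μ, ∫⁻ τ, ENNReal.ofReal (stripTerm Φ N (l * s) (l - l * s) (l * μ) τ) := by
      intro s
      have h1 := lintegral_affine (fun η => ∫⁻ τ, ENNReal.ofReal
        (stripTerm Φ N (l * s) (l - l * s) η τ)) hl0 0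
      simp only [add_zero] at h1
      rw [h1, ← mul_assoc, ← ENNReal.ofReal_mul hl0.le, mul_inv_cancel₀ hl0.ne', ENNReal.ofReal_one,
        one_mul]
      rfl
    have h2 : ∀ s μ, ∫⁻ τ, ENNReal.ofReal (stripTerm Φ N (l * s) (l - l * s) (l * μ) τ) =
        (if l ^ 2 * μ ≤ N then ENNReal.ofReal (l ^ 2) else 0) *
          ∫⁻ τ, ENNReal.ofReal (unitTerm Φ s μ τ) := by
      intro s μ
      simp only [stripTerm_scale hΦ hl0]
      split_ifs
      · simp only [ENNReal.ofReal_mul (sq_nonneg l)]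
        rw [lintegral_const_mul' _ _ ENNReal.ofReal_ne_top]
      · simp
    have hm2 : Measurable fun p : ℝ × ℝ => ∫⁻ τ, ENNReal.ofReal (unitTerm Φ p.1 p.2 τ) :=
      Measurable.lintegral_prod_right' (measurable_ofReal_unitTerm hΦ (α := (ℝ × ℝ) × ℝ)
        (f := fun p => p.1.1) (g := fun p => p.1.2) (h := fun p => p.2)
        (by fun_prop) (by fun_prop) (by fun_prop))
    have hm3 : Measurable (Function.uncurry fun s μ =>
        (if l ^ 2 * μ ≤ N then ENNReal.ofReal (l ^ 2) else 0) *
          ∫⁻ τ, ENNReal.ofReal (unitTerm Φ s μ τ)) := by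
      refine Measurable.mul (Measurable.ite ?_ measurable_const measurable_const) hm2
      exact measurableSet_le (f := fun p : ℝ × ℝ => l ^ 2 * p.2) (by fun_prop) measurable_const
    simp only [h1, h2]
    rw [lintegral_const_mul' _ _ ENNReal.ofReal_ne_top, lintegral_lintegral_swap hm3.aemeasurable,
      ← mul_assoc, ← ENNReal.ofReal_mul hl0.le, ← lintegral_const_mul' _ _ ENNReal.ofReal_ne_top]
    refine lintegral_congr fun μ => ?_
    split_ifs
    · rw [lintegral_const_mul' _ _ ENNReal.ofReal_ne_top, ← mul_assoc,
        ← ENNReal.ofReal_mul (by positivity)]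
      congr 2
      ring
    · simp
  have hm4 : Measurable fun μ : ℝ => ∫⁻ s, ∫⁻ τ, ENNReal.ofReal (unitTerm Φ s μ τ) :=
    Measurable.lintegral_prod_right' (f := fun p : ℝ × ℝ => ∫⁻ τ, ENNReal.ofReal
      (unitTerm Φ p.2 p.1 τ)) (Measurable.lintegral_prod_right' (measurable_ofReal_unitTerm hΦ
        (α := (ℝ × ℝ) × ℝ) (f := fun p => p.1.2) (g := fun p => p.1.1) (h := fun p => p.2)
        (by fun_prop) (by fun_prop) (by fun_prop)))
  have hm5 : Measurable (Function.uncurry fun l μ : ℝ =>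
      (if l ^ 2 * μ ≤ N then ENNReal.ofReal (l ^ 4) else 0) *
        ∫⁻ s, ∫⁻ τ, ENNReal.ofReal (unitTerm Φ s μ τ)) := by
    refine Measurable.mul (Measurable.ite ?_ (by fun_prop) measurable_const)
      (hm4.comp measurable_snd)
    exact measurableSet_le (f := fun p : ℝ × ℝ => p.1 ^ 2 * p.2) (by fun_prop) measurable_const
  have hR : ∀ μ, (∫⁻ s, ∫⁻ τ, ENNReal.ofReal (unitTerm Φ s μ τ)) ≠ 0 → 0 < μ := by
    intro μ h
    by_contra hcon
    refine h ?_
    have : ∀ s τ, unitTerm Φ s μ τ = 0 := fun s τ => by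
      rw [unitTerm, if_neg fun h => hcon h.2.2.2.2.1]
    simp [this]
  rw [e1, e2, setLIntegral_congr_fun measurableSet_Ioi e3,
    lintegral_lintegral_swap hm5.aemeasurable, ← setLIntegral_Ioi_eq]
  swap
  · intro μ h
    by_contra hcon
    refine h ?_
    have : (∫⁻ s, ∫⁻ τ, ENNReal.ofReal (unitTerm Φ s μ τ)) = 0 := by
      by_contra h2
      exact hcon (hR μ h2).le
    simp [this]
  have e4 : ∀ μ ∈ Ioi (0 : ℝ), ∫⁻ l in Ioi (0 : ℝ),
      (if l ^ 2 * μ ≤ N then ENNReal.ofReal (l ^ 4) else 0) *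
        ∫⁻ s, ∫⁻ τ, ENNReal.ofReal (unitTerm Φ s μ τ) =
      ENNReal.ofReal (N ^ (5 / 2 : ℝ) / 5) * ∫⁻ s, ∫⁻ τ, ENNReal.ofReal (μ ^ (-5 / 2 : ℝ)) *
        ENNReal.ofReal (unitTerm Φ s μ τ) := by
    intro μ hμ
    rw [lintegral_mul_const _ (Measurable.ite (measurableSet_le (by fun_prop) measurable_const)
      (by fun_prop) measurable_const), lintegral_pow_four hN hμ, mul_assoc]
    congr 1
    simp only [lintegral_const_mul' _ _ ENNReal.ofReal_ne_top]
  rw [setLIntegral_congr_fun measurableSet_Ioi e4, lintegral_const_mul' _ _ ENNReal.ofReal_ne_top]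
  congr 1
  rw [lintegral_lintegral_swap]
  · refine lintegral_congr fun s => ?_
    rw [lintegral_lintegral_swap]
    exact (Measurable.mul (by fun_prop) (measurable_ofReal_unitTerm hΦ (α := ℝ × ℝ)
      measurable_const measurable_fst measurable_snd)).aemeasurable
  · refine Measurable.aemeasurable ?_
    refine Measurable.lintegral_prod_right' (f := fun p : (ℝ × ℝ) × ℝ =>
      ENNReal.ofReal (p.1.1 ^ (-5 / 2 : ℝ)) * ENNReal.ofReal (unitTerm Φ p.1.2 p.1.1 p.2)) ?_
    exact Measurable.mul (by fun_prop) (measurable_ofReal_unitTerm hΦ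
      (α := (ℝ × ℝ) × ℝ) (f := fun p => p.1.2) (g := fun p => p.1.1) (h := fun p => p.2) (by fun_prop) (by fun_prop) (by fun_prop))

end UnitTerm

/-! ### The ratio of the two totals -/

/-- An integral over the unit square which is invariant under the point reflection is twice the
integral over the triangle `τ + q > 1`. -/
lemma lintegral_square_eq_triangle {K : ℝ → ℝ → ℝ≥0∞} (hK : Measurable (Function.uncurry K))
    (hsymm : ∀ q τ, K (1 - q) (1 - τ) = K q τ)
    (hsupp : ∀ q τ, K q τ ≠ 0 → q ≤ 1 ∧ τ ≤ 1) :
    ∫⁻ q, ∫⁻ τ, K q τ = 2 * ∫⁻ q in Ioo (0 : ℝ) 1, ∫⁻ τ in Ioo (1 - q) 1, K q τ := by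
  have hnull : ∀ a : ℝ, ∀ᵐ x : ℝ, x ≠ a := by
    intro a; rw [ae_iff]; simp
  set T : ℝ → ℝ → ℝ≥0∞ := fun q τ => if 1 < τ + q then K q τ else 0 with hT
  have hTm : Measurable (Function.uncurry T) :=
    Measurable.ite (measurableSet_lt measurable_const (by fun_prop)) hK measurable_const
  have e1 : ∫⁻ q, ∫⁻ τ, K q τ = ∫⁻ q, ∫⁻ τ, T q τ + T (1 - q) (1 - τ) := by
    refine lintegral_congr fun q => lintegral_congr_ae ?_
    filter_upwards [hnull (1 - q)] with τ hτ
    simp only [hT, hsymm]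
    rcases lt_trichotomy 1 (τ + q) with h | h | h
    · rw [if_pos h, if_neg (by linarith), add_zero]
    · exact absurd (by linarith) hτ
    · rw [if_neg (by linarith), if_pos (by linarith), zero_add]
  have e2 : ∀ q, ∫⁻ τ, T q τ + T (1 - q) (1 - τ) = (∫⁻ τ, T q τ) + ∫⁻ τ, T (1 - q) τ := by
    intro q
    have hTq : Measurable fun τ => T q τ := hTm.comp measurable_prodMk_left
    rw [lintegral_add_left hTq,
      lintegral_sub_left_eq_self (fun τ => T (1 - q) τ) 1]
  have e3 : ∫⁻ q, ∫⁻ τ, T q τ = ∫⁻ q in Ioo (0 : ℝ) 1, ∫⁻ τ in Ioo (1 - q) 1, K q τ := by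
    have hT1 : ∀ q τ, T q τ ≠ 0 → 1 < τ + q ∧ q ≤ 1 ∧ τ ≤ 1 := by
      intro q τ h
      by_cases h1 : 1 < τ + q
      · simp only [hT, if_pos h1] at h
        exact ⟨h1, hsupp q τ h⟩
      · simp only [hT, if_neg h1] at h
        exact absurd rfl h
    rw [setLIntegral_congr (Ioo_ae_eq_Ioc : Ioo (0 : ℝ) 1 =ᵐ[volume] Ioc 0 1),
      ← setLIntegral_eq_of_forall_notMem (s := Ioc 0 1) measurableSet_Ioc]
    · refine setLIntegral_congr_fun measurableSet_Ioc fun q _ => ?_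
      rw [setLIntegral_congr (Ioo_ae_eq_Ioc : Ioo (1 - q) 1 =ᵐ[volume] Ioc (1 - q) 1),
        ← setLIntegral_eq_of_forall_notMem (s := Ioc (1 - q) 1) measurableSet_Ioc]
      · refine setLIntegral_congr_fun measurableSet_Ioc fun τ hτ => ?_
        simp only [hT]
        rw [if_pos (by linarith [hτ.1])]
      · intro τ hτ
        by_contra h
        obtain ⟨h1, -, h3⟩ := hT1 q τ h
        exact hτ ⟨by linarith, h3⟩
    · intro q hq
      have : ∀ τ, T q τ = 0 := by
        intro τ
        by_contra h
        obtain ⟨h1, h2, h3⟩ := hT1 q τ h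
        exact hq ⟨by linarith, h2⟩
      simp [this]
  rw [e1]
  simp only [e2]
  have hTm2 : Measurable fun q => ∫⁻ τ, T q τ := hTm.lintegral_prod_right'
  rw [lintegral_add_left hTm2, lintegral_sub_left_eq_self (fun q => ∫⁻ τ, T q τ) 1, e3, two_mul]

lemma measurable_lintegral_Ioo_one_sub {K : ℝ → ℝ → ℝ≥0∞} (hK : Measurable (Function.uncurry K)) :
    Measurable fun q => ∫⁻ τ in Ioo (1 - q) 1, K q τ := by
  have h : Measurable fun q => ∫⁻ τ, if 1 - q < τ ∧ τ < 1 then K q τ else 0 := by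
    refine Measurable.lintegral_prod_right' (f := fun p : ℝ × ℝ =>
      if 1 - p.1 < p.2 ∧ p.2 < 1 then K p.1 p.2 else 0) ?_
    exact Measurable.ite ((measurableSet_lt (f := fun p : ℝ × ℝ => 1 - p.1) (g := fun p => p.2)
      (by fun_prop) (by fun_prop)).inter (measurableSet_lt (f := fun p : ℝ × ℝ => p.2)
      (g := fun _ => 1) (by fun_prop) (by fun_prop))) hK measurable_const
  convert h using 2 with q
  rw [← lintegral_indicator measurableSet_Ioo]
  exact lintegral_congr fun τ => by simp [indicator_apply]

/-- Tonelli for the triangle `τ + q > 1`. -/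
lemma lintegral_triangle_swap {K : ℝ → ℝ → ℝ≥0∞} (hK : Measurable (Function.uncurry K)) :
    ∫⁻ q in Ioo (0 : ℝ) 1, ∫⁻ τ in Ioo (1 - q) 1, K q τ =
      ∫⁻ τ in Ioo (0 : ℝ) 1, ∫⁻ q in Ioo (1 - τ) 1, K q τ := by
  set T : ℝ → ℝ → ℝ≥0∞ := fun q τ => if q < 1 ∧ τ < 1 ∧ 1 < q + τ then K q τ else 0 with hT
  have hTm : Measurable (Function.uncurry T) :=
    Measurable.ite ((measurableSet_lt (f := fun p : ℝ × ℝ => p.1) (g := fun _ => 1)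
      (by fun_prop) (by fun_prop)).inter ((measurableSet_lt (f := fun p : ℝ × ℝ => p.2)
      (g := fun _ => 1) (by fun_prop) (by fun_prop)).inter
      (measurableSet_lt (f := fun _ : ℝ × ℝ => (1 : ℝ)) (g := fun p => p.1 + p.2)
        (by fun_prop) (by fun_prop)))) hK measurable_const
  have key : ∀ {T' K' : ℝ → ℝ → ℝ≥0∞}, (∀ q τ, q < 1 → τ < 1 → 1 < q + τ → T' q τ = K' q τ) →
      (∀ q τ, ¬ (q < 1 ∧ τ < 1 ∧ 1 < q + τ) → T' q τ = 0) →
      ∫⁻ q, ∫⁻ τ, T' q τ = ∫⁻ q in Ioo (0 : ℝ) 1, ∫⁻ τ in Ioo (1 - q) 1, K' q τ := by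
    intro T' K' h1 h2
    rw [← setLIntegral_eq_of_forall_notMem (s := Ioo 0 1) measurableSet_Ioo]
    · refine setLIntegral_congr_fun measurableSet_Ioo fun q hq => ?_
      rw [← setLIntegral_eq_of_forall_notMem (s := Ioo (1 - q) 1) measurableSet_Ioo]
      · refine setLIntegral_congr_fun measurableSet_Ioo fun τ hτ => ?_
        exact h1 q τ hq.2 hτ.2 (by linarith [hτ.1])
      · intro τ hτ
        exact h2 q τ fun h => hτ ⟨by linarith [h.2.2], h.2.1⟩
    · intro q hq
      have : ∀ τ, T' q τ = 0 := fun τ => h2 q τ fun h => hq ⟨by linarith [h.2.1, h.2.2], h.1⟩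
      simp [this]
  rw [← key (T' := T) (K' := K), ← key (T' := fun τ q => T q τ) (K' := fun τ q => K q τ),
    lintegral_lintegral_swap hTm.aemeasurable]
  · intro τ q h1 h2 h3
    exact if_pos ⟨h2, h1, by linarith⟩
  · intro τ q h
    exact if_neg fun h' => h ⟨h'.2.1, h'.1, by linarith [h'.2.2]⟩
  · intro q τ h1 h2 h3
    exact if_pos ⟨h1, h2, h3⟩
  · intro q τ h
    exact if_neg h

section UnitIntegral

variable {Φ : ℝ → ℝ → ℝ → ℝ → ℝ}

/-- The integral of the weight over the ray `μ ↦ (1 - q, μ, τ)`, with the power of `μ` that comes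
from the polar coordinates. -/
noncomputable def rayIntegral (Φ : ℝ → ℝ → ℝ → ℝ → ℝ) (q τ : ℝ) : ℝ≥0∞ :=
  ∫⁻ μ in Ioi (0 : ℝ), ENNReal.ofReal (μ ^ (-5 / 2 : ℝ)) * ENNReal.ofReal (unitTerm Φ (1 - q) μ τ)

lemma measurable_rayIntegral (hΦ : IsWeight Φ) :
    Measurable (Function.uncurry (rayIntegral Φ)) := by
  refine Measurable.lintegral_prod_right' (f := fun p : (ℝ × ℝ) × ℝ =>
    ENNReal.ofReal (p.2 ^ (-5 / 2 : ℝ)) * ENNReal.ofReal (unitTerm Φ (1 - p.1.1) p.2 p.1.2)) ?_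
  exact Measurable.mul (by fun_prop) (measurable_ofReal_unitTerm hΦ (α := (ℝ × ℝ) × ℝ)
    (f := fun p => 1 - p.1.1) (g := fun p => p.2) (h := fun p => p.1.2) (by fun_prop) (by fun_prop)
    (by fun_prop))

lemma rayIntegral_symm (hΦ : IsWeight Φ) (q τ : ℝ) :
    rayIntegral Φ (1 - q) (1 - τ) = rayIntegral Φ q τ := by
  unfold rayIntegral
  refine lintegral_congr fun μ => ?_
  congr 2
  unfold unitTerm
  rw [show 1 - (1 - τ) = τ by ring, show 1 - (1 - q) = q by ring, hΦ.symm]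
  refine if_congr ?_ rfl rfl
  constructor <;> rintro ⟨h1, h2, h3, h4, h5, h6, h7⟩ <;>
    exact ⟨by linarith, by linarith, by linarith, by linarith, h5, h7, h6⟩

lemma rayIntegral_support {q τ : ℝ} (h : rayIntegral Φ q τ ≠ 0) : q ≤ 1 ∧ τ ≤ 1 := by
  by_contra hcon
  refine h ?_
  have : ∀ μ, unitTerm Φ (1 - q) μ τ = 0 := fun μ => by
    rw [unitTerm, if_neg]
    rintro ⟨h1, h2, h3, h4, -⟩
    exact hcon ⟨by linarith, h4⟩
  simp [rayIntegral, this]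

lemma lintegral_unitTerm_eq (hΦ : IsWeight Φ) :
    ∫⁻ s, ∫⁻ τ, ∫⁻ μ in Ioi (0 : ℝ), ENNReal.ofReal (μ ^ (-5 / 2 : ℝ)) *
        ENNReal.ofReal (unitTerm Φ s μ τ) =
      2 * ∫⁻ q in Ioo (0 : ℝ) 1, ∫⁻ τ in Ioo (1 - q) 1, rayIntegral Φ q τ := by
  rw [← lintegral_square_eq_triangle (measurable_rayIntegral hΦ) (rayIntegral_symm hΦ)
    (fun q τ h => rayIntegral_support h), ← lintegral_sub_left_eq_self _ 1]
  rfl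

/-- In the triangle `τ + q > 1`, the ray starts at `μ = τ q`. -/
lemma rayIntegral_eq {q τ : ℝ} (hq : q ∈ Ioo (0 : ℝ) 1) (hτ : τ ∈ Ioo (1 - q) 1) :
    rayIntegral Φ q τ = ∫⁻ μ in Ioi (τ * q), ENNReal.ofReal (μ ^ (-5 / 2 : ℝ) *
      Φ (1 - q) q (μ - τ * q) (μ - (1 - τ) * (1 - q))) := by
  obtain ⟨hq0, hq1⟩ := hq
  obtain ⟨hτ0, hτ1⟩ := hτ
  have hτ2 : 0 < τ := by linarith
  have hτq : 0 < τ * q := mul_pos hτ2 hq0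
  have hle : (1 - τ) * (1 - q) ≤ τ * q := by nlinarith
  unfold rayIntegral
  rw [setLIntegral_congr (Ioi_ae_eq_Ici : Ioi (τ * q) =ᵐ[volume] Ici (τ * q)),
    ← lintegral_indicator measurableSet_Ioi, ← lintegral_indicator measurableSet_Ici]
  refine lintegral_congr fun μ => ?_
  by_cases hμ : μ ∈ Ici (τ * q)
  · have hμ1 : τ * q ≤ μ := hμ
    have hμ0 : 0 < μ := hτq.trans_le hμ
    rw [indicator_of_mem hμ, indicator_of_mem (show μ ∈ Ioi (0 : ℝ) from hμ0), unitTerm, if_pos,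
      sub_sub_cancel, ENNReal.ofReal_mul (by positivity)]
    rw [sub_sub_cancel]
    exact ⟨by linarith, by linarith, hτ2.le, hτ1.le, hμ0, hμ1, hle.trans hμ1⟩
  · rw [indicator_of_notMem hμ]
    by_cases hμ0 : μ ∈ Ioi (0 : ℝ)
    · rw [indicator_of_mem hμ0, unitTerm, if_neg, ENNReal.ofReal_zero, mul_zero]
      rintro ⟨-, -, -, -, -, h6, -⟩
      rw [sub_sub_cancel] at h6
      exact hμ h6
    · rw [indicator_of_notMem hμ0]

lemma rayIntegral_sqrt {q τ : ℝ} (hq : q ∈ Ioo (0 : ℝ) 1) (hτ : τ ∈ Ioo (1 - q) 1) :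
    rayIntegral (fun U W Y Z => √(U * W + U * Y + W * Z)) q τ =
      ENNReal.ofReal (q⁻¹ * τ⁻¹) := by
  have hτq : 0 < τ * q := mul_pos (by linarith [hq.2, hτ.1]) hq.1
  rw [rayIntegral_eq hq hτ]
  have e : ∀ μ ∈ Ioi (τ * q), ENNReal.ofReal (μ ^ (-5 / 2 : ℝ) *
      √((1 - q) * q + (1 - q) * (μ - τ * q) + q * (μ - (1 - τ) * (1 - q)))) =
      ENNReal.ofReal (μ ^ (-2 : ℝ)) := by
    intro μ hμ
    have hμ0 : 0 < μ := hτq.trans hμ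
    rw [show (1 - q) * q + (1 - q) * (μ - τ * q) + q * (μ - (1 - τ) * (1 - q)) = μ by ring,
      Real.sqrt_eq_rpow, ← Real.rpow_add hμ0]
    norm_num
  rw [setLIntegral_congr_fun measurableSet_Ioi e, lintegral_Ioi_rpow (by norm_num) hτq]
  congr 1
  rw [show (-2 : ℝ) + 1 = -1 by norm_num, Real.rpow_neg_one, mul_inv]
  ring

lemma rayIntegral_frob {q τ : ℝ} (hq : q ∈ Ioo (0 : ℝ) 1) (hτ : τ ∈ Ioo (1 - q) 1) :
    rayIntegral (fun U W Y Z => U + W + max Y Z) q τ =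
      ENNReal.ofReal (2 / 3) *
        (ENNReal.ofReal (τ ^ (-1 / 2 : ℝ) * (q ^ (-3 / 2 : ℝ) + q ^ (-1 / 2 : ℝ))) +
          ENNReal.ofReal (q ^ (-1 / 2 : ℝ) * (τ ^ (-3 / 2 : ℝ) + τ ^ (-1 / 2 : ℝ)))) := by
  have hq0 := hq.1
  have hq1 := hq.2
  have hτ0 : 0 < τ := by linarith [hτ.1]
  have hτ1 := hτ.2
  have hτq : 0 < τ * q := mul_pos hτ0 hq0
  have hle : (1 - τ) * (1 - q) ≤ τ * q := by nlinarith [hτ.1]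
  have hm : 0 ≤ τ + q - τ * q := by nlinarith
  rw [rayIntegral_eq hq hτ]
  have e : ∀ μ ∈ Ioi (τ * q), ENNReal.ofReal (μ ^ (-5 / 2 : ℝ) *
      (1 - q + q + max (μ - τ * q) (μ - (1 - τ) * (1 - q)))) =
      ENNReal.ofReal (τ + q - τ * q) * ENNReal.ofReal (μ ^ (-5 / 2 : ℝ)) +
        ENNReal.ofReal (μ ^ (-3 / 2 : ℝ)) := by
    intro μ hμ
    have hμ0 : 0 < μ := hτq.trans hμ
    rw [max_eq_right (by linarith), ← ENNReal.ofReal_mul hm, ← ENNReal.ofReal_add (by positivity)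
      (by positivity), show (-3 / 2 : ℝ) = -5 / 2 + 1 by norm_num, Real.rpow_add_one hμ0.ne']
    congr 1
    ring
  rw [setLIntegral_congr_fun measurableSet_Ioi e, lintegral_add_left (by fun_prop),
    lintegral_const_mul' _ _ ENNReal.ofReal_ne_top, lintegral_Ioi_rpow (by norm_num) hτq,
    lintegral_Ioi_rpow (by norm_num) hτq]
  rw [show (-5 / 2 : ℝ) + 1 = -3 / 2 by norm_num, show (-3 / 2 : ℝ) + 1 = -1 / 2 by norm_num,
    Real.mul_rpow hτ0.le hq0.le, Real.mul_rpow hτ0.le hq0.le]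
  have a1 : τ ^ (-1 / 2 : ℝ) = τ * τ ^ (-3 / 2 : ℝ) := by
    rw [show (-1 / 2 : ℝ) = -3 / 2 + 1 by norm_num, Real.rpow_add_one hτ0.ne', mul_comm]
  have a2 : q ^ (-1 / 2 : ℝ) = q * q ^ (-3 / 2 : ℝ) := by
    rw [show (-1 / 2 : ℝ) = -3 / 2 + 1 by norm_num, Real.rpow_add_one hq0.ne', mul_comm]
  rw [a1, a2]
  have hx : 0 ≤ τ ^ (-3 / 2 : ℝ) := by positivity
  have hy : 0 ≤ q ^ (-3 / 2 : ℝ) := by positivity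
  set x := τ ^ (-3 / 2 : ℝ)
  set y := q ^ (-3 / 2 : ℝ)
  have b1 : -(x * y) / (-3 / 2) = 2 / 3 * (x * y) := by ring
  have b2 : -(τ * x * (q * y)) / (-1 / 2) = 2 * (τ * x * (q * y)) := by ring
  rw [b1, b2, ← ENNReal.ofReal_mul hm, ← ENNReal.ofReal_add (by positivity) (by positivity),
    ← ENNReal.ofReal_add (by positivity) (by positivity), ← ENNReal.ofReal_mul (by norm_num)]
  congr 1
  ring

/-- The mean value of the Frobenius number is `8 / π` times that of `√(a b c)`. -/
lemma lintegral_stripIntegral_frob {N : ℝ} (hN : 0 ≤ N) :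
    ∫⁻ U in Ioi (0 : ℝ), ∫⁻ W in Ioi (0 : ℝ), stripIntegral (fun U W Y Z => U + W + max Y Z) N U W =
      ENNReal.ofReal (8 / Real.pi) * ∫⁻ U in Ioi (0 : ℝ), ∫⁻ W in Ioi (0 : ℝ),
        stripIntegral (fun U W Y Z => √(U * W + U * Y + W * Z)) N U W := by
  have hpi := Real.pi_pos
  rw [lintegral_stripIntegral_polar isWeight_frob hN,
    lintegral_stripIntegral_polar isWeight_sqrt hN,
    lintegral_unitTerm_eq isWeight_frob, lintegral_unitTerm_eq isWeight_sqrt]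
  have e1 : ∫⁻ q in Ioo (0 : ℝ) 1, ∫⁻ τ in Ioo (1 - q) 1,
      rayIntegral (fun U W Y Z => √(U * W + U * Y + W * Z)) q τ =
        ENNReal.ofReal (Real.pi ^ 2 / 6) := by
    rw [← lintegral_triangle_inv]
    exact setLIntegral_congr_fun measurableSet_Ioo fun q hq =>
      setLIntegral_congr_fun measurableSet_Ioo fun τ hτ => rayIntegral_sqrt hq hτ
  have e2 : ∫⁻ q in Ioo (0 : ℝ) 1, ∫⁻ τ in Ioo (1 - q) 1,
      rayIntegral (fun U W Y Z => U + W + max Y Z) q τ =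
        ENNReal.ofReal (2 / 3) * (ENNReal.ofReal Real.pi + ENNReal.ofReal Real.pi) := by
    have h1 : ∀ q ∈ Ioo (0 : ℝ) 1, ∫⁻ τ in Ioo (1 - q) 1,
        rayIntegral (fun U W Y Z => U + W + max Y Z) q τ = ENNReal.ofReal (2 / 3) *
        ((∫⁻ τ in Ioo (1 - q) 1,
          ENNReal.ofReal (τ ^ (-1 / 2 : ℝ) * (q ^ (-3 / 2 : ℝ) + q ^ (-1 / 2 : ℝ)))) +
          ∫⁻ τ in Ioo (1 - q) 1,
            ENNReal.ofReal (q ^ (-1 / 2 : ℝ) * (τ ^ (-3 / 2 : ℝ) + τ ^ (-1 / 2 : ℝ)))) := by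
      intro q hq
      rw [setLIntegral_congr_fun measurableSet_Ioo fun τ hτ => rayIntegral_frob hq hτ,
        lintegral_const_mul' _ _ ENNReal.ofReal_ne_top, lintegral_add_left (by fun_prop)]
    rw [setLIntegral_congr_fun measurableSet_Ioo h1, lintegral_const_mul' _ _ ENNReal.ofReal_ne_top,
      lintegral_add_right, lintegral_triangle_rpow, lintegral_triangle_swap, lintegral_triangle_rpow]
    · exact Measurable.ennreal_ofReal (f := fun p : ℝ × ℝ =>
        p.2 ^ (-1 / 2 : ℝ) * (p.1 ^ (-3 / 2 : ℝ) + p.1 ^ (-1 / 2 : ℝ))) (by fun_prop)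
    · exact measurable_lintegral_Ioo_one_sub (K := fun q τ => ENNReal.ofReal
        (q ^ (-1 / 2 : ℝ) * (τ ^ (-3 / 2 : ℝ) + τ ^ (-1 / 2 : ℝ)))) (by fun_prop)
  rw [e1, e2]
  have h2 : 2 * (ENNReal.ofReal (2 / 3) * (ENNReal.ofReal Real.pi + ENNReal.ofReal Real.pi)) =
      ENNReal.ofReal (8 / Real.pi) * (2 * ENNReal.ofReal (Real.pi ^ 2 / 6)) := by
    rw [show (2 : ℝ≥0∞) = ENNReal.ofReal 2 by simp, ← ENNReal.ofReal_add hpi.le hpi.le,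
      ← ENNReal.ofReal_mul (by norm_num), ← ENNReal.ofReal_mul (by norm_num),
      ← ENNReal.ofReal_mul (by norm_num), ← ENNReal.ofReal_mul (by positivity)]
    congr 1
    field_simp
    ring
  rw [h2, mul_left_comm]

end UnitIntegral

/-- The totals of the two weights are proportional. -/
lemma totalStrip_frob {β γ X : ℝ} (hβ : 0 < β) (hγ : 0 < γ) (hX : 0 ≤ X) :
    totalStrip (fun U W Y Z => U + W + max Y Z) β γ X = ENNReal.ofReal (8 / Real.pi) *
      totalStrip (fun U W Y Z => √(U * W + U * Y + W * Z)) β γ X := by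
  have h : ∀ Φ : ℝ → ℝ → ℝ → ℝ → ℝ, totalStrip Φ β γ X = ENNReal.ofReal (β * γ)⁻¹ *
      (ENNReal.ofReal β⁻¹ * (ENNReal.ofReal γ⁻¹ *
        ∫⁻ U in Ioi (0 : ℝ), ∫⁻ W in Ioi (0 : ℝ), stripIntegral Φ (X * β * γ) U W)) := by
    intro Φ
    unfold totalStrip scaledStrip
    have h1 : ∀ u, ∫⁻ w in Ioi (0 : ℝ), ENNReal.ofReal (β * γ)⁻¹ *
        stripIntegral Φ (X * β * γ) (β * u) (γ * w) = ENNReal.ofReal (β * γ)⁻¹ *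
        (ENNReal.ofReal γ⁻¹ * ∫⁻ W in Ioi (0 : ℝ), stripIntegral Φ (X * β * γ) (β * u) W) := by
      intro u
      rw [lintegral_const_mul' _ _ ENNReal.ofReal_ne_top, setLIntegral_Ioi_eq, setLIntegral_Ioi_eq]
      · have := lintegral_affine (fun W => stripIntegral Φ (X * β * γ) (β * u) W) hγ 0
        simp only [add_zero] at this
        rw [this]
      · exact fun W h => (stripIntegral_ne_zero h).2
      · exact fun w h => (mul_nonneg_iff_of_pos_left hγ).1 (stripIntegral_ne_zero h).2
    simp only [h1]
    rw [lintegral_const_mul' _ _ ENNReal.ofReal_ne_top,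
      lintegral_const_mul' _ _ ENNReal.ofReal_ne_top]
    have h0 : ∀ U, (∫⁻ W in Ioi (0 : ℝ), stripIntegral Φ (X * β * γ) U W) ≠ 0 → 0 ≤ U := by
      intro U hU
      by_contra hcon
      refine hU ?_
      have : ∀ W, stripIntegral Φ (X * β * γ) U W = 0 := fun W => by
        by_contra h
        exact hcon (stripIntegral_ne_zero h).1
      simp [this]
    rw [setLIntegral_Ioi_eq (fun u h => (mul_nonneg_iff_of_pos_left hβ).1 (h0 _ h)),
      setLIntegral_Ioi_eq h0]
    have := lintegral_affine (fun U => ∫⁻ W in Ioi (0 : ℝ), stripIntegral Φ (X * β * γ) U W) hβ 0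
    simp only [add_zero] at this
    rw [this]
    ring
  rw [h, h, lintegral_stripIntegral_frob (by positivity)]
  ring

/-! ### Cancellation of the main terms -/

/-- The sum over the bases whose determinant is divisible by `d` is close to a multiple of
`totalStrip`, with a factor that does not depend on the weight. -/
lemma sum_quads_dvd_total {Φ : ℝ → ℝ → ℝ → ℝ → ℝ} (hΦ : IsWeight Φ) {β γ : ℝ} (hβ : 0 < β)
    (hγ : 0 < γ) {d n : ℕ} (hd : 0 < d) (hn : 0 < n) :
    |∑ q ∈ quads n with d ∣ qdet q, coneTerm Φ q.1 q.2.1 q.2.2.1 q.2.2.2 β γ -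
      ((d : ℝ)⁻¹ * ∑ t ∈ d.divisors, (Nat.totient t : ℝ) * ((t : ℝ) ^ 2)⁻¹) *
        (totalStrip Φ β γ n).toReal| ≤ 19 * (β + γ) * n ^ 2 * harmonicSum n ^ 2 := by
  have hh := one_le_harmonicSum n
  have hd0 : (0 : ℝ) < d := by exact_mod_cast hd
  have h1 := sum_quads_dvd_close hΦ hβ hγ hd n
  have h2 : |(d : ℝ)⁻¹ * ∑ t ∈ d.divisors, (Nat.totient t : ℝ) *
        ∑ u ∈ Finset.Icc 1 n, ∑ w ∈ Finset.Icc 1 n,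
          (if t ∣ u ∧ t ∣ w then (cellIntegral Φ β γ n u w).toReal else 0) -
      ((d : ℝ)⁻¹ * ∑ t ∈ d.divisors, (Nat.totient t : ℝ) * ((t : ℝ) ^ 2)⁻¹) *
        (totalStrip Φ β γ n).toReal| ≤ 15 * (β + γ) * n ^ 2 * harmonicSum n := by
    rw [mul_assoc, ← mul_sub, Finset.sum_mul, ← Finset.sum_sub_distrib, abs_mul,
      abs_of_nonneg (by positivity)]
    have h3 : ∀ t ∈ d.divisors, |(Nat.totient t : ℝ) * (∑ u ∈ Finset.Icc 1 n, ∑ w ∈ Finset.Icc 1 n,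
          (if t ∣ u ∧ t ∣ w then (cellIntegral Φ β γ n u w).toReal else 0)) -
        (Nat.totient t : ℝ) * ((t : ℝ) ^ 2)⁻¹ * (totalStrip Φ β γ n).toReal| ≤
        15 * (β + γ) * n ^ 2 * harmonicSum n := by
      intro t ht
      have ht0 := Nat.pos_of_mem_divisors ht
      have ht1 : (0 : ℝ) < t := by exact_mod_cast ht0
      rw [mul_assoc, ← mul_sub, abs_mul, abs_of_nonneg (Nat.cast_nonneg _)]
      have h4 : (Nat.totient t : ℝ) ≤ t := by exact_mod_cast Nat.totient_le t
      calc _ ≤ (t : ℝ) * (15 * n ^ 2 * (β + γ) * harmonicSum n / t) :=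
            mul_le_mul h4 (sum_cellIntegral_close hΦ hβ hγ ht0 hn) (abs_nonneg _) ht1.le
        _ = _ := by field_simp
    calc _ ≤ (d : ℝ)⁻¹ * (d.divisors.card • (15 * (β + γ) * n ^ 2 * harmonicSum n)) := by
          refine mul_le_mul_of_nonneg_left ?_ (by positivity)
          exact (Finset.abs_sum_le_sum_abs _ _).trans (Finset.sum_le_card_nsmul _ _ _ h3)
      _ ≤ (d : ℝ)⁻¹ * (d * (15 * (β + γ) * n ^ 2 * harmonicSum n)) := by
          rw [nsmul_eq_mul]
          have h5 : (d.divisors.card : ℝ) ≤ d := by exact_mod_cast Nat.card_divisors_le_self d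
          gcongr
      _ = _ := by field_simp
  have h6 : 15 * (β + γ) * n ^ 2 * harmonicSum n ≤ 15 * (β + γ) * n ^ 2 * harmonicSum n ^ 2 :=
    mul_le_mul_of_nonneg_left (by nlinarith) (by positivity)
  refine (abs_sub_le _ _ _).trans ((add_le_add h1 h2).trans ?_)
  linarith

/-- The excess of the Frobenius weight of a basis over `8 / π` times the square root weight. -/
noncomputable def excess (β γ : ℝ) (q : ℕ × ℕ × ℕ × ℕ) : ℝ :=
  coneTerm (fun U W Y Z => U + W + max Y Z) q.1 q.2.1 q.2.2.1 q.2.2.2 β γ -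
    8 / Real.pi * coneTerm (fun U W Y Z => √(U * W + U * Y + W * Z)) q.1 q.2.1 q.2.2.1 q.2.2.2 β γ

/-- The main terms of the two weights cancel in the sum of the excess. -/
lemma abs_sum_excess_le {β γ : ℝ} (hβ : 0 < β) (hγ : 0 < γ) {d : ℕ} (hd : 0 < d) (n : ℕ) :
    |∑ q ∈ quads n with d ∣ qdet q, excess β γ q| ≤ 76 * (β + γ) * harmonicSum n ^ 2 * n ^ 2 := by
  have hh := one_le_harmonicSum n
  rcases Nat.eq_zero_or_pos n with rfl | hn
  · simp [quads]
  have hpi : 8 / Real.pi ≤ 3 := by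
    rw [div_le_iff₀ Real.pi_pos]; linarith [Real.pi_gt_three]
  have hpi0 : 0 ≤ 8 / Real.pi := by positivity
  have h1 := sum_quads_dvd_total isWeight_frob hβ hγ hd hn
  have h2 := sum_quads_dvd_total isWeight_sqrt hβ hγ hd hn
  rw [totalStrip_frob hβ hγ (Nat.cast_nonneg n), ENNReal.toReal_mul,
    ENNReal.toReal_ofReal hpi0] at h1
  simp only [excess]
  rw [Finset.sum_sub_distrib, ← Finset.mul_sum]
  set F := ∑ q ∈ quads n with d ∣ qdet q,
    coneTerm (fun U W Y Z => U + W + max Y Z) q.1 q.2.1 q.2.2.1 q.2.2.2 β γ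
  set G := ∑ q ∈ quads n with d ∣ qdet q,
    coneTerm (fun U W Y Z => √(U * W + U * Y + W * Z)) q.1 q.2.1 q.2.2.1 q.2.2.2 β γ
  set V := (totalStrip (fun U W Y Z => √(U * W + U * Y + W * Z)) β γ n).toReal
  set c := (d : ℝ)⁻¹ * ∑ t ∈ d.divisors, (Nat.totient t : ℝ) * ((t : ℝ) ^ 2)⁻¹
  set R := 19 * (β + γ) * n ^ 2 * harmonicSum n ^ 2 with hR
  have hR0 : 0 ≤ R := by positivity
  have e : F - 8 / Real.pi * G = (F - c * (8 / Real.pi * V)) - 8 / Real.pi * (G - c * V) := by ring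
  have h3 : |8 / Real.pi * (G - c * V)| ≤ 3 * R := by
    rw [abs_mul, abs_of_nonneg hpi0]
    exact mul_le_mul hpi h2 (abs_nonneg _) (by norm_num)
  rw [e]
  refine (abs_sub _ _).trans ?_
  linarith

lemma excess_mul (β γ : ℝ) {κ : ℕ} (hκ : 0 < κ) (q : ℕ × ℕ × ℕ × ℕ) :
    excess β γ (κ * q.1, κ * q.2.1, κ * q.2.2.1, κ * q.2.2.2) = κ * excess β γ q := by
  have hκ0 : (0 : ℝ) < κ := by exact_mod_cast hκ
  have h : ∀ {Φ : ℝ → ℝ → ℝ → ℝ → ℝ}, IsWeight Φ → ∀ u w y z : ℝ,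
      coneTerm Φ (κ * u) (κ * w) (κ * y) (κ * z) β γ = κ * coneTerm Φ u w y z β γ := by
    intro Φ hΦ u w y z
    unfold coneTerm
    rw [mul_ite, mul_zero, ← hΦ.hom hκ0.le]
    refine if_congr (and_congr ?_ ?_) ?_ rfl
    · rw [← mul_lt_mul_iff_right₀ hκ0 (b := γ * y)]
      ring_nf
    · rw [← mul_le_mul_iff_right₀ hκ0 (b := β * z)]
      ring_nf
    · congr 1 <;> ring
  simp only [excess]
  push_cast
  rw [h isWeight_frob, h isWeight_sqrt]
  ring

/-! ### Möbius inversion and summation by parts -/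

lemma harmonicSum_mono {m n : ℕ} (h : m ≤ n) : harmonicSum m ≤ harmonicSum n :=
  Finset.sum_le_sum_of_subset_of_nonneg (Finset.range_mono (by omega)) fun _ _ _ => by positivity

lemma mem_primQuads {n : ℕ} {q : ℕ × ℕ × ℕ × ℕ} : q ∈ primQuads n ↔
    q ∈ quads n ∧ Nat.gcd (Nat.gcd q.1 q.2.1) (Nat.gcd q.2.2.1 q.2.2.2) = 1 :=
  Finset.mem_filter

lemma mem_quads_iff {n : ℕ} {q : ℕ × ℕ × ℕ × ℕ} :
    q ∈ quads n ↔ 0 < q.1 ∧ 0 < q.2.1 ∧ qdet q ≤ n := by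
  obtain ⟨u, w, y, z⟩ := q
  exact mem_quads

lemma qdet_pos {n : ℕ} {q : ℕ × ℕ × ℕ × ℕ} (h : q ∈ quads n) : 0 < qdet q := by
  obtain ⟨h1, h2, -⟩ := mem_quads_iff.1 h
  have := Nat.mul_pos h1 h2
  unfold qdet
  omega

lemma fst_le_of_mem_quads {n : ℕ} {q : ℕ × ℕ × ℕ × ℕ} (h : q ∈ quads n) : q.1 ≤ n := by
  obtain ⟨h1, h2, h3⟩ := mem_quads_iff.1 h
  have := Nat.le_mul_of_pos_right q.1 h2
  unfold qdet at h3
  omega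

section Homogeneous

variable {e : ℕ × ℕ × ℕ × ℕ → ℝ} {E : ℝ} {N : ℕ}

/-- Bases divisible by `κ` correspond to bases of determinant at most `n / κ ^ 2`. -/
lemma sum_quads_mul {κ : ℕ} (hκ : 0 < κ) (n : ℕ) (P : ℕ → Prop) [DecidablePred P] :
    ∑ q ∈ quads n with κ ∣ Nat.gcd (Nat.gcd q.1 q.2.1) (Nat.gcd q.2.2.1 q.2.2.2) ∧ P (qdet q), e q =
      ∑ q ∈ quads (n / κ ^ 2) with P (κ ^ 2 * qdet q),
        e (κ * q.1, κ * q.2.1, κ * q.2.2.1, κ * q.2.2.2) := by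
  symm
  have hdet : ∀ q : ℕ × ℕ × ℕ × ℕ,
      qdet (κ * q.1, κ * q.2.1, κ * q.2.2.1, κ * q.2.2.2) = κ ^ 2 * qdet q := by
    intro q; unfold qdet; ring
  refine Finset.sum_nbij' (fun q => (κ * q.1, κ * q.2.1, κ * q.2.2.1, κ * q.2.2.2))
    (fun q => (q.1 / κ, q.2.1 / κ, q.2.2.1 / κ, q.2.2.2 / κ)) ?_ ?_ ?_ ?_ ?_
  · intro q hq
    rw [Finset.mem_filter, mem_quads_iff] at hq ⊢
    obtain ⟨⟨h1, h2, h3⟩, h4⟩ := hq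
    rw [hdet]
    refine ⟨⟨Nat.mul_pos hκ h1, Nat.mul_pos hκ h2, ?_⟩, ?_, h4⟩
    · rw [Nat.le_div_iff_mul_le (by positivity)] at h3
      linarith
    · simp only [Nat.dvd_gcd_iff]
      exact ⟨⟨dvd_mul_right _ _, dvd_mul_right _ _⟩, dvd_mul_right _ _, dvd_mul_right _ _⟩
  · rintro q hq
    rw [Finset.mem_filter, mem_quads_iff] at hq ⊢
    obtain ⟨⟨h1, h2, h3⟩, h4, h5⟩ := hq
    obtain ⟨u, w, y, z⟩ := q
    simp only [Nat.dvd_gcd_iff] at h4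
    obtain ⟨⟨⟨u, rfl⟩, ⟨w, rfl⟩⟩, ⟨y, rfl⟩, ⟨z, rfl⟩⟩ := h4
    simp only [Nat.mul_div_cancel_left _ hκ]
    have := hdet (u, w, y, z)
    simp only at this
    rw [this] at h3 h5
    refine ⟨⟨Nat.pos_of_mul_pos_left h1, Nat.pos_of_mul_pos_left h2, ?_⟩, h5⟩
    rw [Nat.le_div_iff_mul_le (by positivity)]
    linarith
  · rintro q _
    simp only [Nat.mul_div_cancel_left _ hκ]
  · rintro q hq
    rw [Finset.mem_filter] at hq
    obtain ⟨-, h4, -⟩ := hq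
    simp only [Nat.dvd_gcd_iff] at h4
    obtain ⟨⟨h1, h2⟩, h3, h4⟩ := h4
    simp only [Nat.mul_div_cancel' h1, Nat.mul_div_cancel' h2, Nat.mul_div_cancel' h3,
      Nat.mul_div_cancel' h4]
  · intro q _
    rfl

/-- Möbius inversion over the common divisor of the entries of a basis. -/
lemma abs_sum_primQuads_dvd_le
    (he : ∀ κ : ℕ, 0 < κ → ∀ q, e (κ * q.1, κ * q.2.1, κ * q.2.2.1, κ * q.2.2.2) = κ * e q)
    (hE : ∀ d n : ℕ, 0 < d → n ≤ N → |∑ q ∈ quads n with d ∣ qdet q, e q| ≤ E * n ^ 2)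
    {d n : ℕ} (hd : 0 < d) (hn : n ≤ N) :
    |∑ q ∈ primQuads n with d ∣ qdet q, e q| ≤ E * harmonicSum N * n ^ 2 := by
  have hE0 : 0 ≤ E * n ^ 2 := (abs_nonneg _).trans (hE d n hd hn)
  have h1 : ∑ q ∈ primQuads n with d ∣ qdet q, e q = ∑ κ ∈ Finset.Icc 1 n,
      (ArithmeticFunction.moebius κ : ℝ) * ∑ q ∈ quads n with
        κ ∣ Nat.gcd (Nat.gcd q.1 q.2.1) (Nat.gcd q.2.2.1 q.2.2.2) ∧ d ∣ qdet q, e q := by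
    simp only [Finset.sum_filter, primQuads, Finset.mul_sum]
    rw [Finset.sum_comm]
    refine Finset.sum_congr rfl fun q hq => ?_
    obtain ⟨h2, -, -⟩ := mem_quads_iff.1 hq
    set g := Nat.gcd (Nat.gcd q.1 q.2.1) (Nat.gcd q.2.2.1 q.2.2.2) with hg
    have hg0 : g ≠ 0 := Nat.gcd_ne_zero_left (Nat.gcd_ne_zero_left h2.ne')
    have hgn : g ≤ n := ((Nat.gcd_le_left _ (Nat.gcd_pos_of_pos_left _ h2)).trans
      (Nat.gcd_le_left _ h2)).trans (fst_le_of_mem_quads hq)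
    have h3 : g.divisors = (Finset.Icc 1 n).filter (· ∣ g) := by
      ext κ
      rw [Nat.mem_divisors, Finset.mem_filter, Finset.mem_Icc]
      refine ⟨fun h => ⟨⟨Nat.pos_of_dvd_of_pos h.1 (Nat.pos_of_ne_zero hg0),
        (Nat.le_of_dvd (Nat.pos_of_ne_zero hg0) h.1).trans hgn⟩, h.1⟩, fun h => ⟨h.2, hg0⟩⟩
    have h4 := sum_divisors_moebius g
    rw [h3, Finset.sum_filter] at h4
    by_cases hdq : d ∣ qdet q
    · simp only [hdq, and_true, if_true]
      rw [← one_mul (e q), ← ite_zero_mul, ← h4, Finset.sum_mul]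
      refine Finset.sum_congr rfl fun κ _ => ?_
      split_ifs <;> simp
    · simp [hdq]
  rw [h1]
  have h5 : ∀ κ ∈ Finset.Icc 1 n, |(ArithmeticFunction.moebius κ : ℝ) * ∑ q ∈ quads n with
        κ ∣ Nat.gcd (Nat.gcd q.1 q.2.1) (Nat.gcd q.2.2.1 q.2.2.2) ∧ d ∣ qdet q, e q| ≤
      E * n ^ 2 * (κ : ℝ)⁻¹ := by
    intro κ hκ
    have hκ0 : 0 < κ := (Finset.mem_Icc.1 hκ).1
    have hκ1 : (1 : ℝ) ≤ κ := by exact_mod_cast hκ0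
    have hmu : |(ArithmeticFunction.moebius κ : ℝ)| ≤ 1 := by
      exact_mod_cast ArithmeticFunction.abs_moebius_le_one
    have hg0 : 0 < Nat.gcd d (κ ^ 2) := Nat.gcd_pos_of_pos_left _ hd
    -- the bases `κ q` have determinant `κ ^ 2 * qdet q`
    have h6 : ∀ q, d ∣ κ ^ 2 * qdet q ↔ d / Nat.gcd d (κ ^ 2) ∣ qdet q := by
      intro q
      have hcop := Nat.coprime_div_gcd_div_gcd hg0
      have h7 : d ∣ κ ^ 2 * qdet q ↔ d / Nat.gcd d (κ ^ 2) * Nat.gcd d (κ ^ 2) ∣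
          κ ^ 2 / Nat.gcd d (κ ^ 2) * qdet q * Nat.gcd d (κ ^ 2) := by
        rw [mul_right_comm, Nat.div_mul_cancel (Nat.gcd_dvd_left d (κ ^ 2)),
          Nat.div_mul_cancel (Nat.gcd_dvd_right d (κ ^ 2))]
      rw [h7, Nat.mul_dvd_mul_iff_right hg0]
      exact ⟨fun h => hcop.dvd_of_dvd_mul_left h, fun h => h.mul_left _⟩
    have hd' : 0 < d / Nat.gcd d (κ ^ 2) :=
      Nat.div_pos (Nat.gcd_le_left _ hd) hg0
    rw [sum_quads_mul hκ0 n (fun a => d ∣ a), Finset.sum_congr rfl fun q _ => he κ hκ0 q,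
      ← Finset.mul_sum, abs_mul, abs_mul, Nat.abs_cast]
    simp only [h6]
    have h7 := hE _ (n / κ ^ 2) hd' ((Nat.div_le_self _ _).trans hn)
    have h8 : ((n / κ ^ 2 : ℕ) : ℝ) ≤ n / (κ : ℝ) ^ 2 := by
      exact_mod_cast Nat.cast_div_le
    have hEn : E * ((n / κ ^ 2 : ℕ) : ℝ) ^ 2 ≤ E * n ^ 2 * ((κ : ℝ) ^ 4)⁻¹ := by
      rcases Nat.eq_zero_or_pos n with rfl | hn0
      · simp
      · have : 0 ≤ E := by
          refine nonneg_of_mul_nonneg_left hE0 ?_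
          positivity
        calc _ ≤ E * (n / (κ : ℝ) ^ 2) ^ 2 := by gcongr
          _ = _ := by field_simp
    calc _ ≤ 1 * (κ * (E * n ^ 2 * ((κ : ℝ) ^ 4)⁻¹)) := by
          refine mul_le_mul hmu ?_ (by positivity) zero_le_one
          exact mul_le_mul_of_nonneg_left (h7.trans hEn) (by positivity)
      _ = E * n ^ 2 * ((κ : ℝ) ^ 3)⁻¹ := by field_simp
      _ ≤ _ := by
          refine mul_le_mul_of_nonneg_left (inv_anti₀ (by positivity) ?_) hE0
          exact le_self_pow₀ hκ1 (by norm_num)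
  refine (Finset.abs_sum_le_sum_abs _ _).trans ((Finset.sum_le_sum h5).trans ?_)
  rw [← Finset.mul_sum]
  calc _ ≤ E * n ^ 2 * harmonicSum N :=
        mul_le_mul_of_nonneg_left ((sum_Icc_inv_le n).trans (harmonicSum_mono hn)) hE0
    _ = _ := by ring

/-- The factor `φ(a) / a` is expanded as a divisor sum. -/
lemma abs_sum_primQuads_dens_le
    (he : ∀ κ : ℕ, 0 < κ → ∀ q, e (κ * q.1, κ * q.2.1, κ * q.2.2.1, κ * q.2.2.2) = κ * e q)
    (hE : ∀ d n : ℕ, 0 < d → n ≤ N → |∑ q ∈ quads n with d ∣ qdet q, e q| ≤ E * n ^ 2)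
    {n : ℕ} (hn : n ≤ N) :
    |∑ q ∈ primQuads n, dens (qdet q) * e q| ≤ E * harmonicSum N ^ 2 * n ^ 2 := by
  have h1 : ∑ q ∈ primQuads n, dens (qdet q) * e q = ∑ d ∈ Finset.Icc 1 n,
      (ArithmeticFunction.moebius d : ℝ) / d * ∑ q ∈ primQuads n with d ∣ qdet q, e q := by
    simp only [Finset.sum_filter, Finset.mul_sum]
    rw [Finset.sum_comm]
    refine Finset.sum_congr rfl fun q hq => ?_
    have hq' := (mem_primQuads.1 hq).1
    have h0 := qdet_pos hq'
    have h2 : (qdet q).divisors = (Finset.Icc 1 n).filter (· ∣ qdet q) := by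
      ext κ
      rw [Nat.mem_divisors, Finset.mem_filter, Finset.mem_Icc]
      exact ⟨fun h => ⟨⟨Nat.pos_of_dvd_of_pos h.1 h0,
        (Nat.le_of_dvd h0 h.1).trans (mem_quads_iff.1 hq').2.2⟩, h.1⟩, fun h => ⟨h.2, h0.ne'⟩⟩
    rw [dens, h2, Finset.sum_filter, Finset.sum_mul]
    refine Finset.sum_congr rfl fun κ _ => ?_
    split_ifs <;> simp
  rw [h1]
  have h3 : ∀ d ∈ Finset.Icc 1 n, |(ArithmeticFunction.moebius d : ℝ) / d *
      ∑ q ∈ primQuads n with d ∣ qdet q, e q| ≤ (d : ℝ)⁻¹ * (E * harmonicSum N * n ^ 2) := by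
    intro d hd
    have hmu : |(ArithmeticFunction.moebius d : ℝ)| ≤ 1 := by
      exact_mod_cast ArithmeticFunction.abs_moebius_le_one
    rw [abs_mul, abs_div, Nat.abs_cast, ← one_div]
    exact mul_le_mul (div_le_div_of_nonneg_right hmu (by positivity))
      (abs_sum_primQuads_dvd_le he hE (Finset.mem_Icc.1 hd).1 hn) (abs_nonneg _) (by positivity)
  refine (Finset.abs_sum_le_sum_abs _ _).trans ((Finset.sum_le_sum h3).trans ?_)
  rw [← Finset.sum_mul]
  have h0 : 0 ≤ E * harmonicSum N * n ^ 2 :=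
    (abs_nonneg _).trans (abs_sum_primQuads_dvd_le he hE one_pos hn)
  calc _ ≤ harmonicSum N * (E * harmonicSum N * n ^ 2) :=
        mul_le_mul_of_nonneg_right ((sum_Icc_inv_le n).trans (harmonicSum_mono hn)) h0
    _ = _ := by ring

lemma inv_eq_inv_add_sum {a n : ℕ} (ha : 0 < a) (hn : a ≤ n) :
    (a : ℝ)⁻¹ = (n : ℝ)⁻¹ + ∑ m ∈ Finset.Icc 1 n, if a ≤ m ∧ m < n then
      ((m : ℝ) * (m + 1))⁻¹ else 0 := by
  have h : ∀ n, a ≤ n → (a : ℝ)⁻¹ = (n : ℝ)⁻¹ + ∑ m ∈ Finset.Ico a n, ((m : ℝ) * (m + 1))⁻¹ := by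
    intro n hn
    induction n, hn using Nat.le_induction with
    | base => simp
    | succ k hk ih =>
      have hk0 : (0 : ℝ) < k := by exact_mod_cast ha.trans_le hk
      rw [Finset.sum_Ico_succ_top hk, ih]
      push_cast
      field_simp
      ring
  rw [h n hn, ← Finset.sum_filter]
  congr 2
  ext m
  simp only [Finset.mem_filter, Finset.mem_Icc, Finset.mem_Ico]
  omega

/-- Summation by parts against `1 / a`. -/
lemma abs_sum_primQuads_inv_le
    (he : ∀ κ : ℕ, 0 < κ → ∀ q, e (κ * q.1, κ * q.2.1, κ * q.2.2.1, κ * q.2.2.2) = κ * e q)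
    (hE : ∀ d n : ℕ, 0 < d → n ≤ N → |∑ q ∈ quads n with d ∣ qdet q, e q| ≤ E * n ^ 2) :
    |∑ q ∈ primQuads N, dens (qdet q) * (qdet q : ℝ)⁻¹ * e q| ≤ 2 * E * harmonicSum N ^ 2 * N := by
  rcases Nat.eq_zero_or_pos N with rfl | hN
  · simp [primQuads, quads]
  have hN0 : (0 : ℝ) < N := by exact_mod_cast hN
  have hh := one_le_harmonicSum N
  have hE0 : 0 ≤ E * harmonicSum N ^ 2 := by
    refine nonneg_of_mul_nonneg_left ((abs_nonneg _).trans (abs_sum_primQuads_dens_le he hE le_rfl)) ?_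
    positivity
  have h1 : ∑ q ∈ primQuads N, dens (qdet q) * (qdet q : ℝ)⁻¹ * e q =
      (N : ℝ)⁻¹ * ∑ q ∈ primQuads N, dens (qdet q) * e q + ∑ m ∈ Finset.Icc 1 N, if m < N then
        ((m : ℝ) * (m + 1))⁻¹ * ∑ q ∈ primQuads m, dens (qdet q) * e q else 0 := by
    have h2 : ∀ m ∈ Finset.Icc 1 N, (if m < N then
        ((m : ℝ) * (m + 1))⁻¹ * ∑ q ∈ primQuads m, dens (qdet q) * e q else 0) =
        ∑ q ∈ primQuads N, (if qdet q ≤ m ∧ m < N then ((m : ℝ) * (m + 1))⁻¹ else 0) *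
          (dens (qdet q) * e q) := by
      intro m hm
      have h3 : primQuads m = (primQuads N).filter fun q => qdet q ≤ m := by
        ext q
        rw [Finset.mem_filter, mem_primQuads, mem_primQuads, mem_quads_iff, mem_quads_iff]
        have := (Finset.mem_Icc.1 hm).2
        constructor
        · rintro ⟨⟨a, b, c⟩, d⟩
          exact ⟨⟨⟨a, b, c.trans this⟩, d⟩, c⟩
        · rintro ⟨⟨⟨a, b, -⟩, d⟩, c⟩
          exact ⟨⟨a, b, c⟩, d⟩
      split_ifs with h
      · rw [h3, Finset.mul_sum, Finset.sum_filter]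
        refine Finset.sum_congr rfl fun q _ => ?_
        by_cases hq : qdet q ≤ m <;> simp [h, hq]
      · simp [h]
    rw [Finset.sum_congr rfl h2, Finset.sum_comm, Finset.mul_sum, ← Finset.sum_add_distrib]
    refine Finset.sum_congr rfl fun q hq => ?_
    have hq' := (mem_primQuads.1 hq).1
    rw [← Finset.sum_mul, ← add_mul, ← inv_eq_inv_add_sum (qdet_pos hq') (mem_quads_iff.1 hq').2.2]
    ring
  have h4 : ∀ m ∈ Finset.Icc 1 N, |if m < N then
      ((m : ℝ) * (m + 1))⁻¹ * ∑ q ∈ primQuads m, dens (qdet q) * e q else 0| ≤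
        E * harmonicSum N ^ 2 := by
    intro m hm
    split_ifs with h
    · have hm0 : (0 : ℝ) < m := by exact_mod_cast (Finset.mem_Icc.1 hm).1
      rw [abs_mul, abs_of_nonneg (by positivity)]
      calc _ ≤ ((m : ℝ) * (m + 1))⁻¹ * (E * harmonicSum N ^ 2 * m ^ 2) :=
            mul_le_mul_of_nonneg_left (abs_sum_primQuads_dens_le he hE h.le) (by positivity)
        _ = E * harmonicSum N ^ 2 * (m / (m + 1)) := by field_simp
        _ ≤ E * harmonicSum N ^ 2 * 1 := by
            refine mul_le_mul_of_nonneg_left ?_ hE0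
            rw [div_le_one (by positivity)]
            linarith
        _ = _ := mul_one _
    · simpa using hE0
  rw [h1]
  refine (abs_add_le _ _).trans ?_
  have h5 : |(N : ℝ)⁻¹ * ∑ q ∈ primQuads N, dens (qdet q) * e q| ≤ E * harmonicSum N ^ 2 * N := by
    rw [abs_mul, abs_of_nonneg (by positivity)]
    calc _ ≤ (N : ℝ)⁻¹ * (E * harmonicSum N ^ 2 * N ^ 2) :=
          mul_le_mul_of_nonneg_left (abs_sum_primQuads_dens_le he hE le_rfl) (by positivity)
      _ = _ := by field_simp
  have h6 := (Finset.abs_sum_le_sum_abs _ _).trans (Finset.sum_le_card_nsmul _ _ _ h4)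
  rw [Nat.card_Icc, Nat.add_sub_cancel, nsmul_eq_mul] at h6
  linarith

end Homogeneous

/-- The sums over bases agree up to the factor `8 / π`, for every linear form. -/
lemma abs_basisSum_sub_le {β γ : ℝ} (hβ : 0 < β) (hγ : 0 < γ) (n : ℕ) :
    |basisSum (fun U W Y Z => U + W + max Y Z) n β γ - 8 / Real.pi *
      basisSum (fun U W Y Z => √(U * W + U * Y + W * Z)) n β γ| ≤
      152 * (β + γ) * harmonicSum n ^ 4 * n := by
  have h := abs_sum_primQuads_inv_le (e := excess β γ) (N := n)
    (E := 76 * (β + γ) * harmonicSum n ^ 2) (fun κ hκ q => excess_mul β γ hκ q) ?_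
  · convert h using 1
    · unfold basisSum
      rw [Finset.mul_sum, ← Finset.sum_sub_distrib]
      refine congrArg _ (Finset.sum_congr rfl fun q _ => ?_)
      unfold excess
      ring
    · ring
  · intro d m hd hm
    refine (abs_sum_excess_le hβ hγ hd m).trans ?_
    have h1 := harmonicSum_mono hm
    have h2 := one_le_harmonicSum m
    gcongr

/-- The integrals of the two weights over a box agree up to the factor `8 / π`. -/
lemma abs_integral_basisSum_sub_le {Yb Zb : ℝ} (hYb : 0 ≤ Yb) (hZb : 0 ≤ Zb) (n : ℕ) :
    |(∫ p in Ioc 0 Yb ×ˢ Ioc 0 Zb, basisSum (fun U W Y Z => U + W + max Y Z) n p.1 p.2) -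
      8 / Real.pi * ∫ p in Ioc 0 Yb ×ˢ Ioc 0 Zb,
        basisSum (fun U W Y Z => √(U * W + U * Y + W * Z)) n p.1 p.2| ≤
      152 * (Yb + Zb) * harmonicSum n ^ 4 * n * (Yb * Zb) := by
  have hh := one_le_harmonicSum n
  rw [← integral_const_mul, ← integral_sub (integrableOn_basisSum isWeight_frob n Yb Zb)
    ((integrableOn_basisSum isWeight_sqrt n Yb Zb).const_mul _)]
  have hvol : volume.real (Ioc 0 Yb ×ˢ Ioc 0 Zb) = Yb * Zb := by
    rw [Measure.real, Measure.volume_eq_prod, Measure.prod_prod, Real.volume_Ioc, Real.volume_Ioc,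
      ENNReal.toReal_mul, ENNReal.toReal_ofReal (by linarith), ENNReal.toReal_ofReal (by linarith)]
    ring
  rw [← hvol, ← Real.norm_eq_abs]
  refine norm_setIntegral_le_of_norm_le_const ?_ ?_
  · rw [Measure.volume_eq_prod, Measure.prod_prod, Real.volume_Ioc, Real.volume_Ioc]
    exact ENNReal.mul_lt_top ENNReal.ofReal_lt_top ENNReal.ofReal_lt_top
  · rintro ⟨β, γ⟩ ⟨⟨h1, h2⟩, h3, h4⟩
    simp only at h1 h2 h3 h4 ⊢
    rw [Real.norm_eq_abs]
    refine (abs_basisSum_sub_le h1 h3 n).trans ?_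
    gcongr

/-! ### The estimate for a box -/

/-- The divisor function grows more slowly than any power: in the product over the primes `p ∣ n`
the factor `v + 1` is at most `p ^ (δ v)` as soon as `p ^ δ ≥ 2`, and the finitely many smaller
primes cost a bounded factor each. -/
lemma exists_card_divisors_le {δ : ℝ} (hδ : 0 < δ) :
    ∃ C : ℝ, 1 ≤ C ∧ ∀ n : ℕ, 0 < n → (n.divisors.card : ℝ) ≤ C * (n : ℝ) ^ δ := by
  obtain ⟨P, hP⟩ := exists_nat_ge ((2 : ℝ) ^ δ⁻¹)
  have hl : 0 < δ * Real.log 2 := mul_pos hδ (Real.log_pos one_lt_two)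
  set M := 1 + (δ * Real.log 2)⁻¹ with hM
  have hM1 : 1 ≤ M := by
    have : 0 ≤ (δ * Real.log 2)⁻¹ := by positivity
    linarith
  refine ⟨M ^ P, one_le_pow₀ hM1, fun n hn => ?_⟩
  have hfac : ∀ p ∈ n.primeFactors, ((n.factorization p : ℝ) + 1) ≤
      (if p < P then M else 1) * ((p ^ n.factorization p : ℕ) : ℝ) ^ δ := by
    intro p hp
    have hp2 : (2 : ℝ) ≤ p := by exact_mod_cast (Nat.prime_of_mem_primeFactors hp).two_le
    set v := n.factorization p
    have hv : ((p ^ v : ℕ) : ℝ) ^ δ = ((p : ℝ) ^ δ) ^ v := by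
      push_cast
      rw [← Real.rpow_natCast, ← Real.rpow_natCast, ← Real.rpow_mul (by positivity),
        ← Real.rpow_mul (by positivity), mul_comm]
    rw [hv]
    split_ifs with h
    · have h1 : 1 + δ * Real.log 2 ≤ (p : ℝ) ^ δ := by
        calc 1 + δ * Real.log 2 ≤ Real.exp (δ * Real.log 2) := by
              linarith [Real.add_one_le_exp (δ * Real.log 2)]
          _ = (2 : ℝ) ^ δ := by rw [Real.rpow_def_of_pos two_pos, mul_comm]
          _ ≤ _ := Real.rpow_le_rpow (by norm_num) hp2 hδ.le
      have h2 : 1 + v * (δ * Real.log 2) ≤ ((p : ℝ) ^ δ) ^ v :=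
        (one_add_mul_le_pow (by linarith) v).trans (pow_le_pow_left₀ (by positivity) h1 v)
      calc (v : ℝ) + 1 ≤ M * (1 + v * (δ * Real.log 2)) := by
            have : M * (1 + v * (δ * Real.log 2)) =
                1 + v + (v * (δ * Real.log 2) + (δ * Real.log 2)⁻¹) := by
              rw [hM]; field_simp; ring
            rw [this]
            have : 0 ≤ v * (δ * Real.log 2) + (δ * Real.log 2)⁻¹ := by positivity
            linarith
        _ ≤ _ := mul_le_mul_of_nonneg_left h2 (by linarith)
    · have h1 : (2 : ℝ) ≤ (p : ℝ) ^ δ := by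
        have h3 : (2 : ℝ) ^ δ⁻¹ ≤ p := hP.trans (by exact_mod_cast not_lt.1 h)
        calc (2 : ℝ) = ((2 : ℝ) ^ δ⁻¹) ^ δ := by
              rw [← Real.rpow_mul (by norm_num), inv_mul_cancel₀ hδ.ne', Real.rpow_one]
          _ ≤ _ := Real.rpow_le_rpow (by positivity) h3 hδ.le
      have h2 : (v : ℝ) + 1 ≤ 2 ^ v := by exact_mod_cast Nat.lt_two_pow_self
      rw [one_mul]
      exact h2.trans (pow_le_pow_left₀ (by norm_num) h1 v)
  have hprod : ∏ p ∈ n.primeFactors, ((p ^ n.factorization p : ℕ) : ℝ) ^ δ = (n : ℝ) ^ δ := by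
    rw [Real.finsetProd_rpow _ _ (fun p _ => Nat.cast_nonneg _)]
    congr 1
    conv_rhs => rw [← Nat.prod_factorization_pow_eq_self hn.ne',
      Nat.prod_factorization_eq_prod_primeFactors]
    push_cast
    rfl
  have hsmall : ∏ p ∈ n.primeFactors, (if p < P then M else 1) ≤ M ^ P := by
    rw [← Finset.prod_filter, Finset.prod_const]
    refine pow_le_pow_right₀ hM1 ?_
    have hsub : (n.primeFactors.filter fun p => p < P) ⊆ Finset.range P := fun p hp =>
      Finset.mem_range.2 (Finset.mem_filter.1 hp).2
    simpa using Finset.card_le_card hsub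
  rw [Nat.card_divisors hn.ne', ← hprod]
  push_cast
  refine (Finset.prod_le_prod (fun p _ => by positivity) hfac).trans ?_
  rw [Finset.prod_mul_distrib]
  push_cast
  exact mul_le_mul_of_nonneg_right hsmall (Finset.prod_nonneg fun p _ => by positivity)

lemma exists_harmonicSum_le {δ : ℝ} (hδ : 0 < δ) :
    ∃ C : ℝ, 1 ≤ C ∧ ∀ n : ℕ, 0 < n → harmonicSum n ≤ C * (n : ℝ) ^ δ := by
  refine ⟨1 + 2 ^ δ / δ, by linarith [show 0 ≤ (2 : ℝ) ^ δ / δ by positivity], fun n hn => ?_⟩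
  have hn1 : (1 : ℝ) ≤ n := by exact_mod_cast hn
  have h1 : harmonicSum n ≤ 1 + Real.log (n + 1) := by
    have := harmonic_le_one_add_log (n + 1)
    simpa [harmonicSum, harmonic] using this
  have h2 : Real.log ((n : ℝ) + 1) ≤ 2 ^ δ / δ * (n : ℝ) ^ δ := by
    calc _ ≤ ((n : ℝ) + 1) ^ δ / δ := Real.log_le_rpow_div (by positivity) hδ
      _ ≤ (2 * (n : ℝ)) ^ δ / δ := by
          have : ((n : ℝ) + 1) ^ δ ≤ (2 * (n : ℝ)) ^ δ :=
            Real.rpow_le_rpow (by positivity) (by linarith) hδ.le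
          gcongr
      _ = _ := by rw [Real.mul_rpow (by norm_num) (by positivity)]; ring
  have h3 : (1 : ℝ) ≤ (n : ℝ) ^ δ := Real.one_le_rpow hn1 hδ.le
  linarith

/-- The difference between `f(a, b, c)` and its mean value `(8 / π) √(a b c)`. -/
noncomputable def deviation (a b c : ℕ) : ℝ :=
  (frobeniusShifted a b c : ℝ) - 8 / Real.pi * √((a : ℝ) * (b : ℝ) * (c : ℝ))

/-- The sum of the deviations over the primitive triples in a box. -/
noncomputable def deviationSum (X Y Z : ℝ) : ℝ :=
  ∑ a ∈ Finset.Icc 1 ⌊X⌋₊, ∑ b ∈ Finset.Icc 1 ⌊Y⌋₊,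
    ∑ c ∈ Finset.Icc 1 ⌊Z⌋₊ with Nat.gcd (Nat.gcd a b) c = 1, deviation a b c

lemma deviation_swap_left (a b c : ℕ) : deviation b a c = deviation a b c := by
  have h : nonRepresentable b a c = nonRepresentable a b c := by
    ext k
    refine not_congr ⟨?_, ?_⟩ <;>
    · rintro ⟨x, y, z, h⟩
      exact ⟨y, x, z, by linarith⟩
  unfold deviation frobeniusShifted frobeniusInt
  rw [h, mul_comm (b : ℝ) a]
  push_cast
  ring

lemma deviation_swap_right (a b c : ℕ) : deviation a c b = deviation a b c := by
  have h : nonRepresentable a c b = nonRepresentable a b c := by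
    ext k
    refine not_congr ⟨?_, ?_⟩ <;>
    · rintro ⟨x, y, z, h⟩
      exact ⟨x, z, y, by linarith⟩
  unfold deviation frobeniusShifted frobeniusInt
  rw [h, mul_right_comm (a : ℝ) c b]
  push_cast
  ring

lemma deviationSum_swap_left (X Y Z : ℝ) : deviationSum Y X Z = deviationSum X Y Z := by
  unfold deviationSum
  rw [Finset.sum_comm]
  refine Finset.sum_congr rfl fun a _ => Finset.sum_congr rfl fun b _ => ?_
  rw [Nat.gcd_comm b a]
  exact Finset.sum_congr rfl fun c _ => deviation_swap_left a b c

lemma deviationSum_swap_right (X Y Z : ℝ) : deviationSum X Z Y = deviationSum X Y Z := by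
  unfold deviationSum
  simp only [Finset.sum_filter]
  refine Finset.sum_congr rfl fun a _ => ?_
  rw [Finset.sum_comm]
  refine Finset.sum_congr rfl fun b _ => Finset.sum_congr rfl fun c _ => ?_
  exact if_congr (by rw [Nat.gcd_assoc, Nat.gcd_comm c b, ← Nat.gcd_assoc])
    (deviation_swap_right a b c) rfl

/-- The bound in terms of the divisor function and harmonic sums, for a box whose shortest side is
the first one. -/
lemma abs_deviationSum_le {X Y Z T : ℝ} (hX : 0 ≤ X) (hY : X ≤ Y) (hZ : X ≤ Z)
    (hT : ∀ a : ℕ, 0 < a → a ≤ ⌊X⌋₊ → (a.divisors.card : ℝ) ≤ T) (hT0 : 0 ≤ T) :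
    |deviationSum X Y Z| ≤
      (32 * T * harmonicSum ⌊X⌋₊ ^ 3 + 152 * harmonicSum ⌊X⌋₊ ^ 4) * (X * Y * Z * (X + Y + Z)) := by
  have hY0 := hX.trans hY
  have hZ0 := hX.trans hZ
  have hpi : 8 / Real.pi ≤ 3 := by
    rw [div_le_iff₀ Real.pi_pos]; linarith [Real.pi_gt_three]
  have hpi0 : 0 ≤ 8 / Real.pi := by positivity
  have hh := one_le_harmonicSum ⌊X⌋₊
  have h1 := triple_sum_eq_integral isWeight_frob (fun a b c => (frobeniusShifted a b c : ℝ))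
    (fun a b c u w y z j k P hg => by
      have := P.frobeniusShifted_eq hg
      simp only [this]
      push_cast
      rfl) ⌊X⌋₊ hY0 hZ0 hT
  have h2 := triple_sum_eq_integral isWeight_sqrt
    (fun a b c => √((a : ℝ) * (b : ℝ) * (c : ℝ)))
    (fun a b c u w y z j k P hg => by
      simp only [P.a_eq]
      push_cast
      congr 1
      ring) ⌊X⌋₊ hY0 hZ0 hT
  have h3 := abs_integral_basisSum_sub_le hY0 hZ0 ⌊X⌋₊
  have e : deviationSum X Y Z = (∑ a ∈ Finset.Icc 1 ⌊X⌋₊, ∑ b ∈ Finset.Icc 1 ⌊Y⌋₊,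
      ∑ c ∈ Finset.Icc 1 ⌊Z⌋₊ with Nat.gcd (Nat.gcd a b) c = 1, (frobeniusShifted a b c : ℝ)) -
      8 / Real.pi * ∑ a ∈ Finset.Icc 1 ⌊X⌋₊, ∑ b ∈ Finset.Icc 1 ⌊Y⌋₊,
      ∑ c ∈ Finset.Icc 1 ⌊Z⌋₊ with Nat.gcd (Nat.gcd a b) c = 1, √((a : ℝ) * (b : ℝ) * (c : ℝ)) := by
    simp only [deviationSum, deviation, Finset.sum_sub_distrib, Finset.mul_sum]
  rw [e]
  set F := ∑ a ∈ Finset.Icc 1 ⌊X⌋₊, ∑ b ∈ Finset.Icc 1 ⌊Y⌋₊,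
      ∑ c ∈ Finset.Icc 1 ⌊Z⌋₊ with Nat.gcd (Nat.gcd a b) c = 1, (frobeniusShifted a b c : ℝ)
  set G := ∑ a ∈ Finset.Icc 1 ⌊X⌋₊, ∑ b ∈ Finset.Icc 1 ⌊Y⌋₊,
      ∑ c ∈ Finset.Icc 1 ⌊Z⌋₊ with Nat.gcd (Nat.gcd a b) c = 1, √((a : ℝ) * (b : ℝ) * (c : ℝ))
  set I := ∫ p in Ioc 0 Y ×ˢ Ioc 0 Z, basisSum (fun U W Y Z => U + W + max Y Z) ⌊X⌋₊ p.1 p.2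
  set J := ∫ p in Ioc 0 Y ×ˢ Ioc 0 Z,
    basisSum (fun U W Y Z => √(U * W + U * Y + W * Z)) ⌊X⌋₊ p.1 p.2
  set h := harmonicSum ⌊X⌋₊
  set n : ℝ := (⌊X⌋₊ : ℝ) with hn
  have hn0 : 0 ≤ n := Nat.cast_nonneg _
  have hnX : n ≤ X := Nat.floor_le hX
  have e2 : F - 8 / Real.pi * G = (F - I) - 8 / Real.pi * (G - J) + (I - 8 / Real.pi * J) := by ring
  have h4 : |8 / Real.pi * (G - J)| ≤ 3 * (8 * T * (Y ^ 2 + Z ^ 2) * (n ^ 2 * h ^ 3)) := by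
    rw [abs_mul, abs_of_nonneg hpi0]
    exact mul_le_mul hpi h2 (abs_nonneg _) (by norm_num)
  have h5 : n ^ 2 * (Y ^ 2 + Z ^ 2) ≤ X * Y * Z * (X + Y + Z) := by
    have h6 : n ^ 2 ≤ X ^ 2 := pow_le_pow_left₀ hn0 hnX 2
    have h7 : X ^ 2 * Y ^ 2 ≤ X * Y * Z * Y := by
      have : X * X * (Y * Y) ≤ X * Z * (Y * Y) := by gcongr
      linarith
    have h8 : X ^ 2 * Z ^ 2 ≤ X * Y * Z * Z := by
      have : X * X * (Z * Z) ≤ X * Y * (Z * Z) := by gcongr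
      linarith
    have h9 : n ^ 2 * (Y ^ 2 + Z ^ 2) ≤ X ^ 2 * (Y ^ 2 + Z ^ 2) := by gcongr
    have h10 : 0 ≤ X * Y * Z * X := by positivity
    linarith
  have h6 : n * (Y * Z) * (Y + Z) ≤ X * Y * Z * (X + Y + Z) := by
    calc _ ≤ X * (Y * Z) * (X + Y + Z) := by gcongr; linarith
      _ = _ := by ring
  rw [e2]
  calc _ ≤ |F - I| + |8 / Real.pi * (G - J)| + |I - 8 / Real.pi * J| :=
        (abs_add_le _ _).trans (add_le_add (abs_sub _ _) le_rfl)
    _ ≤ 8 * T * (Y ^ 2 + Z ^ 2) * (n ^ 2 * h ^ 3) +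
        3 * (8 * T * (Y ^ 2 + Z ^ 2) * (n ^ 2 * h ^ 3)) + 152 * (Y + Z) * h ^ 4 * n * (Y * Z) :=
        add_le_add (add_le_add h1 h4) h3
    _ = 32 * T * h ^ 3 * (n ^ 2 * (Y ^ 2 + Z ^ 2)) + 152 * h ^ 4 * (n * (Y * Z) * (Y + Z)) := by ring
    _ ≤ 32 * T * h ^ 3 * (X * Y * Z * (X + Y + Z)) + 152 * h ^ 4 * (X * Y * Z * (X + Y + Z)) :=
        add_le_add (mul_le_mul_of_nonneg_left h5 (by positivity))
          (mul_le_mul_of_nonneg_left h6 (by positivity))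
    _ = _ := by ring

lemma exists_abs_deviationSum_le {ε : ℝ} (hε : 0 < ε) : ∃ C : ℝ, 0 < C ∧ ∀ X Y Z : ℝ, 0 ≤ X →
    X ≤ Y → X ≤ Z → |deviationSum X Y Z| ≤ C * (X ^ ε * (X * Y * Z * (X + Y + Z))) := by
  -- the bound is of degree four in the divisor bound `T` and the harmonic sum
  have hδ : 0 < ε / 4 := by positivity
  obtain ⟨C, hC, hdiv⟩ := exists_card_divisors_le hδ
  obtain ⟨D, hD, hharm⟩ := exists_harmonicSum_le hδ
  refine ⟨32 * C * D ^ 3 + 152 * D ^ 4, by positivity, fun X Y Z hX hY hZ => ?_⟩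
  have hY0 := hX.trans hY
  have hZ0 := hX.trans hZ
  rcases Nat.eq_zero_or_pos ⌊X⌋₊ with h0 | h0
  · rw [deviationSum, h0]
    simp only [Finset.Icc_eq_empty_of_lt zero_lt_one, Finset.sum_empty, abs_zero]
    positivity
  set x := X ^ (ε / 4) with hx
  have hx0 : 0 ≤ x := by positivity
  have hfl : ∀ a : ℕ, a ≤ ⌊X⌋₊ → (a : ℝ) ^ (ε / 4) ≤ x := fun a ha =>
    Real.rpow_le_rpow (Nat.cast_nonneg _) ((Nat.cast_le.2 ha).trans (Nat.floor_le hX)) hδ.le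
  have hx4 : X ^ ε = x ^ 4 := by
    rw [hx, ← Real.rpow_natCast, ← Real.rpow_mul hX]
    congr 1
    push_cast
    ring
  have h1 := abs_deviationSum_le (T := C * x) hX hY hZ (fun a ha han => (hdiv a ha).trans
    (mul_le_mul_of_nonneg_left (hfl a han) (by linarith))) (by positivity)
  have h2 : harmonicSum ⌊X⌋₊ ≤ D * x :=
    (hharm _ h0).trans (mul_le_mul_of_nonneg_left (hfl _ le_rfl) (by linarith))
  have h3 := one_le_harmonicSum ⌊X⌋₊
  refine h1.trans ?_
  have h4 : 0 ≤ X * Y * Z * (X + Y + Z) := by positivity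
  calc _ ≤ (32 * (C * x) * (D * x) ^ 3 + 152 * (D * x) ^ 4) * (X * Y * Z * (X + Y + Z)) := by
        refine mul_le_mul_of_nonneg_right ?_ h4
        gcongr
    _ = _ := by rw [hx4]; ring

/-- The right hand side of the estimate dominates `m ^ ε` times the longest side of the box, for
any lower bound `m` of the sides. -/
lemma sum_mul_rpow_le {ε X Y Z m : ℝ} (hε : 0 < ε) (hm : 0 < m) (hX : m ≤ X) (hY : m ≤ Y)
    (hZ : m ≤ Z) : m ^ ε * (X + Y + Z) ≤
      3 * (X ^ (1 + ε) * (Z ^ ε / Y ^ ε) + Y ^ (1 + ε) * (Z ^ ε / X ^ ε) + Z ^ (1 + ε)) := by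
  have hX0 := hm.trans_le hX
  have hY0 := hm.trans_le hY
  have hZ0 := hm.trans_le hZ
  have hmZ : m ^ ε ≤ Z ^ ε := Real.rpow_le_rpow hm.le hZ hε.le
  have key : ∀ {A B : ℝ}, 0 < A → 0 < B → B ≤ A → m ^ ε * A ≤ A ^ (1 + ε) * (Z ^ ε / B ^ ε) := by
    intro A B hA hB hBA
    have h1 : B ^ ε ≤ A ^ ε := Real.rpow_le_rpow hB.le hBA hε.le
    have hB' : 0 < B ^ ε := by positivity
    rw [Real.rpow_add hA, Real.rpow_one]
    calc m ^ ε * A ≤ Z ^ ε * A := by gcongr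
      _ = A * B ^ ε * (Z ^ ε / B ^ ε) := by field_simp
      _ ≤ A * A ^ ε * (Z ^ ε / B ^ ε) := by gcongr
  have keyZ : m ^ ε * Z ≤ Z ^ (1 + ε) := by
    rw [Real.rpow_add hZ0, Real.rpow_one, mul_comm]
    gcongr
  have hm' : 0 < m ^ ε := by positivity
  have p1 : 0 ≤ X ^ (1 + ε) * (Z ^ ε / Y ^ ε) := by positivity
  have p2 : 0 ≤ Y ^ (1 + ε) * (Z ^ ε / X ^ ε) := by positivity
  have p3 : 0 ≤ Z ^ (1 + ε) := by positivity
  rcases le_total X Z with h1 | h1 <;> rcases le_total Y Z with h2 | h2 <;>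
    rcases le_total X Y with h3 | h3
  · nlinarith
  · nlinarith
  · have := key hY0 hX0 h3
    nlinarith
  · have := key hX0 hY0 h3
    nlinarith
  · have := key hY0 hX0 h3
    nlinarith
  · have := key hX0 hY0 h3
    nlinarith
  · have := key hY0 hX0 h3
    nlinarith
  · have := key hX0 hY0 h3
    nlinarith

lemma exists_abs_deviationSum_le_box {ε : ℝ} (hε : 0 < ε) : ∃ C : ℝ, 0 < C ∧ ∀ X Y Z : ℝ, 0 < X →
    0 < Y → 0 < Z → |deviationSum X Y Z| ≤ C * (X * Y * Z *
      (X ^ (1 + ε) * (Z ^ ε / Y ^ ε) + Y ^ (1 + ε) * (Z ^ ε / X ^ ε) + Z ^ (1 + ε))) := by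
  obtain ⟨C, hC, h⟩ := exists_abs_deviationSum_le hε
  refine ⟨C * 3, by positivity, fun X Y Z hX hY hZ => ?_⟩
  have main : ∃ m, 0 < m ∧ m ≤ X ∧ m ≤ Y ∧ m ≤ Z ∧
      |deviationSum X Y Z| ≤ C * (m ^ ε * (X * Y * Z * (X + Y + Z))) := by
    rcases le_total X Y with h1 | h1
    · rcases le_total X Z with h2 | h2
      · exact ⟨X, hX, le_rfl, h1, h2, h X Y Z hX.le h1 h2⟩
      · refine ⟨Z, hZ, h2, h2.trans h1, le_rfl, ?_⟩
        rw [← deviationSum_swap_right, ← deviationSum_swap_left]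
        refine (h Z X Y hZ.le h2 (h2.trans h1)).trans (le_of_eq ?_)
        ring
    · rcases le_total Y Z with h2 | h2
      · refine ⟨Y, hY, h1, le_rfl, h2, ?_⟩
        rw [← deviationSum_swap_left]
        refine (h Y X Z hY.le h1 h2).trans (le_of_eq ?_)
        ring
      · refine ⟨Z, hZ, h2.trans h1, h2, le_rfl, ?_⟩
        rw [← deviationSum_swap_right, ← deviationSum_swap_left]
        refine (h Z X Y hZ.le (h2.trans h1) h2).trans (le_of_eq ?_)
        ring
  obtain ⟨m, hm, hmX, hmY, hmZ, hmain⟩ := main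
  have h1 := sum_mul_rpow_le hε hm hmX hmY hmZ
  refine hmain.trans ?_
  calc _ = C * (X * Y * Z) * (m ^ ε * (X + Y + Z)) := by ring
    _ ≤ C * (X * Y * Z) * _ := mul_le_mul_of_nonneg_left h1 (by positivity)
    _ = _ := by ring

theorem theorem2 (ε : ℝ) (hε : 0 < ε) :
    ∃ K : ℝ, 0 < K ∧ ∀ x₁ x₂ x₃ N : ℝ, 0 < x₁ → 0 < x₂ → 0 < x₃ → 0 < N →
      |1 / (x₁ * x₂ * x₃ * N ^ (9 / 2 : ℝ)) *
          ∑ a ∈ Finset.Icc 1 ⌊x₁ * N⌋₊, ∑ b ∈ Finset.Icc 1 ⌊x₂ * N⌋₊,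
            ∑ c ∈ Finset.Icc 1 ⌊x₃ * N⌋₊ with Nat.gcd (Nat.gcd a b) c = 1,
              ((frobeniusShifted a b c : ℝ) -
                8 / Real.pi * Real.sqrt ((a : ℝ) * (b : ℝ) * (c : ℝ)))|
        ≤ K * (N ^ (-1 / 2 + ε : ℝ) *
            (x₁ ^ (1 + ε) * (x₃ ^ ε / x₂ ^ ε) + x₂ ^ (1 + ε) * (x₃ ^ ε / x₁ ^ ε)
              + x₃ ^ (1 + ε))) := by
  obtain ⟨K, hK, h⟩ := exists_abs_deviationSum_le_box hε
  refine ⟨K, hK, fun x₁ x₂ x₃ N h1 h2 h3 hN => ?_⟩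
  have h4 := h (x₁ * N) (x₂ * N) (x₃ * N) (by positivity) (by positivity) (by positivity)
  have hN' : 0 < N ^ ε := by positivity
  have e : ∀ {A B : ℝ}, 0 < A → 0 < B → (A * N) ^ (1 + ε) * ((x₃ * N) ^ ε / (B * N) ^ ε) =
      N ^ (1 + ε) * (A ^ (1 + ε) * (x₃ ^ ε / B ^ ε)) := by
    intro A B hA hB
    have hB' : 0 < B ^ ε := by positivity
    rw [Real.mul_rpow hA.le hN.le, Real.mul_rpow h3.le hN.le, Real.mul_rpow hB.le hN.le]
    field_simp
  rw [e h1 h2, e h2 h1, Real.mul_rpow h3.le hN.le, mul_comm (x₃ ^ (1 + ε)), ← mul_add,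
    ← mul_add] at h4
  have hpow : N ^ (-1 / 2 + ε : ℝ) * N ^ (9 / 2 : ℝ) = N ^ 3 * N ^ (1 + ε) := by
    rw [← Real.rpow_natCast, ← Real.rpow_add hN, ← Real.rpow_add hN]
    congr 1
    push_cast
    ring
  change |_ * deviationSum (x₁ * N) (x₂ * N) (x₃ * N)| ≤ _
  rw [abs_mul, abs_of_nonneg (by positivity), div_mul_eq_mul_div, one_mul,
    div_le_iff₀ (by positivity)]
  refine h4.trans (le_of_eq ?_)
  linear_combination (-K * (x₁ * x₂ * x₃) * (x₁ ^ (1 + ε) * (x₃ ^ ε / x₂ ^ ε) +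
    x₂ ^ (1 + ε) * (x₃ ^ ε / x₁ ^ ε) + x₃ ^ (1 + ε))) * hpow
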